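/- Let $(G,H)$ be a $b$-Lie group: $G$ is a (finite-dimensional, real) Lie group and $H\subset G$ is a closed subgroup of codimension one, and $G$ is regarded as a $b$-manifold with critical hypersurface $H$. For a $b$-manifold $(M,Z)$ let ${}^bTM$ be the $b$-tangent bundle (whose sections are the vector fields tangent to $Z$), ${}^bT^*M$ its dual, and $\tau^*_M:{}^bT^*M\to M$ the projection; ${}^bT^*M$ is a $b$-manifold with critical hypersurface ${}^bT^*M|_Z$, it carries the Liouville $b$-form $\lambda_M$, $(\lambda_M)_p(w)=\langle p,(\tau_M^*)_*w\rangle$, and the canonical $b$-symplectic form $\omega_M=-\mathrm d\lambda_M$. (A $b$-symplectic form is a closed $b$-form of degree $2$ that is nondegenerate on each fibre of the $b$-tangent bundle.) Let $H$ act on $G$ by left translations, with $\mathfrak h=T_eH$ and infinitesimal action $\zeta_g:\mathfrak h\to{}^bT_gG$, $\zeta_g(X)=\frac{d}{dt}\big|_{t=0}e^{tX}g$. Let $\pi:G\to G/H$ be the projection onto the orbit space (the space of cosets $Hg$), which is a one-dimensional $b$-manifold with critical hypersurface $\{[e]\}$. Let $\mathcal H^\circ\subset{}^bT^*G$ be the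 annihilator of the vertical bundle $\mathcal H_g=\zeta_g(\mathfrak h)$, with projection $\tau_G^*|_{\mathcal H^\circ}:\mathcal H^\circ\to G$, and let $\bar\pi:\mathcal H^\circ\to{}^bT^*(G/H)$ be the map with $\bar\pi(\alpha_g)\in {}^bT^*_{\pi(g)}(G/H)$ and $\langle\bar\pi(\alpha_g),\pi_*v\rangle=\langle\alpha_g,v\rangle$ for all $v\in{}^bT_gG$. The manifolds $\mathcal H^\circ$ and $\mathcal H^\circ\times\mathfrak h^*$ are $b$-manifolds with critical hypersurfaces $\mathcal H^\circ|_H$ and $\mathcal H^\circ|_H\times\mathfrak h^*$. Let $\theta$ be a principal $H$-$b$-connection for $\pi$, that is, a smooth $\mathfrak h$-valued $b$-form of degree $1$ on $(G,H)$ with $\theta_g(\zeta_g(X))=X$ and $\theta_{hg}((L_h)_*v)=\mathrm{Ad}_h(\theta_g(v))$ for all $g\in G$, $h\in H$, $X\in\mathfrak h$, $v\in{}^bT_gG$. Then the map $$\psi_\theta:{}^bT^*G\to\mathcal H^\circ\times\mathfrak h^*,\qquad \alpha_g\mapsto(\alpha_g-\alpha_g\circ\zeta_g\circ\theta_g,\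 \alpha_g\circ\zeta_g),$$ is a diffeomorphism, the forms $\omega_G$ on ${}^bT^*G$ and $\omega_{G/H}$ on ${}^bT^*(G/H)$ are $b$-symplectic, and $\psi_\theta$ transforms $\omega_G$ into the following $b$-symplectic form on $\mathcal H^\circ\times\mathfrak h^*$: $$(\psi_\theta)_*\omega_G=\bar\pi^*\omega_{G/H}-\mathrm d\lambda^\theta,$$ where $\bar\pi^*\omega_{G/H}$ is pulled back to $\mathcal H^\circ\times\mathfrak h^*$ along the projection onto the first factor, and $\lambda^\theta$ is the smooth $b$-form of degree $1$ on $\mathcal H^\circ\times\mathfrak h^*$ given by $$\lambda^\theta_{(\alpha,\mu)}(w,\phi)=\mu\big(((\tau_G^*|_{\mathcal H^\circ})^*\theta)(w)\big)$$ for all $\alpha\in\mathcal H^\circ$, $w\in{}^bT_\alpha\mathcal H^\circ$ and $\mu,\phi\in\mathfrak h^*$. -/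

import Mathlib

open scoped Manifold ContDiff

noncomputable section

namespace BGeom

open Set Filter Bundle
open scoped Topology

set_option linter.unusedSectionVars false

section

open Set Filter


/-- Smoothness of an integral over `[0, 1]` depending on a parameter. -/
theorem contDiff_integral_unit {E : Type*} [NormedAddCommGroup E] [NormedSpace ℝ E]
    {h : E → ℝ → ℝ} (hh : ContDiff ℝ ∞ (fun p : E × ℝ => h p.1 p.2)) :
    ContDiff ℝ ∞ (fun y => ∫ s in (0 : ℝ)..1, h y s) := by
  let χ : ContDiffBump (0 : ℝ) := ⟨2, 3, by norm_num, by norm_num⟩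
  have h2 : ContDiffOn ℝ ((⊤ : ℕ∞) : ℕ∞ω) (fun x : E =>
      MeasureTheory.convolution ((Ioc (0 : ℝ) 1).indicator (fun _ => (1 : ℝ)))
        (fun t => χ t * h x (-t)) (ContinuousLinearMap.mul ℝ ℝ) MeasureTheory.volume
        ((fun _ : E => (0 : ℝ)) x)) univ := by
    refine MeasureTheory.contDiffOn_convolution_right_with_param_comp
      (g := fun x t => χ t * h x (-t)) (k := Metric.closedBall 0 3)
      _ contDiffOn_const isOpen_univ (isCompact_closedBall _ _) ?_ ?_ ?_
    · intro p x _ hx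
      have : χ x = 0 := by
        apply χ.zero_of_le_dist
        simp only [Metric.mem_closedBall, not_le] at hx
        exact hx.le
      simp [this]
    · exact ((MeasureTheory.locallyIntegrable_const (1 : ℝ))).indicator measurableSet_Ioc
    · refine ContDiff.contDiffOn ?_
      have e1 : ContDiff ℝ ∞ (fun p : E × ℝ => χ p.2) := χ.contDiff.comp contDiff_snd
      have e2 : ContDiff ℝ ∞ (fun p : E × ℝ => h p.1 (-p.2)) :=
        hh.comp (contDiff_fst.prodMk contDiff_snd.neg)
      exact e1.mul e2
  rw [contDiffOn_univ] at h2
  convert h2 using 2 with y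
  rw [MeasureTheory.convolution_def, intervalIntegral.integral_of_le zero_le_one,
    ← MeasureTheory.integral_indicator measurableSet_Ioc]
  congr 1
  ext t
  by_cases ht : t ∈ Ioc (0 : ℝ) 1
  · have : χ (-t) = 1 := by
      apply χ.one_of_mem_closedBall
      simp only [Metric.mem_closedBall, dist_zero_right, norm_neg, Real.norm_eq_abs]
      rw [abs_of_pos ht.1]
      exact ht.2.trans (by norm_num)
    simp [ht, this]
  · simp [ht]

variable {E : Type*} [NormedAddCommGroup E] [NormedSpace ℝ E] [FiniteDimensional ℝ E]

theorem exists_contDiff_eq {V : Type*} [NormedAddCommGroup V] [NormedSpace ℝ V]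
    {g : E → V} {x : E} (hg : ∀ᶠ y in 𝓝 x, ContDiffAt ℝ ∞ g y) :
    ∃ g' : E → V, ContDiff ℝ ∞ g' ∧ g' =ᶠ[𝓝 x] g := by
  obtain ⟨r, hr, hb⟩ := Metric.eventually_nhds_iff_ball.1 hg
  let χ : ContDiffBump x := ⟨r / 4, r / 2, by positivity, by linarith⟩
  refine ⟨fun y => χ y • g y, ?_, ?_⟩
  · rw [contDiff_iff_contDiffAt]
    intro y
    by_cases hy : y ∈ Metric.ball x r
    · exact χ.contDiff.contDiffAt.smul (hb y hy)
    · have : (fun y => χ y • g y) =ᶠ[𝓝 y] fun _ => 0 := by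
        have : (Metric.closedBall x (r / 2))ᶜ ∈ 𝓝 y := by
          apply Metric.isClosed_closedBall.isOpen_compl.mem_nhds
          simp only [Metric.mem_ball, not_lt, mem_compl_iff, Metric.mem_closedBall, not_le] at hy ⊢
          linarith
        filter_upwards [this] with z hz
        have : χ z = 0 := χ.zero_of_le_dist (by
          simp only [mem_compl_iff, Metric.mem_closedBall, not_le] at hz; exact hz.le)
        simp [this]
      exact contDiffAt_const.congr_of_eventuallyEq this
  · filter_upwards [χ.eventuallyEq_one] with y hy
    simp [hy]

/-- Implicit function theorem for one smooth scalar equation, with a solution that is smooth on a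
neighbourhood. -/
theorem exists_implicit {Φ : E × ℝ → ℝ} {p : E × ℝ}
    (hΦ : ∀ᶠ v in 𝓝 p, ContDiffAt ℝ ∞ Φ v) (h0 : Φ p = 0) (h1 : fderiv ℝ Φ p (0, 1) ≠ 0) :
    ∃ τ : E → ℝ, τ p.1 = p.2 ∧ (∀ᶠ y in 𝓝 p.1, ContDiffAt ℝ ∞ τ y) ∧
      ∀ᶠ v in 𝓝 p, (Φ v = 0 ↔ τ v.1 = v.2) := by
  have inv : ∀ v, fderiv ℝ Φ v (0, 1) ≠ 0 → (fderiv ℝ Φ v ∘L .inr ℝ E ℝ).IsInvertible := by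
    intro v hv
    refine ⟨ContinuousLinearEquiv.unitsEquivAut ℝ (Units.mk0 _ hv), ?_⟩
    ext
    simp
  have hp := hΦ.self_of_nhds
  have n0 : (∞ : ℕ∞ω) ≠ 0 := by simp
  let τ := hp.implicitFunction n0 (inv p h1)
  have hτp : τ p.1 = p.2 := hp.implicitFunction_apply_self n0 (inv p h1)
  have hτs : ContDiffAt ℝ ∞ τ p.1 := hp.contDiffAt_implicitFunction n0 (inv p h1)
  have hτ : ∀ᶠ v in 𝓝 p, (Φ v = 0 ↔ τ v.1 = v.2) := by
    have := hp.eventually_apply_eq_iff_implicitFunction n0 (inv p h1)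
    simpa only [h0] using this
  refine ⟨τ, hτp, ?_, hτ⟩
  have hreg : ∀ᶠ v in 𝓝 p, fderiv ℝ Φ v (0, 1) ≠ 0 := by
    have : ContinuousAt (fun v => fderiv ℝ Φ v (0, 1)) p :=
      ((hp.fderiv_right (m := 0) (by simp)).continuousAt).clm_apply continuousAt_const
    exact this.eventually_ne h1
  have hall := (hΦ.and (hreg.and hτ)).eventually_nhds
  have hcont : Tendsto (fun y => (y, τ y)) (𝓝 p.1) (𝓝 p) := by
    have : ContinuousAt (fun y => (y, τ y)) p.1 := continuousAt_id.prodMk hτs.continuousAt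
    simpa [ContinuousAt, hτp] using this
  filter_upwards [hcont.eventually hall] with y hy
  obtain ⟨a, b, c⟩ := hy.self_of_nhds
  let σ := a.implicitFunction n0 (inv _ b)
  have hσs : ContDiffAt ℝ ∞ σ y := a.contDiffAt_implicitFunction n0 (inv _ b)
  have hσy : σ y = τ y := a.implicitFunction_apply_self n0 (inv _ b)
  have hσ : ∀ᶠ z in 𝓝 y, Φ (z, σ z) = Φ (y, τ y) := a.eventually_apply_implicitFunction n0 (inv _ b)
  have hc : Tendsto (fun z => (z, σ z)) (𝓝 y) (𝓝 (y, τ y)) := by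
    have : ContinuousAt (fun z => (z, σ z)) y := continuousAt_id.prodMk hσs.continuousAt
    simpa [ContinuousAt, hσy] using this
  refine hσs.congr_of_eventuallyEq ?_
  filter_upwards [hσ, hc.eventually hy] with z h1 h2
  have : Φ (y, τ y) = 0 := c.2 rfl
  exact h2.2.2.1 (h1.trans this)

theorem exists_smooth_quotient {K : E → ℝ} (hK : ContDiff ℝ ∞ K) {τ : E → ℝ}
    (hτ : ContDiff ℝ ∞ τ) (e : E) :
    ∃ G : E → ℝ, ContDiff ℝ ∞ G ∧ (∀ y, K y - K (y - τ y • e) = τ y * G y) ∧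
      ∀ y, τ y = 0 → G y = fderiv ℝ K y e := by
  have hdK : ContDiff ℝ ∞ (fderiv ℝ K) := hK.fderiv_right (by simp)
  refine ⟨fun y => ∫ s in (0 : ℝ)..1, fderiv ℝ K (y - (s * τ y) • e) e, ?_, ?_, ?_⟩
  · apply contDiff_integral_unit
      (h := fun y s => fderiv ℝ K (y - (s * τ y) • e) e)
    refine ContDiff.clm_apply (hdK.comp ?_) contDiff_const
    exact contDiff_fst.sub ((contDiff_snd.mul (hτ.comp contDiff_fst)).smul contDiff_const)
  · intro y
    have hd : ∀ s ∈ uIcc (0 : ℝ) 1, HasDerivAt (fun s => - K (y - (s * τ y) • e))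
        (τ y * fderiv ℝ K (y - (s * τ y) • e) e) s := by
      intro s _
      have h1 : HasDerivAt (fun s : ℝ => y - (s * τ y) • e) (-(τ y • e)) s := by
        have := (((hasDerivAt_id s).mul_const (τ y)).smul_const e).const_sub y
        simpa using this
      have h2 := ((hK.differentiable (by simp) (y - (s * τ y) • e)).hasFDerivAt.comp_hasDerivAt s
        h1).neg
      have h3 : -(fderiv ℝ K (y - (s * τ y) • e)) (-(τ y • e))
          = τ y * fderiv ℝ K (y - (s * τ y) • e) e := by simp
      rw [h3] at h2
      exact h2
    have hi : IntervalIntegrable (fun s => τ y * fderiv ℝ K (y - (s * τ y) • e) e)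
        MeasureTheory.volume 0 1 := by
      apply Continuous.intervalIntegrable
      refine continuous_const.mul (Continuous.clm_apply (hdK.continuous.comp ?_) continuous_const)
      fun_prop
    have := intervalIntegral.integral_eq_sub_of_hasDerivAt hd hi
    rw [← intervalIntegral.integral_const_mul, this]
    simp
    ring
  · intro y hy
    simp [hy]

/-- Division by a regular function: if `f` has a regular zero at `x` and `g` vanishes on the zero
set of `f`, then `g` is a smooth multiple of `f` near `x`. -/
theorem exists_eq_mul_of_regular {f g : E → ℝ} {x : E}
    (hf : ∀ᶠ y in 𝓝 x, ContDiffAt ℝ ∞ f y) (hfx : f x = 0) (hf' : fderiv ℝ f x ≠ 0)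
    (hg : ∀ᶠ y in 𝓝 x, ContDiffAt ℝ ∞ g y) (hfg : ∀ᶠ y in 𝓝 x, f y = 0 → g y = 0) :
    ∃ u : E → ℝ, (∀ᶠ y in 𝓝 x, ContDiffAt ℝ ∞ u y) ∧ ∀ᶠ y in 𝓝 x, g y = u y * f y := by
  obtain ⟨F, hF, hFf⟩ := exists_contDiff_eq hf
  obtain ⟨K, hK, hKg⟩ := exists_contDiff_eq hg
  have hFx : F x = 0 := by rw [hFf.eq_of_nhds, hfx]
  have hF' : fderiv ℝ F x ≠ 0 := by rwa [hFf.fderiv_eq]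
  obtain ⟨e, he⟩ : ∃ e, fderiv ℝ F x e ≠ 0 := by
    by_contra! h
    exact hF' (ContinuousLinearMap.ext h)
  let Φ : E × ℝ → ℝ := fun p => F (p.1 - p.2 • e)
  have hΦ : ContDiff ℝ ∞ Φ := hF.comp (contDiff_fst.sub (contDiff_snd.smul contDiff_const))
  have hΦ' : fderiv ℝ Φ (x, 0) (0, 1) ≠ 0 := by
    have h1 : HasFDerivAt (fun p : E × ℝ => p.1 - p.2 • e)
        (ContinuousLinearMap.fst ℝ E ℝ - (ContinuousLinearMap.snd ℝ E ℝ).smulRight e) (x, 0) := by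
      exact hasFDerivAt_fst.sub (hasFDerivAt_snd.smul_const e)
    have h2 : HasFDerivAt F (fderiv ℝ F x) ((fun p : E × ℝ => p.1 - p.2 • e) (x, 0)) := by
      simpa using (hF.differentiable (by simp) x).hasFDerivAt
    have h3 := (h2.comp (x, (0 : ℝ)) h1).fderiv
    change fderiv ℝ (F ∘ (fun p : E × ℝ => p.1 - p.2 • e)) (x, 0) (0, 1) ≠ 0
    rw [h3]
    simpa using he
  obtain ⟨τ₀, hτ₀x, hτ₀, hΦτ⟩ := exists_implicit (p := (x, (0 : ℝ)))
    (Eventually.of_forall fun v => hΦ.contDiffAt) (by simp [Φ, hFx]) hΦ'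
  obtain ⟨τ, hτ, hττ⟩ := exists_contDiff_eq hτ₀
  have hτx : τ x = 0 := by rw [hττ.eq_of_nhds]; exact hτ₀x
  have hc : Tendsto (fun y => (y, τ y)) (𝓝 x) (𝓝 (x, 0)) := by
    have : ContinuousAt (fun y => (y, τ y)) x := continuousAt_id.prodMk hτ.continuous.continuousAt
    simpa [ContinuousAt, hτx] using this
  have hc' : Tendsto (fun y => y - τ y • e) (𝓝 x) (𝓝 x) := by
    have : ContinuousAt (fun y => y - τ y • e) x := by
      have := hτ.continuous
      fun_prop
    simpa [ContinuousAt, hτx] using this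
  have hFτ : ∀ᶠ y in 𝓝 x, F (y - τ y • e) = 0 := by
    filter_upwards [hc.eventually hΦτ, hττ] with y h1 h2
    exact h1.2 h2.symm
  have hKτ : ∀ᶠ y in 𝓝 x, K (y - τ y • e) = 0 := by
    filter_upwards [hFτ, hc'.eventually hFf, hc'.eventually hKg, hc'.eventually hfg]
      with y h1 h2 h3 h4
    rw [h3, h4 (h2 ▸ h1)]
  obtain ⟨A, hA, hA1, hA2⟩ := exists_smooth_quotient hF hτ e
  obtain ⟨B, hB, hB1, -⟩ := exists_smooth_quotient hK hτ e
  have hAx : A x ≠ 0 := by rw [hA2 x hτx]; exact he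
  have hAe : ∀ᶠ y in 𝓝 x, A y ≠ 0 := hA.continuous.continuousAt.eventually_ne hAx
  refine ⟨fun y => B y / A y, ?_, ?_⟩
  · filter_upwards [hAe] with y hy
    exact hB.contDiffAt.div hA.contDiffAt hy
  · filter_upwards [hAe, hFτ, hKτ, hFf, hKg] with y h1 h2 h3 h4 h5
    have a := hA1 y
    have b := hB1 y
    rw [h2, sub_zero] at a
    rw [h3, sub_zero] at b
    rw [← h4, ← h5, a, b]
    field_simp

end

section

section Defs

variable {E : Type*} [NormedAddCommGroup E] [NormedSpace ℝ E]
  {B : Type*} [TopologicalSpace B] (I : ModelWithCorners ℝ E B)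
  {M : Type*} [TopologicalSpace M] [ChartedSpace B M] (Z : Set M)

/-- `f` is, near `x`, a local defining function for `Z`: it is smooth, its zero set is `Z`, and it
is regular on `Z`. (Off `Z` this says that `f` is smooth and does not vanish near `x`.) -/
structure IsDefFun (f : M → ℝ) (x : M) : Prop where
  smooth : ∀ᶠ y in 𝓝 x, ContMDiffAt I 𝓘(ℝ) ∞ f y
  zero_iff : ∀ᶠ y in 𝓝 x, (f y = 0 ↔ y ∈ Z)
  regular : x ∈ Z → mfderiv I 𝓘(ℝ) f x ≠ 0

/-- `Z` is a (closed, embedded) hypersurface of `M`, that is, `(M, Z)` is a `b`-manifold. -/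
class IsHypersurface : Prop where
  exists_defFun : ∀ x, ∃ f, IsDefFun I Z f x
/-- The derivative of a real function along a tangent vector. -/
def dir (f : M → ℝ) (x : M) (v : TangentSpace I x) : ℝ := mfderiv I 𝓘(ℝ) f x v

theorem dir_add (f : M → ℝ) {x : M} (v w : TangentSpace I x) :
    dir I f x (v + w) = dir I f x v + dir I f x w :=
  map_add (mfderiv I 𝓘(ℝ) f x) v w

theorem dir_smul (f : M → ℝ) {x : M} (c : ℝ) (v : TangentSpace I x) :
    dir I f x (c • v) = c * dir I f x v :=
  map_smul (mfderiv I 𝓘(ℝ) f x) c v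

/-- The fibre `ᵇT_x M` of the `b`-tangent bundle of `(M, Z)`. A `b`-tangent vector consists of a
tangent vector `v` and of the values `D f = ⟨df / f, ·⟩` on the logarithmic differentials of all
local defining functions `f` of `Z` at `x`; these satisfy `⟨df, v⟩ = f(x) D f`, so that `v` is
tangent to `Z` if `x ∈ Z`, and `D (u f) = D f + ⟨du, v⟩ / u(x)`.
(For the junk arguments `f` the value `D f` is `0`.) -/
def bTangentSubmodule (x : M) : Submodule ℝ (TangentSpace I x × ((M → ℝ) → ℝ)) where
  carrier := {b | (∀ f, ¬ IsDefFun I Z f x → b.2 f = 0) ∧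
    (∀ f, IsDefFun I Z f x → dir I f x b.1 = f x * b.2 f) ∧
    ∀ f f' u, IsDefFun I Z f x → IsDefFun I Z f' x → (∀ᶠ y in 𝓝 x, ContMDiffAt I 𝓘(ℝ) ∞ u y) →
      (∀ᶠ y in 𝓝 x, f' y = u y * f y) → b.2 f' = b.2 f + dir I u x b.1 / u x}
  add_mem' := by
    rintro a b ⟨a1, a2, a3⟩ ⟨b1, b2, b3⟩
    refine ⟨fun f hf => by simp [a1 f hf, b1 f hf], fun f hf => ?_, fun f f' u hf hf' hu h => ?_⟩
    · have := a2 f hf; have := b2 f hf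
      simp only [dir, Prod.fst_add, map_add, Prod.snd_add, Pi.add_apply] at *
      rw [mul_add]
      exact congrArg₂ (· + ·) ‹_› ‹_›
    · have h1 := a3 f f' u hf hf' hu h
      have h2 := b3 f f' u hf hf' hu h
      have h3 : dir I u x (a + b).1 = dir I u x a.1 + dir I u x b.1 := by
        exact map_add (mfderiv I 𝓘(ℝ) u x) a.1 b.1
      simp only [Prod.snd_add, Pi.add_apply, h1, h2, h3]
      ring
  zero_mem' := by
    refine ⟨fun f hf => rfl, fun f hf => ?_, fun f f' u hf hf' hu h => ?_⟩
    · have : dir I f x 0 = 0 := map_zero (mfderiv I 𝓘(ℝ) f x)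
      simp [this]
    · have : dir I u x 0 = 0 := map_zero (mfderiv I 𝓘(ℝ) u x)
      simp [this]
  smul_mem' := by
    rintro c a ⟨a1, a2, a3⟩
    have h0 : ∀ u, dir I u x (c • a).1 = c * dir I u x a.1 := fun u =>
      map_smul (mfderiv I 𝓘(ℝ) u x) c a.1
    refine ⟨fun f hf => by simp [a1 f hf], fun f hf => ?_, fun f f' u hf hf' hu h => ?_⟩
    · rw [h0, a2 f hf]
      simp only [Prod.smul_snd, Pi.smul_apply, smul_eq_mul]
      ring
    · rw [h0]
      simp only [Prod.smul_snd, Pi.smul_apply, smul_eq_mul, a3 f f' u hf hf' hu h]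
      ring

def BTangent (x : M) : Type _ := bTangentSubmodule I Z x

namespace BTangent

variable (x : M)

instance : AddCommGroup (BTangent I Z x) := inferInstanceAs (AddCommGroup (bTangentSubmodule I Z x))
instance : Module ℝ (BTangent I Z x) := inferInstanceAs (Module ℝ (bTangentSubmodule I Z x))
instance : TopologicalSpace (BTangent I Z x) :=
  inferInstanceAs (TopologicalSpace (bTangentSubmodule I Z x))
instance : IsTopologicalAddGroup (BTangent I Z x) :=
  inferInstanceAs (IsTopologicalAddGroup (bTangentSubmodule I Z x))
instance : ContinuousSMul ℝ (BTangent I Z x) :=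
  inferInstanceAs (ContinuousSMul ℝ (bTangentSubmodule I Z x))

variable {x}

/-- The anchor `ᵇT_x M → T_x M`. -/
def anchor : BTangent I Z x →L[ℝ] TangentSpace I x :=
  (ContinuousLinearMap.fst ℝ _ _).comp (bTangentSubmodule I Z x).subtypeL

/-- The `b`-covector `df / f` at `x`, for a local defining function `f`. -/
def dlog (f : M → ℝ) : BTangent I Z x →L[ℝ] ℝ :=
  (ContinuousLinearMap.proj (R := ℝ) (φ := fun _ : M → ℝ => ℝ) f).comp
    ((ContinuousLinearMap.snd ℝ _ _).comp (bTangentSubmodule I Z x).subtypeL)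

variable {I Z}

theorem dir_anchor (b : BTangent I Z x) {f : M → ℝ} (hf : IsDefFun I Z f x) :
    dir I f x (anchor I Z b) = f x * dlog I Z f b := b.2.2.1 f hf

theorem dlog_mul (b : BTangent I Z x) {f f' u : M → ℝ} (hf : IsDefFun I Z f x)
    (hf' : IsDefFun I Z f' x) (hu : ∀ᶠ y in 𝓝 x, ContMDiffAt I 𝓘(ℝ) ∞ u y)
    (h : ∀ᶠ y in 𝓝 x, f' y = u y * f y) :
    dlog I Z f' b = dlog I Z f b + dir I u x (anchor I Z b) / u x := b.2.2.2 f f' u hf hf' hu h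

end BTangent

end Defs

end

section

section Charts

variable {E : Type*} [NormedAddCommGroup E] [NormedSpace ℝ E]
  {M : Type*} [TopologicalSpace M] [ChartedSpace E M]
  {V : Type*} [NormedAddCommGroup V] [NormedSpace ℝ V]
  {φ : OpenPartialHomeomorph M E} {x : M}

theorem contMDiffAt_comp_symm [IsManifold 𝓘(ℝ, E) ∞ M] (hφ : φ ∈ atlas E M) {F : M → V}
    (hx : x ∈ φ.source) (h : ContMDiffAt 𝓘(ℝ, E) 𝓘(ℝ, V) ∞ F x) :
    ContDiffAt ℝ ∞ (F ∘ φ.symm) (φ x) := by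
  rw [← contMDiffAt_iff_contDiffAt]
  refine ContMDiffAt.comp (φ x) (I' := 𝓘(ℝ, E)) (by rwa [φ.left_inv hx]) ?_
  exact contMDiffAt_symm_of_mem_maximalAtlas (IsManifold.subset_maximalAtlas hφ) (φ.map_source hx)

theorem contMDiffAt_comp_chart [IsManifold 𝓘(ℝ, E) ∞ M] (hφ : φ ∈ atlas E M) {F : E → V}
    (hx : x ∈ φ.source) (h : ContDiffAt ℝ ∞ F (φ x)) :
    ContMDiffAt 𝓘(ℝ, E) 𝓘(ℝ, V) ∞ (F ∘ φ) x :=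
  h.contMDiffAt.comp x (contMDiffAt_of_mem_maximalAtlas (IsManifold.subset_maximalAtlas hφ) hx)

/-- The derivative of the inverse of a chart. -/
def chartVec (φ : OpenPartialHomeomorph M E) (x : M) : E →L[ℝ] TangentSpace 𝓘(ℝ, E) x :=
  mfderiv 𝓘(ℝ, E) 𝓘(ℝ, E) φ.symm (φ x)

/-- The derivative of a chart. -/
def chartCoord (φ : OpenPartialHomeomorph M E) (x : M) : TangentSpace 𝓘(ℝ, E) x →L[ℝ] E :=
  mfderiv 𝓘(ℝ, E) 𝓘(ℝ, E) φ x

theorem chartVec_chartCoord [IsManifold 𝓘(ℝ, E) ∞ M] (hφ : φ ∈ atlas E M) (hx : x ∈ φ.source)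
    (v : TangentSpace 𝓘(ℝ, E) x) : chartVec φ x (chartCoord φ x v) = v := by
  have : IsManifold 𝓘(ℝ, E) 1 M := IsManifold.of_le (n := ∞) (by simp)
  have he := mdifferentiable_of_mem_atlas (I := 𝓘(ℝ, E)) hφ
  exact (he.mfderiv hx).left_inv v

theorem chartCoord_chartVec [IsManifold 𝓘(ℝ, E) ∞ M] (hφ : φ ∈ atlas E M) (hx : x ∈ φ.source)
    (w : E) : chartCoord φ x (chartVec φ x w) = w := by
  have : IsManifold 𝓘(ℝ, E) 1 M := IsManifold.of_le (n := ∞) (by simp)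
  have he := mdifferentiable_of_mem_atlas (I := 𝓘(ℝ, E)) hφ
  exact (he.mfderiv hx).right_inv w

theorem mfderiv_chartVec [IsManifold 𝓘(ℝ, E) ∞ M] (hφ : φ ∈ atlas E M) {F : M → V}
    (hx : x ∈ φ.source) (h : ContMDiffAt 𝓘(ℝ, E) 𝓘(ℝ, V) ∞ F x) (w : E) :
    mfderiv 𝓘(ℝ, E) 𝓘(ℝ, V) F x (chartVec φ x w) = fderiv ℝ (F ∘ φ.symm) (φ x) w := by
  have : IsManifold 𝓘(ℝ, E) 1 M := IsManifold.of_le (n := ∞) (by simp)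
  have he := mdifferentiable_of_mem_atlas (I := 𝓘(ℝ, E)) hφ
  have h1 : MDifferentiableAt 𝓘(ℝ, E) 𝓘(ℝ, V) F (φ.symm (φ x)) := by
    rw [φ.left_inv hx]; exact h.mdifferentiableAt (by simp)
  have h2 := mfderiv_comp (φ x) h1 (he.mdifferentiableAt_symm (φ.map_source hx))
  rw [← mfderiv_eq_fderiv, h2, φ.left_inv hx]
  rfl

theorem contMDiffAt_fderiv_chart [IsManifold 𝓘(ℝ, E) ∞ M] (hφ : φ ∈ atlas E M) {F : M → V}
    (hx : x ∈ φ.source) (h : ContMDiffAt 𝓘(ℝ, E) 𝓘(ℝ, V) ∞ F x) :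
    ContMDiffAt 𝓘(ℝ, E) 𝓘(ℝ, E →L[ℝ] V) ∞ (fun y => fderiv ℝ (F ∘ φ.symm) (φ y)) x :=
  contMDiffAt_comp_chart (V := E →L[ℝ] V) hφ hx
    ((contMDiffAt_comp_symm hφ hx h).fderiv_right (by simp))

/-- Division by a regular function on a manifold. -/
theorem exists_eq_mul_of_isDefFun [FiniteDimensional ℝ E] [IsManifold 𝓘(ℝ, E) ∞ M] {Z : Set M}
    {f g : M → ℝ} (hf : IsDefFun 𝓘(ℝ, E) Z f x) (hx : x ∈ Z)
    (hg : ∀ᶠ y in 𝓝 x, ContMDiffAt 𝓘(ℝ, E) 𝓘(ℝ) ∞ g y) (hgZ : ∀ᶠ y in 𝓝 x, y ∈ Z → g y = 0) :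
    ∃ u : M → ℝ, (∀ᶠ y in 𝓝 x, ContMDiffAt 𝓘(ℝ, E) 𝓘(ℝ) ∞ u y) ∧ ∀ᶠ y in 𝓝 x, g y = u y * f y := by
  set φ := chartAt E x
  have hφ : φ ∈ atlas E M := chart_mem_atlas E x
  have hxs : x ∈ φ.source := mem_chart_source E x
  have src := φ.open_source.mem_nhds hxs
  have key := exists_eq_mul_of_regular (f := f ∘ φ.symm) (g := g ∘ φ.symm) (x := φ x) ?_ ?_ ?_ ?_ ?_
  · obtain ⟨u, hu, h⟩ := key
    refine ⟨u ∘ φ, ?_, ?_⟩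
    · filter_upwards [(φ.eventually_nhds _ hxs).1 hu, src] with y hy hys
      exact contMDiffAt_comp_chart hφ hys hy
    · filter_upwards [(φ.eventually_nhds _ hxs).1 h, src] with y hy hys
      simpa [φ.left_inv hys] using hy
  · rw [φ.eventually_nhds _ hxs]
    filter_upwards [hf.smooth, src] with y hy hys
    exact contMDiffAt_comp_symm hφ hys hy
  · simpa [φ.left_inv hxs] using hf.zero_iff.self_of_nhds.2 hx
  · intro h0
    apply hf.regular hx
    ext v
    have := mfderiv_chartVec hφ hxs hf.smooth.self_of_nhds (chartCoord φ x v)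
    rw [chartVec_chartCoord hφ hxs, h0] at this
    exact this
  · rw [φ.eventually_nhds _ hxs]
    filter_upwards [hg, src] with y hy hys
    exact contMDiffAt_comp_symm hφ hys hy
  · rw [φ.eventually_nhds _ hxs]
    filter_upwards [hf.zero_iff, hgZ, src] with y h1 h2 hys
    simp only [Function.comp, φ.left_inv hys]
    exact fun h => h2 (h1.1 h)

theorem dir_mul {u g : M → ℝ} (hu : ContMDiffAt 𝓘(ℝ, E) 𝓘(ℝ) ∞ u x)
    (hg : ContMDiffAt 𝓘(ℝ, E) 𝓘(ℝ) ∞ g x) (v : TangentSpace 𝓘(ℝ, E) x) :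
    dir 𝓘(ℝ, E) (u * g) x v = u x * dir 𝓘(ℝ, E) g x v + g x * dir 𝓘(ℝ, E) u x v := by
  have h1 := (hu.mdifferentiableAt (by simp)).hasMFDerivAt.mul
      (hg.mdifferentiableAt (by simp)).hasMFDerivAt
  unfold dir
  rw [h1.mfderiv]
  rfl

theorem dir_congr {f g : M → ℝ} (h : f =ᶠ[𝓝 x] g) (v : TangentSpace 𝓘(ℝ, E) x) :
    dir 𝓘(ℝ, E) f x v = dir 𝓘(ℝ, E) g x v := by
  unfold dir
  rw [h.mfderiv_eq]
  rfl

namespace IsDefFun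

variable [IsManifold 𝓘(ℝ, E) ∞ M] {Z : Set M} {f f' : M → ℝ}

protected theorem eventually (hf : IsDefFun 𝓘(ℝ, E) Z f x) :
    ∀ᶠ y in 𝓝 x, IsDefFun 𝓘(ℝ, E) Z f y := by
  have hreg : ∀ᶠ y in 𝓝 x, y ∈ Z → mfderiv 𝓘(ℝ, E) 𝓘(ℝ) f y ≠ 0 := by
    set φ := chartAt E x
    have hφ : φ ∈ atlas E M := chart_mem_atlas E x
    have hxs : x ∈ φ.source := mem_chart_source E x
    by_cases hx : x ∈ Z
    · have h1 : fderiv ℝ (f ∘ φ.symm) (φ x) ≠ 0 := by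
        intro h0
        apply hf.regular hx
        ext v
        have := mfderiv_chartVec hφ hxs hf.smooth.self_of_nhds (chartCoord φ x v)
        rw [chartVec_chartCoord hφ hxs, h0] at this
        exact this
      have h2 := (contMDiffAt_fderiv_chart hφ hxs hf.smooth.self_of_nhds).continuousAt
      filter_upwards [h2.eventually_ne h1, hf.smooth, φ.open_source.mem_nhds hxs]
        with y hy hs hys _ h0
      apply hy
      ext w
      have := mfderiv_chartVec hφ hys hs w
      rw [h0] at this
      exact this.symm
    · have h1 : f x ≠ 0 := fun h => hx (hf.zero_iff.self_of_nhds.1 h)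
      filter_upwards [hf.smooth.self_of_nhds.continuousAt.eventually_ne h1, hf.zero_iff]
        with y hy hz hyZ
      exact absurd (hz.2 hyZ) hy
  filter_upwards [hf.smooth.eventually_nhds, hf.zero_iff.eventually_nhds, hreg] with y h1 h2 h3
  exact ⟨h1, h2, h3⟩

/-- The complement of a hypersurface is dense. -/
theorem frequently_ne (hf : IsDefFun 𝓘(ℝ, E) Z f x) : ∃ᶠ y in 𝓝 x, f y ≠ 0 := by
  intro h
  simp only [ne_eq, not_not] at h
  have hx : x ∈ Z := hf.zero_iff.self_of_nhds.1 h.self_of_nhds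
  apply hf.regular hx
  have : f =ᶠ[𝓝 x] fun _ => 0 := h
  rw [this.mfderiv_eq, mfderiv_const]
  rfl

/-- The ratio of two local defining functions is unique. -/
theorem ratio_unique (hf : IsDefFun 𝓘(ℝ, E) Z f x) {u u' : M → ℝ}
    (hu : ∀ᶠ y in 𝓝 x, ContMDiffAt 𝓘(ℝ, E) 𝓘(ℝ) ∞ u y)
    (hu' : ∀ᶠ y in 𝓝 x, ContMDiffAt 𝓘(ℝ, E) 𝓘(ℝ) ∞ u' y)
    (h : ∀ᶠ y in 𝓝 x, u y * f y = u' y * f y) : u =ᶠ[𝓝 x] u' := by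
  filter_upwards [hf.eventually, hu, hu', h.eventually_nhds] with y h1 h2 h3 h4
  by_contra hne
  have h5 : ∀ᶠ z in 𝓝 y, u z ≠ u' z := by
    filter_upwards [(h2.continuousAt.sub h3.continuousAt).eventually_ne (sub_ne_zero.2 hne)] with z hz
    exact sub_ne_zero.1 hz
  apply h1.frequently_ne
  filter_upwards [h5, h4] with z a b
  rw [not_not]
  by_contra hz
  exact a (mul_right_cancel₀ hz b)

theorem exists_ratio [FiniteDimensional ℝ E] (hf : IsDefFun 𝓘(ℝ, E) Z f x)
    (hf' : IsDefFun 𝓘(ℝ, E) Z f' x) :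
    ∃ u : M → ℝ, (∀ᶠ y in 𝓝 x, ContMDiffAt 𝓘(ℝ, E) 𝓘(ℝ) ∞ u y) ∧
      (∀ᶠ y in 𝓝 x, f' y = u y * f y) := by
  by_cases hx : x ∈ Z
  · refine exists_eq_mul_of_isDefFun hf hx hf'.smooth ?_
    filter_upwards [hf'.zero_iff] with y hy hyZ using hy.2 hyZ
  · have h1 : f x ≠ 0 := fun h => hx (hf.zero_iff.self_of_nhds.1 h)
    have h2 := hf.smooth.self_of_nhds.continuousAt.eventually_ne h1
    refine ⟨fun y => f' y / f y, ?_, ?_⟩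
    · filter_upwards [h2, hf.smooth, hf'.smooth] with y a b c
      exact c.div₀ b a
    · filter_upwards [h2] with y a
      field_simp

theorem ratio_ne_zero (hf : IsDefFun 𝓘(ℝ, E) Z f x) (hf' : IsDefFun 𝓘(ℝ, E) Z f' x) {u : M → ℝ}
    (hu : ∀ᶠ y in 𝓝 x, ContMDiffAt 𝓘(ℝ, E) 𝓘(ℝ) ∞ u y) (h : ∀ᶠ y in 𝓝 x, f' y = u y * f y) :
    u x ≠ 0 := by
  intro h0
  by_cases hx : x ∈ Z
  · apply hf'.regular hx
    have e : f' =ᶠ[𝓝 x] u * f := h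
    ext v
    have := dir_congr e v
    rw [dir_mul hu.self_of_nhds hf.smooth.self_of_nhds, h0, hf.zero_iff.self_of_nhds.2 hx] at this
    exact (by simpa using this : dir 𝓘(ℝ, E) f' x v = 0)
  · exact hx (hf'.zero_iff.self_of_nhds.1 (by simp [h.self_of_nhds, h0]))

end IsDefFun

end Charts

end

section

/-- A family of local frames of a family `Fib` of vector spaces over `M`, with smooth changes of
frame. -/
structure FrameFamily {E M : Type*} [NormedAddCommGroup E] [NormedSpace ℝ E]
    [TopologicalSpace M] [ChartedSpace E M] (F : Type*) [NormedAddCommGroup F] [NormedSpace ℝ F]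
    [FiniteDimensional ℝ F] (Fib : M → Type*) [∀ x, AddCommGroup (Fib x)] [∀ x, Module ℝ (Fib x)]
    [∀ x, TopologicalSpace (Fib x)] where
  ι : Type*
  U : ι → Set M
  isOpen : ∀ i, IsOpen (U i)
  coord : ∀ (_ : ι) (x : M), Fib x →L[ℝ] F
  vec : ∀ (_ : ι) (x : M), F →ₗ[ℝ] Fib x
  continuous_vec : ∀ i x, Continuous (vec i x)
  coord_vec : ∀ i, ∀ x ∈ U i, ∀ w, coord i x (vec i x w) = w
  vec_coord : ∀ i, ∀ x ∈ U i, ∀ b, vec i x (coord i x b) = b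
  idx : M → ι
  mem_idx : ∀ x, x ∈ U (idx x)
  smooth : ∀ i j, ∀ x ∈ U i ∩ U j, ContMDiffAt 𝓘(ℝ, E) 𝓘(ℝ, F →L[ℝ] F) ∞
    (fun y => LinearMap.toContinuousLinearMap ((coord j y).toLinearMap ∘ₗ vec i y)) x

namespace FrameFamily

variable {E M : Type*} [NormedAddCommGroup E] [NormedSpace ℝ E]
    [TopologicalSpace M] [ChartedSpace E M] {F : Type*} [NormedAddCommGroup F] [NormedSpace ℝ F]
    [FiniteDimensional ℝ F] {Fib : M → Type*} [∀ x, AddCommGroup (Fib x)] [∀ x, Module ℝ (Fib x)]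
    [∀ x, TopologicalSpace (Fib x)] (A : FrameFamily (E := E) F Fib)

def pretriv (i : A.ι) : Pretrivialization F (π F Fib) where
  toFun p := (p.1, A.coord i p.1 p.2)
  invFun q := ⟨q.1, A.vec i q.1 q.2⟩
  source := π F Fib ⁻¹' A.U i
  target := A.U i ×ˢ univ
  map_source' := fun p hp => ⟨hp, mem_univ _⟩
  map_target' := fun q hq => hq.1
  left_inv' := by
    rintro ⟨x, b⟩ hx
    exact congrArg (TotalSpace.mk x) (A.vec_coord i x hx b)
  right_inv' := by
    rintro ⟨x, w⟩ ⟨hx, -⟩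
    exact congrArg (Prod.mk x) (A.coord_vec i x hx w)
  open_target := (A.isOpen i).prod isOpen_univ
  baseSet := A.U i
  open_baseSet := A.isOpen i
  source_eq := rfl
  target_eq := rfl
  proj_toFun := fun p _ => rfl

theorem pretriv_symm {i : A.ι} {x : M} (hx : x ∈ A.U i) (w : F) :
    (A.pretriv i).symm x w = A.vec i x w := by
  have h := (A.pretriv i).symm_apply (b := x) hx w
  rw [h]
  rfl

/-- The vector bundle structure defined by a family of frames. -/
def prebundle : VectorPrebundle ℝ F Fib where
  pretrivializationAtlas := range A.pretriv
  pretrivialization_linear' := by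
    rintro _ ⟨i, rfl⟩
    exact ⟨fun x _ => (A.coord i x).toLinearMap.isLinear⟩
  pretrivializationAt x := A.pretriv (A.idx x)
  mem_base_pretrivializationAt := A.mem_idx
  pretrivialization_mem_atlas x := ⟨_, rfl⟩
  exists_coordChange := by
    rintro _ ⟨i, rfl⟩ _ ⟨j, rfl⟩
    refine ⟨fun y => LinearMap.toContinuousLinearMap ((A.coord j y).toLinearMap ∘ₗ A.vec i y),
      fun x hx => (A.smooth i j x hx).continuousAt.continuousWithinAt, fun x hx w => ?_⟩
    rw [A.pretriv_symm hx.1]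
    rfl
  totalSpaceMk_isInducing x := by
    have : Topology.IsInducing (A.coord (A.idx x) x) := by
      let e : Fib x ≃ₜ F :=
        { toFun := A.coord (A.idx x) x
          invFun := A.vec (A.idx x) x
          left_inv := A.vec_coord _ x (A.mem_idx x)
          right_inv := A.coord_vec _ x (A.mem_idx x)
          continuous_toFun := (A.coord (A.idx x) x).continuous
          continuous_invFun := A.continuous_vec _ x }
      exact e.isInducing
    exact Topology.isInducing_const_prod.2 this

instance : A.prebundle.IsContMDiff 𝓘(ℝ, E) ∞ where
  exists_contMDiffCoordChange := by
    rintro _ ⟨i, rfl⟩ _ ⟨j, rfl⟩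
    refine ⟨fun y => LinearMap.toContinuousLinearMap ((A.coord j y).toLinearMap ∘ₗ A.vec i y),
      fun x hx => (A.smooth i j x hx).contMDiffWithinAt, fun x hx w => ?_⟩
    rw [A.pretriv_symm hx.1]
    rfl

end FrameFamily

end

section

section

variable {E : Type*} [NormedAddCommGroup E] [NormedSpace ℝ E] [FiniteDimensional ℝ E]
  {M : Type*} [TopologicalSpace M] [ChartedSpace E M] [IsManifold 𝓘(ℝ, E) ∞ M]
  {Z : Set M} {x : M}

namespace BTangent

theorem ext_of_dlog {b b' : BTangent 𝓘(ℝ, E) Z x} {f : M → ℝ} (hf : IsDefFun 𝓘(ℝ, E) Z f x)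
    (h1 : anchor _ Z b = anchor _ Z b') (h2 : dlog _ Z f b = dlog _ Z f b') : b = b' := by
  apply Subtype.ext
  refine Prod.ext h1 (funext fun f' => ?_)
  by_cases hf' : IsDefFun 𝓘(ℝ, E) Z f' x
  · obtain ⟨u, hu, hu'⟩ := hf.exists_ratio hf'
    have e1 := dlog_mul b hf hf' hu hu'
    have e2 := dlog_mul b' hf hf' hu hu'
    rw [h1, h2, ← e2] at e1
    exact e1
  · exact (b.2.1 f' hf').trans (b'.2.1 f' hf').symm

open Classical in
/-- A `b`-tangent vector is determined by its anchor and one logarithmic derivative. -/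
theorem exists_eq {f : M → ℝ} (hf : IsDefFun 𝓘(ℝ, E) Z f x) (v : TangentSpace 𝓘(ℝ, E) x) (c : ℝ)
    (h : dir 𝓘(ℝ, E) f x v = f x * c) :
    ∃ b : BTangent 𝓘(ℝ, E) Z x, anchor _ Z b = v ∧ dlog _ Z f b = c := by
  choose r hr hr' using fun f' (hf' : IsDefFun 𝓘(ℝ, E) Z f' x) => hf.exists_ratio hf'
  have key : ∀ f' hf' u, (∀ᶠ y in 𝓝 x, ContMDiffAt 𝓘(ℝ, E) 𝓘(ℝ) ∞ u y) →
      (∀ᶠ y in 𝓝 x, f' y = u y * f y) → r f' hf' =ᶠ[𝓝 x] u := by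
    intro f' hf' u hu hu'
    refine hf.ratio_unique (hr f' hf') hu ?_
    filter_upwards [hr' f' hf', hu'] with y a b
    rw [← a, b]
  let D : (M → ℝ) → ℝ := fun f' =>
    if hf' : IsDefFun 𝓘(ℝ, E) Z f' x then c + dir 𝓘(ℝ, E) (r f' hf') x v / r f' hf' x else 0
  have hD : ∀ f' (hf' : IsDefFun 𝓘(ℝ, E) Z f' x),
    D f' = c + dir 𝓘(ℝ, E) (r f' hf') x v / r f' hf' x := fun f' hf' => dif_pos hf'
  refine ⟨⟨(v, D), fun f' hf' => dif_neg hf', fun f' hf' => ?_, fun f₁ f₂ u h1 h2 hu hu' => ?_⟩,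
    rfl, ?_⟩
  · have e : f' =ᶠ[𝓝 x] r f' hf' * f := hr' f' hf'
    have := hf.ratio_ne_zero hf' (hr f' hf') (hr' f' hf')
    simp only [hD f' hf']
    rw [dir_congr e, dir_mul (hr f' hf').self_of_nhds hf.smooth.self_of_nhds, h, e.self_of_nhds,
      Pi.mul_apply]
    field_simp
  · have n1 := hf.ratio_ne_zero h1 (hr f₁ h1) (hr' f₁ h1)
    have nu := h1.ratio_ne_zero h2 hu hu'
    have e : r f₂ h2 =ᶠ[𝓝 x] u * r f₁ h1 := by
      refine key f₂ h2 _ ?_ ?_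
      · filter_upwards [hu, hr f₁ h1] with y a b using a.mul b
      · filter_upwards [hu', hr' f₁ h1] with y a b
        rw [a, b, Pi.mul_apply, mul_assoc]
    simp only [hD f₁ h1, hD f₂ h2]
    rw [dir_congr e, dir_mul hu.self_of_nhds (hr f₁ h1).self_of_nhds, e.self_of_nhds, Pi.mul_apply]
    field_simp
    ring
  · have e : r f hf =ᶠ[𝓝 x] fun _ => 1 :=
      key f hf _ (Eventually.of_forall fun y => contMDiffAt_const) (by simp)
    change D f = c
    rw [hD f hf, dir_congr e]
    have h0 : dir 𝓘(ℝ, E) (fun _ : M => (1 : ℝ)) x v = 0 := by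
      unfold dir
      rw [mfderiv_const]
      rfl
    rw [h0, zero_div, add_zero]

end BTangent

open BTangent

variable (Z) in
/-- The data of a local frame of the `b`-tangent bundle: a chart `φ`, a local defining function
`f` and a vector field `ε` transverse to `f`; the frame is obtained from the coordinate frame
by rescaling with `f` in the direction of `ε`. -/
structure BFrame where
  φ : OpenPartialHomeomorph M E
  f : M → ℝ
  ε : M → E
  U : Set M
  φ_mem : φ ∈ atlas E M
  isOpen : IsOpen U
  subset : U ⊆ φ.source
  isDefFun : ∀ y ∈ U, IsDefFun 𝓘(ℝ, E) Z f y
  smooth : ∀ y ∈ U, ContMDiffAt 𝓘(ℝ, E) 𝓘(ℝ, E) ∞ ε y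
  norm : ∀ y ∈ U, (f y - 1) * (dir 𝓘(ℝ, E) f y (chartVec φ y (ε y)) - 1) = 0

theorem dir_chartVec {φ : OpenPartialHomeomorph M E} (hφ : φ ∈ atlas E M) (hx : x ∈ φ.source)
    {f : M → ℝ} (hf : ContMDiffAt 𝓘(ℝ, E) 𝓘(ℝ) ∞ f x) (w : E) :
    dir 𝓘(ℝ, E) f x (chartVec φ x w) = fderiv ℝ (f ∘ φ.symm) (φ x) w :=
  mfderiv_chartVec hφ hx hf w

namespace BFrame

variable (A : BFrame (E := E) Z)

/-- The coordinates of a `b`-tangent vector in a frame. -/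
def coord (y : M) : BTangent 𝓘(ℝ, E) Z y →L[ℝ] E :=
  (chartCoord A.φ y).comp (anchor _ Z) + (1 - A.f y) • (dlog _ Z A.f).smulRight (A.ε y)

/-- The anchor of the `b`-tangent vector with given coordinates. -/
def vecAnchor (y : M) (w : E) : TangentSpace 𝓘(ℝ, E) y :=
  chartVec A.φ y (w + ((A.f y - 1) * dir 𝓘(ℝ, E) A.f y (chartVec A.φ y w)) • A.ε y)

theorem exists_vec {y : M} (hy : y ∈ A.U) (w : E) :
    ∃ b : BTangent 𝓘(ℝ, E) Z y, anchor _ Z b = A.vecAnchor y w ∧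
      dlog _ Z A.f b = dir 𝓘(ℝ, E) A.f y (chartVec A.φ y w) := by
  refine exists_eq (A.isDefFun y hy) _ _ ?_
  have := A.norm y hy
  rw [vecAnchor, map_add, map_smul, dir_add, dir_smul]
  linear_combination (dir 𝓘(ℝ, E) A.f y (chartVec A.φ y w)) * this

theorem coord_eq {y : M} (hy : y ∈ A.U) (w : E) {b : BTangent 𝓘(ℝ, E) Z y}
    (h1 : anchor _ Z b = A.vecAnchor y w)
    (h2 : dlog _ Z A.f b = dir 𝓘(ℝ, E) A.f y (chartVec A.φ y w)) : A.coord y b = w := by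
  have : A.coord y b = chartCoord A.φ y (anchor _ Z b) + (1 - A.f y) • (dlog _ Z A.f b) • A.ε y :=
    rfl
  rw [this, h1, h2, vecAnchor, chartCoord_chartVec A.φ_mem (A.subset hy), smul_smul, add_assoc,
    ← add_smul]
  simp only [add_eq_left]
  convert zero_smul ℝ _ using 2
  ring

theorem vec_eq {y : M} (hy : y ∈ A.U) (b : BTangent 𝓘(ℝ, E) Z y) :
    anchor _ Z b = A.vecAnchor y (A.coord y b) ∧
      dlog _ Z A.f b = dir 𝓘(ℝ, E) A.f y (chartVec A.φ y (A.coord y b)) := by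
  have e : A.coord y b = chartCoord A.φ y (anchor _ Z b) + (1 - A.f y) • (dlog _ Z A.f b) • A.ε y :=
    rfl
  have h0 := dir_anchor b (A.isDefFun y hy)
  have hn := A.norm y hy
  have h2 : dir 𝓘(ℝ, E) A.f y (chartVec A.φ y (A.coord y b)) = dlog _ Z A.f b := by
    rw [e, map_add, map_smul, map_smul, dir_add, dir_smul, dir_smul,
      chartVec_chartCoord A.φ_mem (A.subset hy), h0]
    linear_combination (- dlog 𝓘(ℝ, E) Z A.f b) * hn
  refine ⟨?_, h2.symm⟩
  rw [vecAnchor, h2, e, smul_smul, add_assoc, ← add_smul]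
  have : (1 - A.f y) * dlog 𝓘(ℝ, E) Z A.f b + (A.f y - 1) * dlog 𝓘(ℝ, E) Z A.f b = 0 := by ring
  rw [this, zero_smul, add_zero, chartVec_chartCoord A.φ_mem (A.subset hy)]

theorem coord_bijective {y : M} (hy : y ∈ A.U) : Function.Bijective (A.coord y) := by
  constructor
  · intro b b' h
    have h1 := A.vec_eq hy b
    have h2 := A.vec_eq hy b'
    rw [← h] at h2
    exact ext_of_dlog (A.isDefFun y hy) (h1.1.trans h2.1.symm) (h1.2.trans h2.2.symm)
  · intro w
    obtain ⟨b, h1, h2⟩ := A.exists_vec hy w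
    exact ⟨b, A.coord_eq hy w h1 h2⟩

open Classical in
/-- The `b`-tangent vector with given coordinates in a frame. -/
def vec (y : M) : E →ₗ[ℝ] BTangent 𝓘(ℝ, E) Z y :=
  if hy : y ∈ A.U then
    (LinearEquiv.ofBijective (A.coord y).toLinearMap (A.coord_bijective hy)).symm.toLinearMap
  else 0

theorem coord_vec {y : M} (hy : y ∈ A.U) (w : E) : A.coord y (A.vec y w) = w := by
  rw [vec, dif_pos hy]
  exact (LinearEquiv.ofBijective (A.coord y).toLinearMap (A.coord_bijective hy)).apply_symm_apply w

theorem vec_coord {y : M} (hy : y ∈ A.U) (b : BTangent 𝓘(ℝ, E) Z y) : A.vec y (A.coord y b) = b :=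
  (A.coord_bijective hy).1 (A.coord_vec hy _)

theorem anchor_vec {y : M} (hy : y ∈ A.U) (w : E) : anchor _ Z (A.vec y w) = A.vecAnchor y w := by
  have := (A.vec_eq hy (A.vec y w)).1
  rwa [A.coord_vec hy] at this

theorem dlog_vec {y : M} (hy : y ∈ A.U) (w : E) :
    dlog _ Z A.f (A.vec y w) = dir 𝓘(ℝ, E) A.f y (chartVec A.φ y w) := by
  have := (A.vec_eq hy (A.vec y w)).2
  rwa [A.coord_vec hy] at this

/-- The coordinate expression of the anchor in a frame. -/
def anchorCoord (y : M) : E →L[ℝ] E :=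
  ContinuousLinearMap.id ℝ E +
    (A.f y - 1) • (fderiv ℝ (A.f ∘ A.φ.symm) (A.φ y)).smulRight (A.ε y)

theorem vecAnchor_eq {y : M} (hy : y ∈ A.U) (w : E) :
    A.vecAnchor y w = chartVec A.φ y (A.anchorCoord y w) := by
  rw [vecAnchor, dir_chartVec A.φ_mem (A.subset hy) (A.isDefFun y hy).smooth.self_of_nhds]
  simp [anchorCoord, smul_smul]

theorem contMDiffAt_f (hx : x ∈ A.U) : ContMDiffAt 𝓘(ℝ, E) 𝓘(ℝ) ∞ A.f x :=
  (A.isDefFun x hx).smooth.self_of_nhds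

theorem contMDiffAt_anchorCoord (hx : x ∈ A.U) :
    ContMDiffAt 𝓘(ℝ, E) 𝓘(ℝ, E →L[ℝ] E) ∞ A.anchorCoord x := by
  have h1 := contMDiffAt_fderiv_chart A.φ_mem (A.subset hx) (A.contMDiffAt_f hx)
  have h2 : ContMDiffAt 𝓘(ℝ, E) 𝓘(ℝ, E →L[ℝ] E) ∞
      (fun y => ContinuousLinearMap.smulRightL ℝ E E (fderiv ℝ (A.f ∘ A.φ.symm) (A.φ y)) (A.ε y)) x :=
    (contMDiffAt_const.clm_apply h1).clm_apply (A.smooth x hx)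
  exact contMDiffAt_const.add (((A.contMDiffAt_f hx).sub contMDiffAt_const).smul h2)

/-- In a frame, the logarithmic differentials of local defining functions are smooth. -/
theorem contMDiffAt_dlog (hx : x ∈ A.U) {f : M → ℝ} (hf : IsDefFun 𝓘(ℝ, E) Z f x) :
    ContMDiffAt 𝓘(ℝ, E) 𝓘(ℝ, E →L[ℝ] ℝ) ∞
      (fun y => LinearMap.toContinuousLinearMap ((dlog _ Z f).toLinearMap ∘ₗ A.vec y)) x := by
  obtain ⟨u, hu, hu'⟩ := (A.isDefFun x hx).exists_ratio hf
  have u0 := (A.isDefFun x hx).ratio_ne_zero hf hu hu'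
  have h1 := contMDiffAt_fderiv_chart A.φ_mem (A.subset hx) (A.contMDiffAt_f hx)
  have h2 := contMDiffAt_fderiv_chart A.φ_mem (A.subset hx) hu.self_of_nhds
  have h3 : ContMDiffAt 𝓘(ℝ, E) 𝓘(ℝ, E →L[ℝ] ℝ) ∞ (fun y =>
      fderiv ℝ (A.f ∘ A.φ.symm) (A.φ y) +
        (u y)⁻¹ • (fderiv ℝ (u ∘ A.φ.symm) (A.φ y)).comp (A.anchorCoord y)) x :=
    h1.add ((hu.self_of_nhds.inv₀ u0).smul (h2.clm_comp (A.contMDiffAt_anchorCoord hx)))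
  refine h3.congr_of_eventuallyEq ?_
  filter_upwards [A.isOpen.mem_nhds hx, hf.eventually, hu.eventually_nhds, hu'.eventually_nhds]
    with y hy hfy huy huy'
  ext w
  have := dlog_mul (A.vec y w) (A.isDefFun y hy) hfy huy huy'
  simp only [LinearMap.coe_toContinuousLinearMap', LinearMap.comp_apply,
    ContinuousLinearMap.coe_coe, _root_.add_apply, _root_.smul_apply,
    ContinuousLinearMap.comp_apply, smul_eq_mul]
  rw [this, A.dlog_vec hy, A.anchor_vec hy, A.vecAnchor_eq hy,
    dir_chartVec A.φ_mem (A.subset hy) huy.self_of_nhds,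
    dir_chartVec A.φ_mem (A.subset hy) (A.contMDiffAt_f hy)]
  ring

theorem contMDiffAt_change (A' : BFrame (E := E) Z) (hx : x ∈ A.U ∩ A'.U) :
    ContMDiffAt 𝓘(ℝ, E) 𝓘(ℝ, E →L[ℝ] E) ∞
      (fun y => LinearMap.toContinuousLinearMap ((A'.coord y).toLinearMap ∘ₗ A.vec y)) x := by
  have hφ' : ContMDiffAt 𝓘(ℝ, E) 𝓘(ℝ, E) ∞ A'.φ x :=
    contMDiffAt_of_mem_maximalAtlas (IsManifold.subset_maximalAtlas A'.φ_mem) (A'.subset hx.2)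
  have h1 := contMDiffAt_fderiv_chart A.φ_mem (A.subset hx.1) hφ'
  have h2 : ContMDiffAt 𝓘(ℝ, E) 𝓘(ℝ, E →L[ℝ] E) ∞ (fun y => ContinuousLinearMap.smulRightL ℝ E E
      (LinearMap.toContinuousLinearMap ((dlog _ Z A'.f).toLinearMap ∘ₗ A.vec y)) (A'.ε y)) x :=
    (contMDiffAt_const.clm_apply (A.contMDiffAt_dlog hx.1 (A'.isDefFun x hx.2))).clm_apply
      (A'.smooth x hx.2)
  have h3 : ContMDiffAt 𝓘(ℝ, E) 𝓘(ℝ, E →L[ℝ] E) ∞ (fun y =>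
      (fderiv ℝ (A'.φ ∘ A.φ.symm) (A.φ y)).comp (A.anchorCoord y) +
      (1 - A'.f y) • ContinuousLinearMap.smulRightL ℝ E E
      (LinearMap.toContinuousLinearMap ((dlog _ Z A'.f).toLinearMap ∘ₗ A.vec y)) (A'.ε y)) x :=
    (h1.clm_comp (A.contMDiffAt_anchorCoord hx.1)).add
      ((contMDiffAt_const.sub (A'.contMDiffAt_f hx.2)).smul h2)
  refine h3.congr_of_eventuallyEq ?_
  filter_upwards [A.isOpen.mem_nhds hx.1, A'.isOpen.mem_nhds hx.2] with y hy hy'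
  ext w
  have e : A'.coord y (A.vec y w) = chartCoord A'.φ y (anchor _ Z (A.vec y w)) +
    (1 - A'.f y) • (dlog _ Z A'.f (A.vec y w)) • A'.ε y := rfl
  have hφ'y : ContMDiffAt 𝓘(ℝ, E) 𝓘(ℝ, E) ∞ A'.φ y :=
    contMDiffAt_of_mem_maximalAtlas (IsManifold.subset_maximalAtlas A'.φ_mem) (A'.subset hy')
  have e2 : chartCoord A'.φ y (chartVec A.φ y (A.anchorCoord y w)) =
      fderiv ℝ (A'.φ ∘ A.φ.symm) (A.φ y) (A.anchorCoord y w) :=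
    mfderiv_chartVec A.φ_mem (A.subset hy) hφ'y (A.anchorCoord y w)
  rw [A.anchor_vec hy, A.vecAnchor_eq hy, e2] at e
  simpa using e

end BFrame

variable (Z) in
theorem exists_bFrame [hZ : IsHypersurface 𝓘(ℝ, E) Z] (x : M) :
    ∃ A : BFrame (E := E) Z, x ∈ A.U := by
  obtain ⟨f, hf⟩ := hZ.exists_defFun x
  set φ := chartAt E x
  have hφ : φ ∈ atlas E M := chart_mem_atlas E x
  have hxs : x ∈ φ.source := mem_chart_source E x
  by_cases hx : x ∈ Z
  · obtain ⟨e, he⟩ : ∃ e, fderiv ℝ (f ∘ φ.symm) (φ x) e ≠ 0 := by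
      by_contra! h
      apply hf.regular hx
      ext v
      have := mfderiv_chartVec hφ hxs hf.smooth.self_of_nhds (chartCoord φ x v)
      rw [chartVec_chartCoord hφ hxs, h] at this
      exact this
    have hd := (contMDiffAt_fderiv_chart hφ hxs hf.smooth.self_of_nhds).clm_apply
      (contMDiffAt_const (c := e))
    obtain ⟨U, hU, hUo, hxU⟩ := eventually_nhds_iff.1 (hf.eventually.and
      ((hd.continuousAt.eventually_ne he).and (φ.open_source.mem_nhds hxs)))
    refine ⟨⟨φ, f, fun y => (fderiv ℝ (f ∘ φ.symm) (φ y) e)⁻¹ • e, U, hφ, hUo,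
      fun y hy => (hU y hy).2.2, fun y hy => (hU y hy).1, fun y hy => ?_, fun y hy => ?_⟩, hxU⟩
    · exact (((contMDiffAt_fderiv_chart hφ (hU y hy).2.2 (hU y hy).1.smooth.self_of_nhds).clm_apply
        (contMDiffAt_const (c := e))).inv₀ (hU y hy).2.1).smul contMDiffAt_const
    · rw [map_smul, dir_smul, dir_chartVec hφ (hU y hy).2.2 (hU y hy).1.smooth.self_of_nhds,
        inv_mul_cancel₀ (hU y hy).2.1]
      simp
  · have hc : ∀ᶠ y in 𝓝 x, y ∉ Z := by
      have h1 : f x ≠ 0 := fun h => hx (hf.zero_iff.self_of_nhds.1 h)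
      filter_upwards [hf.smooth.self_of_nhds.continuousAt.eventually_ne h1, hf.zero_iff]
        with y a b c using a (b.2 c)
    obtain ⟨U, hU, hUo, hxU⟩ := eventually_nhds_iff.1 (hc.and (φ.open_source.mem_nhds hxs))
    refine ⟨⟨φ, fun _ => 1, fun _ => 0, U, hφ, hUo,
      fun y hy => (hU y hy).2, fun y hy => ⟨?_, ?_, ?_⟩, fun y hy => ?_, fun y hy => ?_⟩, hxU⟩
    · exact Eventually.of_forall fun _ => contMDiffAt_const
    · filter_upwards [hUo.mem_nhds hy] with z hz
      simp [(hU z hz).1]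
    · exact fun h => absurd h (hU y hy).1
    · exact contMDiffAt_const
    · simp

variable (E Z) in
/-- The local frames of the `b`-tangent bundle. -/
def bFrameFamily [IsHypersurface 𝓘(ℝ, E) Z] : FrameFamily (E := E) E (BTangent 𝓘(ℝ, E) Z) where
  ι := BFrame (E := E) Z
  U A := A.U
  isOpen A := A.isOpen
  coord A := A.coord
  vec A := A.vec
  continuous_vec A y := (A.vec y).continuous_of_finiteDimensional
  coord_vec A _ hy w := A.coord_vec hy w
  vec_coord A _ hy b := A.vec_coord hy b
  idx x := (exists_bFrame Z x).choose
  mem_idx x := (exists_bFrame Z x).choose_spec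
  smooth A A' _ hx := A.contMDiffAt_change A' hx

section Instances

variable [IsHypersurface 𝓘(ℝ, E) Z]

instance : TopologicalSpace (TotalSpace E (BTangent 𝓘(ℝ, E) Z)) :=
  (bFrameFamily E Z).prebundle.totalSpaceTopology

instance : FiberBundle E (BTangent 𝓘(ℝ, E) Z) := (bFrameFamily E Z).prebundle.toFiberBundle

instance : VectorBundle ℝ E (BTangent 𝓘(ℝ, E) Z) := (bFrameFamily E Z).prebundle.toVectorBundle

instance : ContMDiffVectorBundle ∞ E (BTangent 𝓘(ℝ, E) Z) 𝓘(ℝ, E) :=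
  (bFrameFamily E Z).prebundle.contMDiffVectorBundle 𝓘(ℝ, E)

end Instances

variable (E Z) in
/-- The `b`-cotangent bundle. -/
abbrev BCotangentBundle : Type _ :=
  TotalSpace (E →L[ℝ] ℝ) (fun x : M => BTangent 𝓘(ℝ, E) Z x →L[ℝ] ℝ)

end

end

section

open BTangent

section Lift

variable {E : Type*} [NormedAddCommGroup E] [NormedSpace ℝ E]
  {B : Type*} [TopologicalSpace B] (I : ModelWithCorners ℝ E B)
  {M : Type*} [TopologicalSpace M] [ChartedSpace B M] [IsManifold I ∞ M] (Z : Set M)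

/-- A vector field on `M` that is smooth near `x` and tangent to `Z` near `x`: a `b`-vector field
near `x`. -/
def IsBVectorFieldAt (V : ∀ x : M, TangentSpace I x) (x : M) : Prop :=
  (∀ᶠ y in 𝓝 x, ContMDiffAt I I.tangent ∞ (fun z => (⟨z, V z⟩ : TangentBundle I M)) y) ∧
    ∀ᶠ y in 𝓝 x, y ∈ Z → ∀ f, IsDefFun I Z f y → dir I f y (V y) = 0

/-- `b` is the value at `x` of the vector field `V`, regarded as a section of the `b`-tangent
bundle: its anchor is `V x` and `⟨df / f, b⟩` is the value at `x` of the extension of the function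
`V f / f` across `Z`. -/
def IsBLift (V : ∀ x : M, TangentSpace I x) (x : M) (b : BTangent I Z x) : Prop :=
  anchor I Z b = V x ∧ ∀ f, IsDefFun I Z f x →
    Tendsto (fun y => dir I f y (V y) / f y) (𝓝[Zᶜ] x) (𝓝 (dlog I Z f b))

open Classical in
/-- The section of the `b`-tangent bundle defined by a `b`-vector field. -/
def bLift (V : ∀ x : M, TangentSpace I x) (x : M) : BTangent I Z x :=
  if h : ∃ b, IsBLift I Z V x b then h.choose else 0

end Lift

section

variable {E : Type*} [NormedAddCommGroup E] [NormedSpace ℝ E] [FiniteDimensional ℝ E]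
  {M : Type*} [TopologicalSpace M] [ChartedSpace E M] [IsManifold 𝓘(ℝ, E) ∞ M]
  {Z : Set M} {x : M}

theorem contMDiffAt_dir {f : M → ℝ} {V : ∀ x : M, TangentSpace 𝓘(ℝ, E) x}
    (hf : ContMDiffAt 𝓘(ℝ, E) 𝓘(ℝ) ∞ f x)
    (hf' : ∀ᶠ y in 𝓝 x, ContMDiffAt 𝓘(ℝ, E) 𝓘(ℝ) ∞ f y)
    (hV : ContMDiffAt 𝓘(ℝ, E) 𝓘(ℝ, E).tangent ∞
      (fun z => (⟨z, V z⟩ : TangentBundle 𝓘(ℝ, E) M)) x) :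
    ContMDiffAt 𝓘(ℝ, E) 𝓘(ℝ) ∞ (fun y => dir 𝓘(ℝ, E) f y (V y)) x := by
  have : IsManifold 𝓘(ℝ, E) 1 M := IsManifold.of_le (n := ∞) (by simp)
  set φ := chartAt E x
  have hφ : φ ∈ atlas E M := chart_mem_atlas E x
  have hxs : x ∈ φ.source := mem_chart_source E x
  have h1 := contMDiffAt_fderiv_chart hφ hxs hf
  have h2 := (Bundle.contMDiffAt_totalSpace.1 hV).2
  refine (h1.clm_apply h2).congr_of_eventuallyEq ?_
  filter_upwards [φ.open_source.mem_nhds hxs, hf'] with y hy hfy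
  have e : (trivializationAt E (TangentSpace 𝓘(ℝ, E)) x ⟨y, V y⟩).2 = chartCoord φ y (V y) := by
    have h3 := TangentBundle.continuousLinearMapAt_trivializationAt (I := 𝓘(ℝ, E)) (x₀ := x) hy
    have h4 := Trivialization.continuousLinearMapAt_apply_of_mem ℝ
      (trivializationAt E (TangentSpace 𝓘(ℝ, E)) x) (b := y) (by simpa using hy) (V y)
    rw [h3] at h4
    rw [← h4]
    simp [chartCoord, φ]
  have h5 := dir_chartVec hφ hy hfy (chartCoord φ y (V y))
  rw [chartVec_chartCoord hφ hy] at h5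
  rw [h5]
  exact congrArg _ e.symm

theorem IsBLift.unique [hZ : IsHypersurface 𝓘(ℝ, E) Z] {V : ∀ x : M, TangentSpace 𝓘(ℝ, E) x}
    {b b' : BTangent 𝓘(ℝ, E) Z x}
    (h : IsBLift 𝓘(ℝ, E) Z V x b) (h' : IsBLift 𝓘(ℝ, E) Z V x b') : b = b' := by
  obtain ⟨f, hf⟩ := hZ.exists_defFun x
  have : (𝓝[Zᶜ] x).NeBot := by
    rw [← mem_closure_iff_nhdsWithin_neBot, mem_closure_iff_frequently]
    exact (hf.frequently_ne.and_eventually hf.zero_iff).mono fun y hy hyZ => hy.1 (hy.2.2 hyZ)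
  exact ext_of_dlog hf (h.1.trans h'.1.symm) (tendsto_nhds_unique (h.2 f hf) (h'.2 f hf))

theorem IsBVectorFieldAt.exists_isBLift [hZ : IsHypersurface 𝓘(ℝ, E) Z]
    {V : ∀ x : M, TangentSpace 𝓘(ℝ, E) x} (hV : IsBVectorFieldAt 𝓘(ℝ, E) Z V x) :
    ∃ b, IsBLift 𝓘(ℝ, E) Z V x b := by
  obtain ⟨f, hf⟩ := hZ.exists_defFun x
  have hs : ∀ᶠ y in 𝓝 x, ContMDiffAt 𝓘(ℝ, E) 𝓘(ℝ) ∞ (fun y => dir 𝓘(ℝ, E) f y (V y)) y := by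
    filter_upwards [hf.smooth.eventually_nhds, hV.1] with y h1 h2
    exact contMDiffAt_dir h1.self_of_nhds h1 h2
  obtain ⟨k, hk, hk'⟩ : ∃ k : M → ℝ, (∀ᶠ y in 𝓝 x, ContMDiffAt 𝓘(ℝ, E) 𝓘(ℝ) ∞ k y) ∧
      ∀ᶠ y in 𝓝 x, dir 𝓘(ℝ, E) f y (V y) = k y * f y := by
    by_cases hx : x ∈ Z
    · refine exists_eq_mul_of_isDefFun hf hx hs ?_
      filter_upwards [hV.2, hf.eventually] with y h1 h2 h3 using h1 h3 f h2
    · have h1 : f x ≠ 0 := fun h => hx (hf.zero_iff.self_of_nhds.1 h)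
      have h2 := hf.smooth.self_of_nhds.continuousAt.eventually_ne h1
      refine ⟨fun y => dir 𝓘(ℝ, E) f y (V y) / f y, ?_, ?_⟩
      · filter_upwards [h2, hf.smooth, hs] with y a b c
        exact c.div₀ b a
      · filter_upwards [h2] with y a
        field_simp
  obtain ⟨b, hb, hb'⟩ := exists_eq hf (V x) (k x) (by rw [hk'.self_of_nhds]; ring)
  refine ⟨b, hb, fun f' hf' => ?_⟩
  obtain ⟨u, hu, hu'⟩ := hf.exists_ratio hf'
  have u0 := hf.ratio_ne_zero hf' hu hu'
  rw [dlog_mul b hf hf' hu hu', hb, hb']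
  have hc : ContinuousAt (fun y => k y + dir 𝓘(ℝ, E) u y (V y) / u y) x :=
    (hk.self_of_nhds.continuousAt).add
      ((contMDiffAt_dir hu.self_of_nhds hu hV.1.self_of_nhds).continuousAt.div
        hu.self_of_nhds.continuousAt u0)
  refine (hc.tendsto.mono_left nhdsWithin_le_nhds).congr' ?_
  rw [EventuallyEq, eventually_nhdsWithin_iff]
  filter_upwards [hf.zero_iff, hu.eventually_nhds, hu'.eventually_nhds, hf.smooth, hk',
    hu.self_of_nhds.continuousAt.eventually_ne u0] with y h1 h2 h3 h4 h5 h6 hy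
  have hfy : f y ≠ 0 := fun h => hy (h1.1 h)
  have e : f' =ᶠ[𝓝 y] u * f := h3
  rw [dir_congr e, dir_mul h2.self_of_nhds h4, h5, h3.self_of_nhds]
  field_simp

theorem isBLift_bLift {V : ∀ x : M, TangentSpace 𝓘(ℝ, E) x}
    (h : ∃ b, IsBLift 𝓘(ℝ, E) Z V x b) : IsBLift 𝓘(ℝ, E) Z V x (bLift 𝓘(ℝ, E) Z V x) := by
  rw [bLift, dif_pos h]
  exact h.choose_spec

end

section Group

variable {E : Type*} [NormedAddCommGroup E] [NormedSpace ℝ E] [FiniteDimensional ℝ E]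
  {G : Type*} [TopologicalSpace G] [ChartedSpace E G] [Group G]
  (H : Subgroup G)

variable (E) in
/-- The Lie algebra `𝔥 = T_e H`, as a subspace of `T_e G` (which is modelled on `E`). -/
def lieAlg : Submodule ℝ E where
  carrier := {X | ∀ f : G → ℝ, IsDefFun 𝓘(ℝ, E) (H : Set G) f 1 →
    dir 𝓘(ℝ, E) f 1 (X : TangentSpace 𝓘(ℝ, E) (1 : G)) = 0}
  add_mem' := fun {a b} ha hb f hf => by
    exact (dir_add 𝓘(ℝ, E) f (a : TangentSpace 𝓘(ℝ, E) (1 : G)) b).trans (by rw [ha f hf, hb f hf, add_zero])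
  zero_mem' := fun f _ => map_zero (mfderiv 𝓘(ℝ, E) 𝓘(ℝ) f 1)
  smul_mem' := fun c a ha f hf => by
    exact (dir_smul 𝓘(ℝ, E) f c (a : TangentSpace 𝓘(ℝ, E) (1 : G))).trans (by rw [ha f hf, mul_zero])

/-- The vector field `g ↦ d/dt e^{tX} g = (R_g)_* X` on `G` generated by `X ∈ T_e G`. -/
def rightField (X : E) (g : G) : TangentSpace 𝓘(ℝ, E) g :=
  mfderiv 𝓘(ℝ, E) 𝓘(ℝ, E) (fun x : G => x * g) 1 X

variable [LieGroup 𝓘(ℝ, E) ∞ G]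

variable {H} in
theorem dir_rightField {f : G → ℝ} {g : G} (hf : ContMDiffAt 𝓘(ℝ, E) 𝓘(ℝ) ∞ f g) (X : E) :
    dir 𝓘(ℝ, E) f g (rightField X g) = dir 𝓘(ℝ, E) (fun x => f (x * g)) 1 X := by
  have pt : ∀ (z : G) (_ : z = g) (v : E), dir 𝓘(ℝ, E) f z v = dir 𝓘(ℝ, E) f g v := by
    rintro z rfl v; rfl
  have h1 : MDifferentiableAt 𝓘(ℝ, E) 𝓘(ℝ) f (1 * g) := by
    rw [one_mul]; exact hf.mdifferentiableAt (by simp)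
  have h2 : MDifferentiableAt 𝓘(ℝ, E) 𝓘(ℝ, E) (fun x : G => x * g) 1 :=
    (contMDiff_mul_right (n := ∞)).contMDiffAt.mdifferentiableAt (by simp)
  have h3 := mfderiv_comp (1 : G) h1 h2
  have h4 : dir 𝓘(ℝ, E) (fun x => f (x * g)) 1 X =
      dir 𝓘(ℝ, E) f (1 * g) (mfderiv 𝓘(ℝ, E) 𝓘(ℝ, E) (fun x : G => x * g) 1 X) := by
    unfold dir
    change mfderiv 𝓘(ℝ, E) 𝓘(ℝ) (f ∘ fun x => x * g) 1 X = _
    rw [h3]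
    rfl
  rw [h4]
  exact (pt (1 * g) (one_mul g) _).symm

theorem contMDiff_rightField (X : E) :
    ContMDiff 𝓘(ℝ, E) 𝓘(ℝ, E).tangent ∞
      (fun g => (⟨g, rightField X g⟩ : TangentBundle 𝓘(ℝ, E) G)) := by
  have : IsManifold 𝓘(ℝ, E) 1 G := IsManifold.of_le (n := ∞) (by simp)
  let fg : G → TangentBundle 𝓘(ℝ, E) G := fun g ↦ TotalSpace.mk' E g 0
  have sfg : ContMDiff 𝓘(ℝ, E) 𝓘(ℝ, E).tangent ∞ fg := contMDiff_zeroSection _ _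
  let fv : G → TangentBundle 𝓘(ℝ, E) G := fun _ ↦ TotalSpace.mk' E 1 X
  have sfv : ContMDiff 𝓘(ℝ, E) 𝓘(ℝ, E).tangent ∞ fv := contMDiff_const
  let F₁ : G → (TangentBundle 𝓘(ℝ, E) G × TangentBundle 𝓘(ℝ, E) G) := fun g ↦ (fv g, fg g)
  have S₁ : ContMDiff 𝓘(ℝ, E) (𝓘(ℝ, E).tangent.prod 𝓘(ℝ, E).tangent) ∞ F₁ := sfv.prodMk sfg
  let F₂ : (TangentBundle 𝓘(ℝ, E) G × TangentBundle 𝓘(ℝ, E) G) →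
      TangentBundle (𝓘(ℝ, E).prod 𝓘(ℝ, E)) (G × G) :=
    (equivTangentBundleProd 𝓘(ℝ, E) G 𝓘(ℝ, E) G).symm
  have S₂ : ContMDiff (𝓘(ℝ, E).tangent.prod 𝓘(ℝ, E).tangent) (𝓘(ℝ, E).prod 𝓘(ℝ, E)).tangent ∞ F₂ := contMDiff_equivTangentBundleProd_symm
  let F₃ : TangentBundle (𝓘(ℝ, E).prod 𝓘(ℝ, E)) (G × G) → TangentBundle 𝓘(ℝ, E) G :=
    tangentMap (𝓘(ℝ, E).prod 𝓘(ℝ, E)) 𝓘(ℝ, E) (fun (p : G × G) ↦ p.1 * p.2)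
  have S₃ : ContMDiff (𝓘(ℝ, E).prod 𝓘(ℝ, E)).tangent 𝓘(ℝ, E).tangent ∞ F₃ := by
    apply ContMDiff.contMDiff_tangentMap _ (m := ∞) (n := ∞) (by simp)
    exact contMDiff_mul 𝓘(ℝ, E) ∞
  let S := (S₃.comp S₂).comp S₁
  convert! S with g
  · simp [F₁, F₂, F₃, fg, fv]
  · simp only [Function.comp_apply, tangentMap, F₃, F₂, F₁, fg, fv]
    rw [mfderiv_prod_eq_add_apply ((contMDiff_mul 𝓘(ℝ, E) ∞).mdifferentiableAt (by simp))]
    exact ((congrArg (rightField X g + ·) (map_zero _)).trans (add_zero _)).symm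

end Group

end

section

open BTangent

section Group

variable {E : Type*} [NormedAddCommGroup E] [NormedSpace ℝ E] [FiniteDimensional ℝ E]
  {G : Type*} [TopologicalSpace G] [ChartedSpace E G] [Group G] [LieGroup 𝓘(ℝ, E) ∞ G]
  {H : Subgroup G} [hH : IsHypersurface 𝓘(ℝ, E) (H : Set G)]

theorem dir_eq_zero_of_eq_mul {M : Type*} [TopologicalSpace M] [ChartedSpace E M]
    {k u f : M → ℝ} {x : M} (hu : ContMDiffAt 𝓘(ℝ, E) 𝓘(ℝ) ∞ u x)
    (hf : ContMDiffAt 𝓘(ℝ, E) 𝓘(ℝ) ∞ f x) (e : k =ᶠ[𝓝 x] u * f) (fx : f x = 0)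
    (v : TangentSpace 𝓘(ℝ, E) x) (hv : dir 𝓘(ℝ, E) f x v = 0) : dir 𝓘(ℝ, E) k x v = 0 := by
  rw [dir_congr e, dir_mul hu hf, hv, fx]
  ring

theorem dir_eq_zero_of_mem_lieAlg {X : E} (hX : X ∈ lieAlg E H) {k : G → ℝ}
    (hk : ∀ᶠ y in 𝓝 (1 : G), ContMDiffAt 𝓘(ℝ, E) 𝓘(ℝ) ∞ k y)
    (hk0 : ∀ᶠ y in 𝓝 (1 : G), y ∈ H → k y = 0) :
    dir 𝓘(ℝ, E) k 1 (X : TangentSpace 𝓘(ℝ, E) (1 : G)) = 0 := by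
  obtain ⟨f, hf⟩ := hH.exists_defFun 1
  obtain ⟨u, hu, hu'⟩ := exists_eq_mul_of_isDefFun hf H.one_mem hk hk0
  have e : k =ᶠ[𝓝 1] u * f := hu'
  exact dir_eq_zero_of_eq_mul hu.self_of_nhds hf.smooth.self_of_nhds e
    (hf.zero_iff.self_of_nhds.2 H.one_mem) _ (hX f hf)

theorem tendsto_mul_right_one {G : Type*} [TopologicalSpace G] [Group G] [IsTopologicalGroup G]
    (g : G) : Tendsto (fun x : G => x * g) (𝓝 1) (𝓝 g) := by
  have h : ContinuousAt (fun x : G => x * g) 1 := by fun_prop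
  simpa [ContinuousAt] using h

theorem isBVectorFieldAt_rightField {X : E} (hX : X ∈ lieAlg E H) (g : G) :
    IsBVectorFieldAt 𝓘(ℝ, E) (H : Set G) (rightField X) g := by
  refine ⟨Eventually.of_forall fun y => (contMDiff_rightField X).contMDiffAt,
    Eventually.of_forall fun y hy f hf => ?_⟩
  rw [dir_rightField hf.smooth.self_of_nhds]
  have := topologicalGroup_of_lieGroup 𝓘(ℝ, E) ∞ (G := G)
  have ht := tendsto_mul_right_one y
  refine dir_eq_zero_of_mem_lieAlg hX ?_ ?_
  · filter_upwards [ht.eventually hf.smooth] with x hx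
    exact ContMDiffAt.comp x hx contMDiff_mul_right.contMDiffAt
  · filter_upwards [ht.eventually hf.zero_iff] with x hx hxH
    exact hx.2 (H.mul_mem hxH hy)

variable (H) in
/-- The infinitesimal action `ζ_g : 𝔥 → ᵇT_g G` of `H` on `G` by left translations. -/
def zeta (g : G) : lieAlg E H →ₗ[ℝ] BTangent 𝓘(ℝ, E) (H : Set G) g where
  toFun X := bLift 𝓘(ℝ, E) (H : Set G) (rightField (X : E)) g
  map_add' X Y := by
    have hX := isBLift_bLift (isBVectorFieldAt_rightField X.2 g).exists_isBLift
    have hY := isBLift_bLift (isBVectorFieldAt_rightField Y.2 g).exists_isBLift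
    refine (isBLift_bLift (isBVectorFieldAt_rightField (X + Y).2 g).exists_isBLift).unique ?_
    have e : ∀ y : G, rightField ((X + Y : lieAlg E H) : E) y = rightField (X : E) y +
      rightField (Y : E) y := fun y => map_add (mfderiv 𝓘(ℝ, E) 𝓘(ℝ, E) (fun x : G => x * y) 1) _ _
    refine ⟨?_, fun f hf => ?_⟩
    · rw [map_add, hX.1, hY.1, e]
    · rw [map_add]
      refine ((hX.2 f hf).add (hY.2 f hf)).congr fun y => ?_
      rw [e, dir_add, add_div]
  map_smul' c X := by
    have hX := isBLift_bLift (isBVectorFieldAt_rightField X.2 g).exists_isBLift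
    refine (isBLift_bLift (isBVectorFieldAt_rightField (c • X).2 g).exists_isBLift).unique ?_
    have e : ∀ y : G, rightField ((c • X : lieAlg E H) : E) y = c • rightField (X : E) y :=
      fun y => map_smul (mfderiv 𝓘(ℝ, E) 𝓘(ℝ, E) (fun x : G => x * y) 1) c _
    refine ⟨?_, fun f hf => ?_⟩
    · rw [RingHom.id_apply, map_smul, hX.1, e]
    · rw [RingHom.id_apply, map_smul]
      refine ((hX.2 f hf).const_smul c).congr fun y => ?_
      rw [e, dir_smul, smul_eq_mul, mul_div_assoc]

theorem isBLift_zeta (g : G) (X : lieAlg E H) :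
    IsBLift 𝓘(ℝ, E) (H : Set G) (rightField (X : E)) g (zeta H g X) :=
  isBLift_bLift (isBVectorFieldAt_rightField X.2 g).exists_isBLift

theorem zeta_injective (g : G) : Function.Injective (zeta (E := E) H g) := by
  rw [injective_iff_map_eq_zero]
  intro X hX
  have h1 := (isBLift_zeta g X).1
  rw [hX, map_zero] at h1
  have hR : ∀ a : G, MDifferentiableAt 𝓘(ℝ, E) 𝓘(ℝ, E) (fun x : G => x * g⁻¹) a := fun a =>
    (contMDiff_mul_right (n := ∞)).contMDiffAt.mdifferentiableAt (by simp)
  have hR' : MDifferentiableAt 𝓘(ℝ, E) 𝓘(ℝ, E) (fun x : G => x * g) 1 :=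
    (contMDiff_mul_right (n := ∞)).contMDiffAt.mdifferentiableAt (by simp)
  have h2 := mfderiv_comp (1 : G) (hR (1 * g)) hR'
  have h3 : (fun x : G => x * g⁻¹) ∘ (fun x : G => x * g) = id := by ext; simp
  rw [h3, mfderiv_id] at h2
  have h4 := congrArg (fun L => L (X : E)) h2
  have h5 : mfderiv 𝓘(ℝ, E) 𝓘(ℝ, E) (fun x : G => x * g) 1 (X : E) = 0 := h1.symm
  apply Subtype.ext
  refine h4.trans ?_
  exact (congrArg (mfderiv 𝓘(ℝ, E) 𝓘(ℝ, E) (fun x : G => x * g⁻¹) (1 * g)) h5).trans (map_zero _)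

theorem finrank_lieAlg : Module.finrank ℝ (lieAlg E H) + 1 = Module.finrank ℝ E := by
  obtain ⟨f, hf⟩ := hH.exists_defFun 1
  let L : E →ₗ[ℝ] ℝ :=
    { toFun := fun X => dir 𝓘(ℝ, E) f 1 (X : TangentSpace 𝓘(ℝ, E) (1 : G))
      map_add' := fun a b => dir_add 𝓘(ℝ, E) f (x := (1 : G)) a b
      map_smul' := fun c a => dir_smul 𝓘(ℝ, E) f (x := (1 : G)) c a }
  have hL : L ≠ 0 := by
    intro h
    apply hf.regular H.one_mem
    ext v
    exact LinearMap.congr_fun h (v : E)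
  have : lieAlg E H = LinearMap.ker L := by
    ext X
    refine ⟨fun h => h f hf, fun h f' hf' => ?_⟩
    obtain ⟨u, hu, hu'⟩ := hf.exists_ratio hf'
    have e : f' =ᶠ[𝓝 1] u * f := hu'
    have h' : dir 𝓘(ℝ, E) f 1 (X : TangentSpace 𝓘(ℝ, E) (1 : G)) = 0 := h
    exact dir_eq_zero_of_eq_mul hu.self_of_nhds hf.smooth.self_of_nhds e
      (hf.zero_iff.self_of_nhds.2 H.one_mem) _ h'
  rw [this]
  exact Module.Dual.finrank_ker_add_one_of_ne_zero hL

variable (E H) in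
/-- A local slice of the right cosets of `H`: a submersion whose level sets are the intersections
of the cosets with the domain. -/
structure Slice where
  U : Set G
  s : G → ℝ
  isOpen : IsOpen U
  smooth : ∀ y ∈ U, ContMDiffAt 𝓘(ℝ, E) 𝓘(ℝ) ∞ s y
  regular : ∀ y ∈ U, ∃ v, dir 𝓘(ℝ, E) s y v ≠ 0
  eq_iff : ∀ y ∈ U, ∀ y' ∈ U, s y = s y' ↔ y * y'⁻¹ ∈ H

theorem exists_slice (g : G) : ∃ S : Slice E H, g ∈ S.U := by
  have := topologicalGroup_of_lieGroup 𝓘(ℝ, E) ∞ (G := G)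
  obtain ⟨f, hf⟩ := hH.exists_defFun 1
  set φ := chartAt E g
  have hφ : φ ∈ atlas E G := chart_mem_atlas E g
  have hgs : g ∈ φ.source := mem_chart_source E g
  -- a direction transverse to the coset of `g`
  let k : G → ℝ := fun z => f (g * z⁻¹)
  have tk : Tendsto (fun z : G => g * z⁻¹) (𝓝 g) (𝓝 1) := by
    have h : ContinuousAt (fun z : G => g * z⁻¹) g := by fun_prop
    simpa [ContinuousAt] using h
  have hk : ∀ᶠ z in 𝓝 g, ContMDiffAt 𝓘(ℝ, E) 𝓘(ℝ) ∞ k z := by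
    filter_upwards [tk.eventually hf.smooth] with z hz
    exact ContMDiffAt.comp z hz
      ((contMDiff_const.mul (contMDiff_inv 𝓘(ℝ, E) ∞)).contMDiffAt)
  obtain ⟨e, he⟩ : ∃ e, fderiv ℝ (k ∘ φ.symm) (φ g) e ≠ 0 := by
    by_contra! h0
    have hk0 : mfderiv 𝓘(ℝ, E) 𝓘(ℝ) k g = 0 := by
      ext v
      have := mfderiv_chartVec hφ hgs hk.self_of_nhds (chartCoord φ g v)
      rw [chartVec_chartCoord hφ hgs, h0] at this
      exact this
    apply hf.regular H.one_mem
    have e1 : f = k ∘ fun x : G => x⁻¹ * g := by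
      ext x; simp [k, mul_assoc]
    have h1 : MDifferentiableAt 𝓘(ℝ, E) 𝓘(ℝ, E) (fun x : G => x⁻¹ * g) 1 :=
      ((contMDiff_inv 𝓘(ℝ, E) ∞).mul contMDiff_const).contMDiffAt.mdifferentiableAt (by simp)
    have e2 : (1 : G)⁻¹ * g = g := by simp
    have h2 : MDifferentiableAt 𝓘(ℝ, E) 𝓘(ℝ) k ((1 : G)⁻¹ * g) := by
      rw [e2]; exact hk.self_of_nhds.mdifferentiableAt (by simp)
    have h3 : ∀ z, z = g → ∀ v : E, mfderiv 𝓘(ℝ, E) 𝓘(ℝ) k z v = (0 : ℝ) := by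
      rintro z rfl v
      rw [hk0]; rfl
    have h4 := mfderiv_comp (1 : G) h2 h1
    rw [← e1] at h4
    rw [h4]
    ext v
    exact h3 _ e2 _
  let c : ℝ → G := fun t => φ.symm (φ g + t • e)
  let Φ : E × ℝ → ℝ := fun p => f (φ.symm p.1 * (c p.2)⁻¹)
  have hc0 : c 0 = g := by simp [c, φ.left_inv hgs]
  have tl : Tendsto (fun t : ℝ => φ g + t • e) (𝓝 0) (𝓝 (φ g)) := by
    have h : ContinuousAt (fun t : ℝ => φ g + t • e) 0 := by fun_prop
    simpa [ContinuousAt] using h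
  have tgt := φ.open_target.mem_nhds (φ.map_source hgs)
  have tsymm : Tendsto φ.symm (𝓝 (φ g)) (𝓝 g) := by
    simpa [φ.left_inv hgs] using (φ.continuousAt_symm (φ.map_source hgs)).tendsto
  have tc : Tendsto c (𝓝 0) (𝓝 g) := tsymm.comp tl
  have hsym : ∀ z ∈ φ.target, ContMDiffAt 𝓘(ℝ, E) 𝓘(ℝ, E) ∞ φ.symm z := fun z hz =>
    contMDiffAt_symm_of_mem_maximalAtlas (IsManifold.subset_maximalAtlas hφ) hz
  have hΦ : ∀ᶠ v in 𝓝 (φ g, (0 : ℝ)), ContDiffAt ℝ ∞ Φ v := by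
    rw [nhds_prod_eq]
    have t1 : Tendsto (fun p : E × ℝ => φ.symm p.1 * (c p.2)⁻¹) (𝓝 (φ g) ×ˢ 𝓝 0) (𝓝 1) := by
      have := (tsymm.comp tendsto_fst).mul ((tc.comp (tendsto_snd (f := 𝓝 (φ g)))).inv)
      simpa using this
    filter_upwards [t1.eventually hf.smooth, tendsto_fst.eventually tgt,
      tendsto_snd.eventually (tl.eventually tgt)] with v h1 h2 h3
    rw [← contMDiffAt_iff_contDiffAt]
    have d1 : ContMDiffAt 𝓘(ℝ, E × ℝ) 𝓘(ℝ, E) ∞ (fun p : E × ℝ => φ.symm p.1) v :=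
      ContMDiffAt.comp v (I' := 𝓘(ℝ, E)) (hsym _ h2) contDiff_fst.contDiffAt.contMDiffAt
    have d2 : ContMDiffAt 𝓘(ℝ, E × ℝ) 𝓘(ℝ, E) ∞ (fun p : E × ℝ => c p.2) v := by
      refine ContMDiffAt.comp v (I' := 𝓘(ℝ, E)) (f := fun p : E × ℝ => φ g + p.2 • e) (hsym _ h3) ?_
      exact (contDiff_const.add (contDiff_snd.smul contDiff_const)).contDiffAt.contMDiffAt
    exact ContMDiffAt.comp v (I' := 𝓘(ℝ, E)) h1 (d1.mul d2.inv)
  have hΦ0 : Φ (φ g, 0) = 0 := by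
    simp only [Φ, hc0, φ.left_inv hgs, mul_inv_cancel]
    exact hf.zero_iff.self_of_nhds.2 H.one_mem
  have hΦ1 : fderiv ℝ Φ (φ g, 0) (0, 1) ≠ 0 := by
    have a1 : HasFDerivAt Φ (fderiv ℝ Φ (φ g, 0)) (φ g, (0 : ℝ)) :=
      (hΦ.self_of_nhds.differentiableAt (by simp)).hasFDerivAt
    have a2 : HasDerivAt (fun t : ℝ => (φ g, t)) ((0 : E), (1 : ℝ)) 0 :=
      (hasDerivAt_const (0 : ℝ) (φ g)).prodMk (hasDerivAt_id (0 : ℝ))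
    have a3 : HasDerivAt (fun t : ℝ => Φ (φ g, t)) (fderiv ℝ Φ (φ g, 0) (0, 1)) 0 :=
      a1.comp_hasDerivAt (0 : ℝ) a2
    have b1 : HasFDerivAt (k ∘ φ.symm) (fderiv ℝ (k ∘ φ.symm) (φ g)) (φ g + (0 : ℝ) • e) := by
      have := ((contMDiffAt_comp_symm hφ hgs hk.self_of_nhds).differentiableAt (by simp)).hasFDerivAt
      simpa using this
    have b2 : HasDerivAt (fun t : ℝ => φ g + t • e) e 0 := by
      simpa using ((hasDerivAt_id (0 : ℝ)).smul_const e).const_add (φ g)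
    have b3 : HasDerivAt (fun t : ℝ => Φ (φ g, t)) (fderiv ℝ (k ∘ φ.symm) (φ g) e) 0 := by
      have := b1.comp_hasDerivAt (0 : ℝ) b2
      refine this.congr_of_eventuallyEq (Eventually.of_forall fun t => ?_)
      simp [Φ, k, c, φ.left_inv hgs]
    rw [a3.unique b3]
    exact he
  obtain ⟨τ, hτ0, hτ, hτΦ⟩ := exists_implicit hΦ hΦ0 hΦ1
  have hc' : Tendsto (fun t : ℝ => (φ g + t • e, t)) (𝓝 0) (𝓝 (φ g, 0)) := by
    rw [nhds_prod_eq]; exact tl.prodMk tendsto_id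
  have hτe : fderiv ℝ τ (φ g) e = 1 := by
    have b1 : HasFDerivAt τ (fderiv ℝ τ (φ g)) (φ g + (0 : ℝ) • e) := by
      have := (hτ.self_of_nhds.differentiableAt (by simp)).hasFDerivAt
      simpa using this
    have b2 : HasDerivAt (fun t : ℝ => φ g + t • e) e 0 := by
      simpa using ((hasDerivAt_id (0 : ℝ)).smul_const e).const_add (φ g)
    have b3 := b1.comp_hasDerivAt (0 : ℝ) b2
    refine b3.unique ((hasDerivAt_id (0 : ℝ)).congr_of_eventuallyEq ?_)
    filter_upwards [hc'.eventually hτΦ] with t ht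
    refine ht.1 ?_
    simp only [Φ, c, mul_inv_cancel]
    exact hf.zero_iff.self_of_nhds.2 H.one_mem
  have hs0 : (τ ∘ φ) g = 0 := hτ0
  have hss : ∀ᶠ y in 𝓝 g, ContMDiffAt 𝓘(ℝ, E) 𝓘(ℝ) ∞ (τ ∘ φ) y := by
    filter_upwards [(φ.eventually_nhds _ hgs).1 hτ, φ.open_source.mem_nhds hgs] with y hy hys
    exact contMDiffAt_comp_chart hφ hys hy
  have hreg : ∀ᶠ y in 𝓝 g, fderiv ℝ τ (φ y) e ≠ 0 := by
    rw [← φ.eventually_nhds (fun z => fderiv ℝ τ z e ≠ 0) hgs]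
    have : ContinuousAt (fun z => fderiv ℝ τ z e) (φ g) :=
      ((hτ.self_of_nhds.fderiv_right (m := 0) (by simp)).continuousAt).clm_apply continuousAt_const
    exact this.eventually_ne (by rw [hτe]; exact one_ne_zero)
  have key : ∀ᶠ p in 𝓝 g ×ˢ 𝓝 (0 : ℝ), (p.1 * (c p.2)⁻¹ ∈ H ↔ (τ ∘ φ) p.1 = p.2) := by
    have t1 : Tendsto (fun p : G × ℝ => p.1 * (c p.2)⁻¹) (𝓝 g ×ˢ 𝓝 0) (𝓝 1) := by
      have := tendsto_fst.mul ((tc.comp (tendsto_snd (f := 𝓝 g))).inv)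
      simpa using this
    have t2 : Tendsto (fun p : G × ℝ => (φ p.1, p.2)) (𝓝 g ×ˢ 𝓝 0) (𝓝 (φ g, 0)) := by
      rw [nhds_prod_eq]
      exact ((φ.continuousAt hgs).tendsto.comp tendsto_fst).prodMk tendsto_snd
    filter_upwards [t1.eventually hf.zero_iff, t2.eventually hτΦ,
      tendsto_fst.eventually (φ.open_source.mem_nhds hgs)] with p h1 h2 h3
    simp only [Φ, φ.left_inv h3] at h2
    exact h1.symm.trans h2
  obtain ⟨P, hP, T, hT, hPT⟩ := eventually_prod_iff.1 key
  have hsT : ∀ᶠ y in 𝓝 g, T ((τ ∘ φ) y) := by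
    have : Tendsto (τ ∘ φ) (𝓝 g) (𝓝 0) := by
      have h := hss.self_of_nhds.continuousAt.tendsto
      rwa [hs0] at h
    exact this.eventually hT
  obtain ⟨U, hU, hUo, hgU⟩ := eventually_nhds_iff.1 ((hss.and hreg).and ((hP.and hsT).and
    (φ.open_source.mem_nhds hgs)))
  refine ⟨⟨U, τ ∘ φ, hUo, fun y hy => (hU y hy).1.1, fun y hy => ⟨chartVec φ y e, ?_⟩,
    fun y hy y' hy' => ?_⟩, hgU⟩
  · rw [dir_chartVec hφ (hU y hy).2.2 (hU y hy).1.1]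
    have : (τ ∘ φ) ∘ φ.symm =ᶠ[𝓝 (φ y)] τ := by
      filter_upwards [φ.open_target.mem_nhds (φ.map_source (hU y hy).2.2)] with z hz
      simp [φ.right_inv hz]
    rw [this.fderiv_eq]
    exact (hU y hy).1.2
  · have h1 := (hPT (hU y' hy').2.1.1 (hU y' hy').2.1.2).2 rfl
    have h2 := hPT (hU y hy).2.1.1 (hU y' hy').2.1.2
    simp only at h1 h2
    have h3 : y * (c ((τ ∘ φ) y'))⁻¹ = (y * y'⁻¹) * (y' * (c ((τ ∘ φ) y'))⁻¹) := by group
    rw [← h2, h3, H.mul_mem_cancel_right h1]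

end Group

end

section

open BTangent

/-- The space `G/H` of right cosets `H g` of `H` in `G`, i.e. of orbits of the action of `H` on `G`
by left translations, with the quotient topology. (The model space `_E` of `G` is only recorded in
order to determine the smooth structure.) -/
def CosetSpace (_E : Type*) {G : Type*} [Group G] (H : Subgroup G) : Type _ :=
  Quotient (QuotientGroup.rightRel H)

section Group

variable {E : Type*} [NormedAddCommGroup E] [NormedSpace ℝ E] [FiniteDimensional ℝ E]
  {G : Type*} [TopologicalSpace G] [ChartedSpace E G] [Group G]

variable (H : Subgroup G)

instance : TopologicalSpace (CosetSpace E H) :=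
  inferInstanceAs (TopologicalSpace (Quotient (QuotientGroup.rightRel H)))

variable (E) in
/-- The projection `π : G → G/H`. -/
def CosetSpace.mk (g : G) : CosetSpace E H := Quotient.mk (QuotientGroup.rightRel H) g

variable {H}

theorem CosetSpace.mk_eq {a b : G} : mk E H a = mk E H b ↔ a * b⁻¹ ∈ H := by
  rw [eq_comm]
  exact Quotient.eq.trans QuotientGroup.rightRel_apply

theorem CosetSpace.exists_rep (q : CosetSpace E H) : ∃ g, mk E H g = q := Quotient.exists_rep q

theorem CosetSpace.continuous_mk : Continuous (mk E H) := continuous_quotient_mk'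

variable [LieGroup 𝓘(ℝ, E) ∞ G]

theorem CosetSpace.isOpenMap_mk : IsOpenMap (mk E H) := by
  have := topologicalGroup_of_lieGroup 𝓘(ℝ, E) ∞ (G := G)
  intro V hV
  change IsOpen (mk E H ⁻¹' _)
  have : mk E H ⁻¹' (mk E H '' V) = ⋃ h : H, (fun y : G => (h : G) * y) ⁻¹' V := by
    ext y
    simp only [mem_preimage, mem_image, mem_iUnion]
    constructor
    · rintro ⟨v, hv, e⟩
      exact ⟨⟨v * y⁻¹, mk_eq.1 e⟩, by simpa using hv⟩
    · rintro ⟨h, hh⟩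
      exact ⟨_, hh, mk_eq.2 (by simp)⟩
  rw [this]
  exact isOpen_iUnion fun h => hV.preimage (continuous_const.mul continuous_id)

theorem CosetSpace.map_nhds (g : G) : map (mk E H) (𝓝 g) = 𝓝 (mk E H g) :=
  le_antisymm continuous_mk.continuousAt.tendsto (isOpenMap_mk.nhds_le g)

theorem Slice.map_nhds (S : Slice E H) {y : G} (hy : y ∈ S.U) : map S.s (𝓝 y) = 𝓝 (S.s y) := by
  set φ := chartAt E y
  have hφ : φ ∈ atlas E G := chart_mem_atlas E y
  have hys : y ∈ φ.source := mem_chart_source E y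
  obtain ⟨v, hv⟩ := S.regular y hy
  have h1 := contMDiffAt_comp_symm hφ hys (S.smooth y hy)
  have h2 : HasStrictFDerivAt (S.s ∘ φ.symm) (fderiv ℝ (S.s ∘ φ.symm) (φ y)) (φ y) :=
    h1.hasStrictFDerivAt (by simp)
  have h3 : fderiv ℝ (S.s ∘ φ.symm) (φ y) (chartCoord φ y v) ≠ 0 := by
    rw [← dir_chartVec hφ hys (S.smooth y hy), chartVec_chartCoord hφ hys]
    exact hv
  have h4 : (fderiv ℝ (S.s ∘ φ.symm) (φ y)).range = ⊤ := by
    refine LinearMap.range_eq_top.2 fun r => ⟨(r / fderiv ℝ (S.s ∘ φ.symm) (φ y)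
      (chartCoord φ y v)) • chartCoord φ y v, ?_⟩
    rw [map_smul]
    exact div_mul_cancel₀ _ h3
  have h5 := h2.map_nhds_eq_of_surj h4
  rw [← φ.map_nhds_eq hys, Filter.map_map] at h5
  have e : (S.s ∘ φ.symm) ∘ φ =ᶠ[𝓝 y] S.s := by
    filter_upwards [φ.open_source.mem_nhds hys] with z hz
    simp [φ.left_inv hz]
  rw [Filter.map_congr e] at h5
  rw [h5]
  simp [φ.left_inv hys]

theorem Slice.exists_section (S : Slice E H) {y : G} (hy : y ∈ S.U) :
    ∃ σ : ℝ → G, σ (S.s y) = y ∧ ContMDiffAt 𝓘(ℝ) 𝓘(ℝ, E) ∞ σ (S.s y) ∧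
      ∀ᶠ t in 𝓝 (S.s y), σ t ∈ S.U ∧ S.s (σ t) = t := by
  set φ := chartAt E y
  have hφ : φ ∈ atlas E G := chart_mem_atlas E y
  have hys : y ∈ φ.source := mem_chart_source E y
  obtain ⟨v, hv⟩ := S.regular y hy
  set e := chartCoord φ y v
  have tl : Tendsto (fun t : ℝ => φ y + t • e) (𝓝 0) (𝓝 (φ y)) := by
    have h : ContinuousAt (fun t : ℝ => φ y + t • e) 0 := by fun_prop
    simpa [ContinuousAt] using h
  have tgt := φ.open_target.mem_nhds (φ.map_source hys)
  have tsymm : Tendsto φ.symm (𝓝 (φ y)) (𝓝 y) := by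
    simpa [φ.left_inv hys] using (φ.continuousAt_symm (φ.map_source hys)).tendsto
  have hsym : ∀ z ∈ φ.target, ContMDiffAt 𝓘(ℝ, E) 𝓘(ℝ, E) ∞ φ.symm z := fun z hz =>
    contMDiffAt_symm_of_mem_maximalAtlas (IsManifold.subset_maximalAtlas hφ) hz
  let Φ : ℝ × ℝ → ℝ := fun p => S.s (φ.symm (φ y + p.2 • e)) - p.1
  have hΦ : ∀ᶠ v in 𝓝 (S.s y, (0 : ℝ)), ContDiffAt ℝ ∞ Φ v := by
    rw [nhds_prod_eq]
    filter_upwards [tendsto_snd.eventually (tl.eventually tgt),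
      tendsto_snd.eventually (tl.eventually (tsymm.eventually (S.isOpen.mem_nhds hy)))] with v h1 h2
    refine ContDiffAt.sub ?_ contDiffAt_fst
    rw [← contMDiffAt_iff_contDiffAt]
    have d2 : ContMDiffAt 𝓘(ℝ, ℝ × ℝ) 𝓘(ℝ, E) ∞ (fun p : ℝ × ℝ => φ.symm (φ y + p.2 • e)) v := by
      refine ContMDiffAt.comp v (I' := 𝓘(ℝ, E)) (f := fun p : ℝ × ℝ => φ y + p.2 • e) (hsym _ h1) ?_
      exact (contDiff_const.add (contDiff_snd.smul contDiff_const)).contDiffAt.contMDiffAt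
    exact ContMDiffAt.comp v (I' := 𝓘(ℝ, E)) (S.smooth _ h2) d2
  have hΦ0 : Φ (S.s y, 0) = 0 := by simp [Φ, φ.left_inv hys]
  have hΦ1 : fderiv ℝ Φ (S.s y, 0) (0, 1) ≠ 0 := by
    have a1 : HasFDerivAt Φ (fderiv ℝ Φ (S.s y, 0)) (S.s y, (0 : ℝ)) :=
      (hΦ.self_of_nhds.differentiableAt (by simp)).hasFDerivAt
    have a2 : HasDerivAt (fun t : ℝ => (S.s y, t)) ((0 : ℝ), (1 : ℝ)) 0 :=
      (hasDerivAt_const (0 : ℝ) (S.s y)).prodMk (hasDerivAt_id (0 : ℝ))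
    have a3 : HasDerivAt (fun t : ℝ => Φ (S.s y, t)) (fderiv ℝ Φ (S.s y, 0) (0, 1)) 0 :=
      a1.comp_hasDerivAt (0 : ℝ) a2
    have b1 : HasFDerivAt (S.s ∘ φ.symm) (fderiv ℝ (S.s ∘ φ.symm) (φ y)) (φ y + (0 : ℝ) • e) := by
      have := ((contMDiffAt_comp_symm hφ hys (S.smooth y hy)).differentiableAt
        (by simp)).hasFDerivAt
      simpa using this
    have b2 : HasDerivAt (fun t : ℝ => φ y + t • e) e 0 := by
      simpa using ((hasDerivAt_id (0 : ℝ)).smul_const e).const_add (φ y)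
    have b3 : HasDerivAt (fun t : ℝ => Φ (S.s y, t)) (fderiv ℝ (S.s ∘ φ.symm) (φ y) e) 0 :=
      (b1.comp_hasDerivAt (0 : ℝ) b2).sub_const _
    rw [a3.unique b3, ← dir_chartVec hφ hys (S.smooth y hy), chartVec_chartCoord hφ hys]
    exact hv
  obtain ⟨τ, hτ0, hτ, hτΦ⟩ := exists_implicit hΦ hΦ0 hΦ1
  have hτ0' : τ (S.s y) = 0 := hτ0
  have hτc : Tendsto τ (𝓝 (S.s y)) (𝓝 0) := by
    have := hτ.self_of_nhds.continuousAt.tendsto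
    rwa [hτ0] at this
  refine ⟨fun t => φ.symm (φ y + τ t • e), by simp [hτ0', φ.left_inv hys], ?_, ?_⟩
  · refine ContMDiffAt.comp (S.s y) (I' := 𝓘(ℝ, E)) (f := fun t : ℝ => φ y + τ t • e) ?_ ?_
    · rw [hτ0']
      simpa using hsym _ (φ.map_source hys)
    · exact (contDiffAt_const.add (hτ.self_of_nhds.smul contDiffAt_const)).contMDiffAt
  · have t2 : Tendsto (fun t => (t, τ t)) (𝓝 (S.s y)) (𝓝 (S.s y, 0)) := by
      rw [nhds_prod_eq]
      exact tendsto_id.prodMk hτc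
    filter_upwards [t2.eventually hτΦ, hτc.eventually (tl.eventually
      (tsymm.eventually (S.isOpen.mem_nhds hy)))] with t h1 h2
    exact ⟨h2, sub_eq_zero.1 (h1.2 rfl)⟩

open Classical in
/-- The chart of `G/H` defined by a slice `s`: it sends the coset of `y` to `s y`. -/
def Slice.chart (S : Slice E H) : OpenPartialHomeomorph (CosetSpace E H) ℝ where
  toFun q := if h : ∃ y ∈ S.U, CosetSpace.mk E H y = q then S.s h.choose else 0
  invFun t := if h : ∃ y ∈ S.U, S.s y = t then CosetSpace.mk E H h.choose else CosetSpace.mk E H 1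
  source := CosetSpace.mk E H '' S.U
  target := S.s '' S.U
  map_source' := by
    rintro q (h : ∃ y ∈ S.U, CosetSpace.mk E H y = q)
    rw [dif_pos h]
    exact mem_image_of_mem _ h.choose_spec.1
  map_target' := by
    rintro t (h : ∃ y ∈ S.U, S.s y = t)
    rw [dif_pos h]
    exact mem_image_of_mem _ h.choose_spec.1
  left_inv' := by
    rintro q (h : ∃ y ∈ S.U, CosetSpace.mk E H y = q)
    have h' : ∃ y ∈ S.U, S.s y = S.s h.choose := ⟨_, h.choose_spec.1, rfl⟩
    rw [dif_pos h, dif_pos h']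
    refine Eq.trans ?_ h.choose_spec.2
    exact CosetSpace.mk_eq.2 ((S.eq_iff _ h'.choose_spec.1 _ h.choose_spec.1).1 h'.choose_spec.2)
  right_inv' := by
    rintro t (h : ∃ y ∈ S.U, S.s y = t)
    have h' : ∃ y ∈ S.U, CosetSpace.mk E H y = CosetSpace.mk E H h.choose :=
      ⟨_, h.choose_spec.1, rfl⟩
    rw [dif_pos h, dif_pos h']
    refine Eq.trans ?_ h.choose_spec.2
    exact (S.eq_iff _ h'.choose_spec.1 _ h.choose_spec.1).2
      ((CosetSpace.mk_eq (E := E)).1 h'.choose_spec.2)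
  open_source := CosetSpace.isOpenMap_mk _ S.isOpen
  open_target := by
    rw [isOpen_iff_mem_nhds]
    rintro _ ⟨y, hy, rfl⟩
    rw [← S.map_nhds hy]
    exact image_mem_map (S.isOpen.mem_nhds hy)
  continuousOn_toFun := by
    rintro _ ⟨y, hy, rfl⟩
    refine ContinuousAt.continuousWithinAt ?_
    rw [ContinuousAt, ← CosetSpace.map_nhds, tendsto_map'_iff]
    have e : ∀ z ∈ S.U, (if h : ∃ y ∈ S.U, CosetSpace.mk E H y = CosetSpace.mk E H z then
        S.s h.choose else 0) = S.s z := fun z hz => by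
      have h : ∃ y ∈ S.U, CosetSpace.mk E H y = CosetSpace.mk E H z := ⟨z, hz, rfl⟩
      rw [dif_pos h]
      exact (S.eq_iff _ h.choose_spec.1 _ hz).2 ((CosetSpace.mk_eq (E := E)).1 h.choose_spec.2)
    rw [e y hy]
    refine (S.smooth y hy).continuousAt.tendsto.congr' ?_
    filter_upwards [S.isOpen.mem_nhds hy] with z hz using (e z hz).symm
  continuousOn_invFun := by
    rintro _ ⟨y, hy, rfl⟩
    refine ContinuousAt.continuousWithinAt ?_
    rw [ContinuousAt, ← S.map_nhds hy, tendsto_map'_iff]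
    have e : ∀ z ∈ S.U, (if h : ∃ y ∈ S.U, S.s y = S.s z then
        CosetSpace.mk E H h.choose else CosetSpace.mk E H 1) = CosetSpace.mk E H z := fun z hz => by
      have h : ∃ y ∈ S.U, S.s y = S.s z := ⟨z, hz, rfl⟩
      rw [dif_pos h]
      exact CosetSpace.mk_eq.2 ((S.eq_iff _ h.choose_spec.1 _ hz).1 h.choose_spec.2)
    rw [e y hy]
    refine CosetSpace.continuous_mk.continuousAt.tendsto.congr' ?_
    filter_upwards [S.isOpen.mem_nhds hy] with z hz using (e z hz).symm

theorem Slice.chart_mk (S : Slice E H) {y : G} (hy : y ∈ S.U) :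
    S.chart (CosetSpace.mk E H y) = S.s y := by
  have h : ∃ z ∈ S.U, CosetSpace.mk E H z = CosetSpace.mk E H y := ⟨y, hy, rfl⟩
  have e : S.chart (CosetSpace.mk E H y) = S.s h.choose := dif_pos h
  rw [e]
  exact (S.eq_iff _ h.choose_spec.1 _ hy).2 ((CosetSpace.mk_eq (E := E)).1 h.choose_spec.2)

theorem Slice.chart_symm (S : Slice E H) {y : G} (hy : y ∈ S.U) :
    S.chart.symm (S.s y) = CosetSpace.mk E H y := by
  rw [← S.chart_mk hy]
  exact S.chart.left_inv (mem_image_of_mem _ hy)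

variable [hH : IsHypersurface 𝓘(ℝ, E) (H : Set G)]

theorem exists_chart (q : CosetSpace E H) : ∃ S : Slice E H, q ∈ S.chart.source := by
  obtain ⟨g, rfl⟩ := q.exists_rep
  obtain ⟨S, hS⟩ := exists_slice (E := E) (H := H) g
  exact ⟨S, mem_image_of_mem _ hS⟩

/-- The manifold structure of `G/H`: the charts are the functions of the coset that lift to
submersions on `G`. -/
instance : ChartedSpace ℝ (CosetSpace E H) where
  atlas := range Slice.chart
  chartAt q := (exists_chart q).choose.chart
  mem_chart_source q := (exists_chart q).choose_spec
  chart_mem_atlas _ := mem_range_self _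

instance : IsManifold 𝓘(ℝ) ∞ (CosetSpace E H) := by
  refine isManifold_of_contDiffOn _ _ _ ?_
  rintro _ _ ⟨S, rfl⟩ ⟨S', rfl⟩
  simp only [modelWithCornersSelf_coe, modelWithCornersSelf_coe_symm, Function.comp_id,
    Function.id_comp, preimage_id, range_id, inter_univ]
  rintro t ⟨⟨y, hy, rfl⟩, ht⟩
  refine ContDiffAt.contDiffWithinAt ?_
  have ht' : CosetSpace.mk E H y ∈ CosetSpace.mk E H '' S'.U := by
    have : S.chart.symm (S.s y) ∈ S'.chart.source := ht
    rwa [S.chart_symm hy] at this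
  obtain ⟨y', hy', e⟩ := ht'
  have hh := CosetSpace.mk_eq.1 e
  obtain ⟨σ, h1, h2, h3⟩ := S.exists_section hy
  set h := y' * y⁻¹
  have e2 : h * σ (S.s y) = y' := by simp [h1, h]
  have h4 : ContMDiffAt 𝓘(ℝ) 𝓘(ℝ, E) ∞ (fun t => h * σ t) (S.s y) := contMDiffAt_const.mul h2
  have h5 : ContMDiffAt 𝓘(ℝ) 𝓘(ℝ) ∞ (fun t => S'.s (h * σ t)) (S.s y) :=
    ContMDiffAt.comp (S.s y) (by rw [e2]; exact S'.smooth y' hy') h4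
  rw [contMDiffAt_iff_contDiffAt] at h5
  refine h5.congr_of_eventuallyEq ?_
  have h6 : ∀ᶠ t in 𝓝 (S.s y), h * σ t ∈ S'.U := by
    exact h4.continuousAt.eventually (S'.isOpen.mem_nhds (e2.symm ▸ hy' : h * σ (S.s y) ∈ S'.U))
  filter_upwards [h3, h6] with t ht ht'
  have e3 : S.chart.symm t = CosetSpace.mk E H (σ t) := by
    rw [← S.chart_symm ht.1, ht.2]
  have e4 : CosetSpace.mk E H (σ t) = CosetSpace.mk E H (h * σ t) := by
    rw [CosetSpace.mk_eq]
    simpa using H.inv_mem hh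
  change S'.chart (S.chart.symm t) = _
  rw [e3, e4, S'.chart_mk ht']

end Group

end

section

open BTangent

section Group

variable {E : Type*} [NormedAddCommGroup E] [NormedSpace ℝ E] [FiniteDimensional ℝ E]
  {G : Type*} [TopologicalSpace G] [ChartedSpace E G] [Group G] [LieGroup 𝓘(ℝ, E) ∞ G]
  {H : Subgroup G}

theorem dir_sub_const {M : Type*} [TopologicalSpace M] [ChartedSpace E M] {f : M → ℝ} {x : M}
    (hf : MDifferentiableAt 𝓘(ℝ, E) 𝓘(ℝ) f x) (c : ℝ) (v : TangentSpace 𝓘(ℝ, E) x) :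
    dir 𝓘(ℝ, E) (fun y => f y - c) x v = dir 𝓘(ℝ, E) f x v := by
  have h := (hf.hasMFDerivAt.sub (hasMFDerivAt_const c x)).mfderiv
  unfold dir
  change mfderiv 𝓘(ℝ, E) 𝓘(ℝ) (f - fun _ => c) x v = _
  rw [h]
  exact congrArg (fun L : E →L[ℝ] ℝ => L v) (sub_zero (mfderiv 𝓘(ℝ, E) 𝓘(ℝ) f x : E →L[ℝ] ℝ))

variable [hH : IsHypersurface 𝓘(ℝ, E) (H : Set G)]

theorem isClosed_of_isHypersurface {M : Type*} [TopologicalSpace M] [ChartedSpace E M] {Z : Set M}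
    [hZ : IsHypersurface 𝓘(ℝ, E) Z] : IsClosed Z := by
  rw [← isOpen_compl_iff, isOpen_iff_mem_nhds]
  intro x hx
  obtain ⟨f, hf⟩ := hZ.exists_defFun x
  have h1 : f x ≠ 0 := fun h => hx (hf.zero_iff.self_of_nhds.1 h)
  filter_upwards [hf.smooth.self_of_nhds.continuousAt.eventually_ne h1, hf.zero_iff] with y h2 h3 h4
  exact h2 (h3.2 h4)

/-- `(G/H, {[e]})` is a `b`-manifold. -/
instance : IsHypersurface 𝓘(ℝ) ({CosetSpace.mk E H 1} : Set (CosetSpace E H)) where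
  exists_defFun q := by
    by_cases hq : q = CosetSpace.mk E H 1
    · subst hq
      obtain ⟨S, hS⟩ := exists_slice (E := E) (H := H) 1
      have hm : S.chart ∈ atlas ℝ (CosetSpace E H) := mem_range_self S
      have hs : CosetSpace.mk E H 1 ∈ S.chart.source := mem_image_of_mem _ hS
      have hsm : ∀ q ∈ S.chart.source, ContMDiffAt 𝓘(ℝ) 𝓘(ℝ) ∞ S.chart q := fun q hq =>
        contMDiffAt_of_mem_maximalAtlas (IsManifold.subset_maximalAtlas hm) hq
      refine ⟨fun q => S.chart q - S.chart (CosetSpace.mk E H 1), ?_, ?_, fun _ h => ?_⟩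
      · filter_upwards [S.chart.open_source.mem_nhds hs] with q hq
        exact (hsm q hq).sub contMDiffAt_const
      · filter_upwards [S.chart.open_source.mem_nhds hs] with q hq
        rw [sub_eq_zero, mem_singleton_iff]
        exact ⟨fun h => S.chart.injOn hq hs h, fun h => h ▸ rfl⟩
      · have hd := (hsm _ hs).mdifferentiableAt (by simp)
        have h1 := fun v => dir_sub_const hd (S.chart (CosetSpace.mk E H 1)) v
        have h2 := fun v => dir_chartVec hm hs (hsm _ hs) v
        have h3 := h1 (chartVec S.chart (CosetSpace.mk E H 1) 1)
        rw [h2] at h3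
        have h4 : S.chart ∘ S.chart.symm =ᶠ[𝓝 (S.chart (CosetSpace.mk E H 1))] id := by
          filter_upwards [S.chart.open_target.mem_nhds (S.chart.map_source hs)] with t ht
          exact S.chart.right_inv ht
        rw [h4.fderiv_eq, fderiv_id] at h3
        have h5 : dir 𝓘(ℝ) (fun q => S.chart q - S.chart (CosetSpace.mk E H 1))
          (CosetSpace.mk E H 1) (chartVec S.chart (CosetSpace.mk E H 1) 1) = 0 := by
          unfold dir
          rw [h]
          rfl
        rw [h5] at h3
        simp at h3
    · refine ⟨fun _ => 1, ?_, ?_, fun h => absurd h hq⟩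
      · exact Eventually.of_forall fun _ => contMDiffAt_const
      · have hc : IsClosed ({CosetSpace.mk E H 1} : Set (CosetSpace E H)) := by
          have hq : Topology.IsQuotientMap (CosetSpace.mk E H) := isQuotientMap_quotient_mk'
          rw [← hq.isClosed_preimage]
          have : CosetSpace.mk E H ⁻¹' {CosetSpace.mk E H 1} = H := by
            ext y
            rw [mem_preimage, mem_singleton_iff, CosetSpace.mk_eq]
            simp
          rw [this]
          exact isClosed_of_isHypersurface (E := E) (Z := (H : Set G))
        filter_upwards [hc.isOpen_compl.mem_nhds hq] with q hq
        simpa using hq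

variable (E H) in
/-- The fibre at `g` of `𝓗°`: the `b`-covectors at `g` that annihilate the vertical space
`𝓗_g = ζ_g(𝔥)` of the projection `π : G → G/H`. -/
def annSubmodule (g : G) : Submodule ℝ (BTangent 𝓘(ℝ, E) (H : Set G) g →L[ℝ] ℝ) where
  carrier := {α | ∀ X, α (zeta H g X) = 0}
  add_mem' ha hb X := by rw [_root_.add_apply, ha X, hb X, add_zero]
  zero_mem' _ := rfl
  smul_mem' c α hα X := by rw [_root_.smul_apply, hα X, smul_zero]

variable (E H) in
/-- The fibre at `g` of `𝓗°`, as a type. -/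
def Ann (g : G) : Type _ := annSubmodule E H g

/-- A `b`-covector that annihilates the vertical space, as an element of `𝓗°`. -/
def Ann.mk {g : G} (α : BTangent 𝓘(ℝ, E) (H : Set G) g →L[ℝ] ℝ)
    (hα : ∀ X, α (zeta H g X) = 0) : Ann E H g := ⟨α, hα⟩

namespace Ann

variable (g : G)

instance : AddCommGroup (Ann E H g) := inferInstanceAs (AddCommGroup (annSubmodule E H g))
instance : Module ℝ (Ann E H g) := inferInstanceAs (Module ℝ (annSubmodule E H g))
instance : TopologicalSpace (Ann E H g) := inferInstanceAs (TopologicalSpace (annSubmodule E H g))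
instance : IsTopologicalAddGroup (Ann E H g) :=
  inferInstanceAs (IsTopologicalAddGroup (annSubmodule E H g))
instance : ContinuousSMul ℝ (Ann E H g) := inferInstanceAs (ContinuousSMul ℝ (annSubmodule E H g))

end Ann

variable (E H) in
/-- Local defining functions of `H` that are submersions and constant on the cosets of `H`; their
logarithmic differentials are the local frames of `𝓗°`. -/
structure AnnFrame where
  U : Set G
  f : G → ℝ
  isOpen : IsOpen U
  isDefFun : ∀ y ∈ U, IsDefFun 𝓘(ℝ, E) (H : Set G) f y
  regular : ∀ y ∈ U, ∃ v, dir 𝓘(ℝ, E) f y v ≠ 0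
  inv : ∀ y ∈ U, ∀ y' ∈ U, y * y'⁻¹ ∈ H → f y = f y'

variable (E H) in
theorem exists_annFrame (g : G) : ∃ A : AnnFrame E H, g ∈ A.U := by
  obtain ⟨S, hS⟩ := exists_slice (E := E) (H := H) g
  have hd : ∀ y ∈ S.U, MDifferentiableAt 𝓘(ℝ, E) 𝓘(ℝ) S.s y := fun y hy =>
    (S.smooth y hy).mdifferentiableAt (by simp)
  have hr : ∀ y ∈ S.U, ∃ v, dir 𝓘(ℝ, E) (fun y => S.s y - S.s g) y v ≠ 0 := fun y hy => by
    obtain ⟨v, hv⟩ := S.regular y hy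
    exact ⟨v, by rwa [dir_sub_const (hd y hy)]⟩
  by_cases hg : g ∈ H
  · refine ⟨⟨S.U, fun y => S.s y - S.s g, S.isOpen, fun y hy => ⟨?_, ?_, fun _ h => ?_⟩, hr,
      fun y hy y' hy' h => ?_⟩, hS⟩
    · filter_upwards [S.isOpen.mem_nhds hy] with z hz
      exact (S.smooth z hz).sub contMDiffAt_const
    · filter_upwards [S.isOpen.mem_nhds hy] with z hz
      rw [sub_eq_zero, S.eq_iff z hz g hS]
      exact H.mul_mem_cancel_right (H.inv_mem hg)
    · obtain ⟨v, hv⟩ := hr y hy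
      apply hv
      unfold dir
      rw [h]
      rfl
    · rw [(S.eq_iff y hy y' hy').2 h]
  · have hc : IsOpen (S.U ∩ (H : Set G)ᶜ) :=
      S.isOpen.inter (isClosed_of_isHypersurface (E := E) (Z := (H : Set G))).isOpen_compl
    have hn : ∀ y ∈ S.U ∩ (H : Set G)ᶜ, ∀ᶠ z in 𝓝 y, z ∈ S.U ∩ (H : Set G)ᶜ := fun y hy =>
      hc.mem_nhds hy
    refine ⟨⟨S.U ∩ (H : Set G)ᶜ, fun y => Real.exp (S.s y),
      hc, fun y hy => ⟨?_, ?_, fun h => absurd h hy.2⟩, fun y hy => ?_,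
      fun y hy y' hy' h => ?_⟩, hS, hg⟩
    · filter_upwards [hn y hy] with z hz
      exact Real.contDiff_exp.contDiffAt.contMDiffAt.comp z (S.smooth z hz.1)
    · filter_upwards [hn y hy] with z hz
      exact ⟨fun h => absurd h (Real.exp_ne_zero _), fun h => absurd h hz.2⟩
    · obtain ⟨v, hv⟩ := S.regular y hy.1
      refine ⟨v, ?_⟩
      have h1 : MDifferentiableAt 𝓘(ℝ) 𝓘(ℝ) Real.exp (S.s y) :=
        Real.differentiable_exp.differentiableAt.mdifferentiableAt
      have h2 := mfderiv_comp y h1 (hd y hy.1)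
      have h3 : dir 𝓘(ℝ, E) (fun y => Real.exp (S.s y)) y v =
          fderiv ℝ Real.exp (S.s y) (dir 𝓘(ℝ, E) S.s y v) := by
        rw [mfderiv_eq_fderiv] at h2
        exact congrArg (fun L : E →L[ℝ] ℝ => L v) h2
      rw [h3, (Real.hasDerivAt_exp (S.s y)).hasFDerivAt.fderiv]
      simpa using hv
    · rw [(S.eq_iff y hy.1 y' hy'.1).2 h]

namespace AnnFrame

variable (A : AnnFrame E H)

theorem dlog_zeta {y : G} (hy : y ∈ A.U) (X : lieAlg E H) :
    dlog 𝓘(ℝ, E) (H : Set G) A.f (zeta H y X) = 0 := by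
  have := topologicalGroup_of_lieGroup 𝓘(ℝ, E) ∞ (G := G)
  have h0 : ∀ z ∈ A.U, dir 𝓘(ℝ, E) A.f z (rightField (X : E) z) = 0 := fun z hz => by
    have hf := A.isDefFun z hz
    have ht := tendsto_mul_right_one z
    rw [dir_rightField hf.smooth.self_of_nhds]
    have hk : ∀ᶠ x in 𝓝 (1 : G), ContMDiffAt 𝓘(ℝ, E) 𝓘(ℝ) ∞ (fun x => A.f (x * z)) x := by
      filter_upwards [ht.eventually hf.smooth] with x hx
      exact ContMDiffAt.comp x hx contMDiff_mul_right.contMDiffAt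
    have h1 := dir_sub_const (hk.self_of_nhds.mdifferentiableAt (by simp)) (A.f z)
      ((X : E) : TangentSpace 𝓘(ℝ, E) (1 : G))
    refine h1.symm.trans (dir_eq_zero_of_mem_lieAlg X.2 ?_ ?_)
    · filter_upwards [hk] with x hx using hx.sub contMDiffAt_const
    · filter_upwards [ht.eventually (A.isOpen.mem_nhds hz)] with x hx hxH
      rw [sub_eq_zero]
      exact A.inv _ hx z hz (by simpa using hxH)
  have h1 := (isBLift_zeta y X).2 A.f (A.isDefFun y hy)
  have : (𝓝[(H : Set G)ᶜ] y).NeBot := by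
    have hf := A.isDefFun y hy
    rw [← mem_closure_iff_nhdsWithin_neBot, mem_closure_iff_frequently]
    exact (hf.frequently_ne.and_eventually hf.zero_iff).mono fun y hy hyZ => hy.1 (hy.2.2 hyZ)
  refine tendsto_nhds_unique h1 (tendsto_const_nhds.congr' ?_)
  refine Filter.Eventually.filter_mono nhdsWithin_le_nhds ?_
  filter_upwards [A.isOpen.mem_nhds hy] with z hz
  rw [h0 z hz, zero_div]

theorem exists_dlog_eq_one {y : G} (hy : y ∈ A.U) :
    ∃ b, dlog 𝓘(ℝ, E) (H : Set G) A.f (x := y) b = 1 := by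
  obtain ⟨v, hv⟩ := A.regular y hy
  obtain ⟨b, -, hb⟩ := exists_eq (A.isDefFun y hy) ((A.f y / dir 𝓘(ℝ, E) A.f y v) • v) 1
    (by rw [dir_smul, div_mul_cancel₀ _ hv, mul_one])
  exact ⟨b, hb⟩

theorem range_zeta {y : G} (hy : y ∈ A.U) :
    LinearMap.range (zeta (E := E) H y) =
      LinearMap.ker (dlog 𝓘(ℝ, E) (H : Set G) A.f (x := y)).toLinearMap := by
  obtain ⟨B, hB⟩ := exists_bFrame (E := E) (H : Set G) y
  let e := LinearEquiv.ofBijective (B.coord y).toLinearMap (B.coord_bijective hB)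
  have : FiniteDimensional ℝ (BTangent 𝓘(ℝ, E) (H : Set G) y) :=
    LinearEquiv.finiteDimensional e.symm
  refine Submodule.eq_of_le_of_finrank_eq ?_ ?_
  · rintro _ ⟨X, rfl⟩
    exact A.dlog_zeta hy X
  · have h1 := LinearMap.finrank_range_of_inj (zeta_injective (E := E) (H := H) y)
    have h2 : (dlog 𝓘(ℝ, E) (H : Set G) A.f (x := y)).toLinearMap ≠ 0 := by
      intro h
      obtain ⟨b, hb⟩ := A.exists_dlog_eq_one hy
      have h3 : dlog 𝓘(ℝ, E) (H : Set G) A.f b = 0 := LinearMap.congr_fun h b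
      rw [hb] at h3
      exact one_ne_zero h3
    have h3 := Module.Dual.finrank_ker_add_one_of_ne_zero h2
    have h4 := finrank_lieAlg (E := E) (H := H)
    have h5 := e.finrank_eq
    omega

open Classical in
/-- A `b`-tangent vector on which `df / f` is `1`. -/
def dual (y : G) : BTangent 𝓘(ℝ, E) (H : Set G) y :=
  if hy : y ∈ A.U then (A.exists_dlog_eq_one hy).choose else 0

theorem dlog_dual {y : G} (hy : y ∈ A.U) : dlog 𝓘(ℝ, E) (H : Set G) A.f (A.dual y) = 1 := by
  rw [dual, dif_pos hy]
  exact (A.exists_dlog_eq_one hy).choose_spec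

theorem apply_eq {y : G} (hy : y ∈ A.U) (α : Ann E H y) (b : BTangent 𝓘(ℝ, E) (H : Set G) y) :
    α.1 b = α.1 (A.dual y) * dlog 𝓘(ℝ, E) (H : Set G) A.f b := by
  have h : b - dlog 𝓘(ℝ, E) (H : Set G) A.f b • A.dual y ∈
      LinearMap.range (zeta (E := E) H y) := by
    rw [A.range_zeta hy, LinearMap.mem_ker]
    change dlog 𝓘(ℝ, E) (H : Set G) A.f _ = 0
    rw [map_sub, map_smul, A.dlog_dual hy, smul_eq_mul, mul_one, sub_self]
  obtain ⟨X, hX⟩ := h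
  have h1 := α.2 X
  rw [hX, map_sub, map_smul, smul_eq_mul] at h1
  linarith

/-- The coordinate of an element of `𝓗°` in a frame. -/
def coord (y : G) : Ann E H y →L[ℝ] ℝ where
  toFun α := α.1 (A.dual y)
  map_add' _ _ := rfl
  map_smul' _ _ := rfl
  cont := (continuous_eval_const (A.dual y)).comp continuous_subtype_val

open Classical in
/-- The element of `𝓗°` with given coordinate in a frame. -/
def vec (y : G) : ℝ →ₗ[ℝ] Ann E H y :=
  LinearMap.toSpanSingleton ℝ (Ann E H y)
    (if hy : y ∈ A.U then Ann.mk (dlog 𝓘(ℝ, E) (H : Set G) A.f) (A.dlog_zeta hy) else 0)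

theorem vec_apply {y : G} (hy : y ∈ A.U) (c : ℝ) :
    (A.vec y c).1 = c • dlog 𝓘(ℝ, E) (H : Set G) A.f := by
  rw [vec, dif_pos hy]
  rfl

theorem coord_vec {y : G} (hy : y ∈ A.U) (c : ℝ) : A.coord y (A.vec y c) = c := by
  change (A.vec y c).1 (A.dual y) = c
  rw [A.vec_apply hy, _root_.smul_apply, A.dlog_dual hy, smul_eq_mul, mul_one]

theorem vec_coord {y : G} (hy : y ∈ A.U) (α : Ann E H y) : A.vec y (A.coord y α) = α := by
  apply Subtype.ext
  rw [A.vec_apply hy]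
  ext b
  exact (A.apply_eq hy α b).symm

theorem contMDiffAt_change (A' : AnnFrame E H) {x : G} (hx : x ∈ A.U ∩ A'.U) :
    ContMDiffAt 𝓘(ℝ, E) 𝓘(ℝ, ℝ →L[ℝ] ℝ) ∞
      (fun y => LinearMap.toContinuousLinearMap ((A'.coord y).toLinearMap ∘ₗ A.vec y)) x := by
  obtain ⟨B, hB⟩ := exists_bFrame (E := E) (H : Set G) x
  set w := B.coord x (A'.dual x)
  have hd := fun (C : AnnFrame E H) (hC : x ∈ C.U) =>
    (B.contMDiffAt_dlog hB (C.isDefFun x hC)).clm_apply (contMDiffAt_const (c := w))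
  have h1 := hd A hx.1
  have h2 := hd A' hx.2
  have h0 : dlog 𝓘(ℝ, E) (H : Set G) A'.f (B.vec x w) ≠ 0 := by
    rw [B.vec_coord hB, A'.dlog_dual hx.2]
    exact one_ne_zero
  have h3 : ContMDiffAt 𝓘(ℝ, E) 𝓘(ℝ, ℝ →L[ℝ] ℝ) ∞ (fun y =>
      (dlog 𝓘(ℝ, E) (H : Set G) A.f (B.vec y w) / dlog 𝓘(ℝ, E) (H : Set G) A'.f (B.vec y w)) •
        ContinuousLinearMap.id ℝ ℝ) x :=
    (h1.div₀ h2 h0).smul contMDiffAt_const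
  refine h3.congr_of_eventuallyEq ?_
  filter_upwards [A.isOpen.mem_nhds hx.1, A'.isOpen.mem_nhds hx.2,
    h2.continuousAt.eventually_ne h0] with y hy hy' h0y
  ext
  change (A.vec y 1).1 (A'.dual y) = _ * 1
  have e := A'.apply_eq hy' (A.vec y 1) (B.vec y w)
  rw [A.vec_apply hy] at e ⊢
  rw [one_smul] at e ⊢
  rw [e, mul_one]
  exact (mul_div_cancel_right₀ _ h0y).symm

end AnnFrame

variable (E H) in
/-- The local frames of `𝓗°`. -/
def annFrameFamily : FrameFamily (E := E) ℝ (Ann E H) where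
  ι := AnnFrame E H
  U A := A.U
  isOpen A := A.isOpen
  coord A := A.coord
  vec A := A.vec
  continuous_vec A y := (A.vec y).continuous_of_finiteDimensional
  coord_vec A _ hy w := A.coord_vec hy w
  vec_coord A _ hy b := A.vec_coord hy b
  idx x := (exists_annFrame E H x).choose
  mem_idx x := (exists_annFrame E H x).choose_spec
  smooth A A' _ hx := A.contMDiffAt_change A' hx

instance : TopologicalSpace (TotalSpace ℝ (Ann E H)) :=
  (annFrameFamily E H).prebundle.totalSpaceTopology

instance : FiberBundle ℝ (Ann E H) := (annFrameFamily E H).prebundle.toFiberBundle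

instance : VectorBundle ℝ ℝ (Ann E H) := (annFrameFamily E H).prebundle.toVectorBundle

instance : ContMDiffVectorBundle ∞ ℝ (Ann E H) 𝓘(ℝ, E) :=
  (annFrameFamily E H).prebundle.contMDiffVectorBundle 𝓘(ℝ, E)

variable (E H) in
/-- The vector bundle `𝓗° ⊆ ᵇT*G` over `G`. -/
abbrev AnnBundle : Type _ := TotalSpace ℝ (Ann E H)

end Group

end

section

open BTangent

section Maps

variable {E : Type*} [NormedAddCommGroup E] [NormedSpace ℝ E]
  {B : Type*} [TopologicalSpace B] (I : ModelWithCorners ℝ E B)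
  {M : Type*} [TopologicalSpace M] [ChartedSpace B M] (Z : Set M)
  {E' : Type*} [NormedAddCommGroup E'] [NormedSpace ℝ E']
  {B' : Type*} [TopologicalSpace B'] (J : ModelWithCorners ℝ E' B')
  {N : Type*} [TopologicalSpace N] [ChartedSpace B' N] (W : Set N)

/-- `F` is a `b`-map `(M, Z) → (N, W)` near `x`: it is smooth, and it pulls local defining functions
of `W` back to local defining functions of `Z` (that is, `F` is transverse to `W` and
`F ⁻¹ W = Z`). -/
structure IsBMapAt (F : M → N) (x : M) : Prop where
  smooth : ∀ᶠ y in 𝓝 x, ContMDiffAt I J ∞ F y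
  comp : ∀ f, IsDefFun J W f (F x) → IsDefFun I Z (f ∘ F) x

variable {I Z J W}

theorem dir_comp {F : M → N} {x : M} {f : N → ℝ} (hf : ContMDiffAt J 𝓘(ℝ) ∞ f (F x))
    (hF : ContMDiffAt I J ∞ F x) (v : TangentSpace I x) :
    dir I (f ∘ F) x v = dir J f (F x) (mfderiv I J F x v) := by
  unfold dir
  rw [mfderiv_comp x (hf.mdifferentiableAt (by simp)) (hF.mdifferentiableAt (by simp))]
  rfl

open Classical in
/-- The values `⟨df / f, F_* b⟩ = ⟨d(f ∘ F) / (f ∘ F), b⟩`. -/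
def bMapDlog (F : M → N) {x : M} (b : BTangent I Z x) (f : N → ℝ) : ℝ :=
  if IsDefFun J W f (F x) then dlog I Z (f ∘ F) b else 0

theorem bMap_mem {F : M → N} {x : M} (hF : IsBMapAt I Z J W F x) (b : BTangent I Z x) :
    (mfderiv I J F x (anchor I Z b), bMapDlog (J := J) (W := W) F b) ∈
      bTangentSubmodule J W (F x) := by
  refine ⟨fun f hf => if_neg hf, fun f hf => ?_, fun f f' u hf hf' hu h => ?_⟩
  · have h1 : bMapDlog (J := J) (W := W) F b f = dlog I Z (f ∘ F) b := if_pos hf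
    change dir J f (F x) (mfderiv I J F x (anchor I Z b)) = f (F x) * bMapDlog F b f
    rw [h1, ← dir_comp hf.smooth.self_of_nhds hF.smooth.self_of_nhds]
    exact dir_anchor b (hF.comp f hf)
  · have h1 : bMapDlog (J := J) (W := W) F b f = dlog I Z (f ∘ F) b := if_pos hf
    have h2 : bMapDlog (J := J) (W := W) F b f' = dlog I Z (f' ∘ F) b := if_pos hf'
    have hc := hF.smooth.self_of_nhds.continuousAt
    change bMapDlog F b f' = bMapDlog F b f + dir J u (F x) (mfderiv I J F x (anchor I Z b)) / u (F x)
    rw [h1, h2, ← dir_comp hu.self_of_nhds hF.smooth.self_of_nhds]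
    refine dlog_mul b (hF.comp f hf) (hF.comp f' hf') ?_ (hc.eventually h)
    filter_upwards [hc.eventually hu, hF.smooth] with y h3 h4
    exact ContMDiffAt.comp y h3 h4

variable (I Z J W)

open Classical in
/-- The `b`-tangent map `F_* : ᵇT_x M → ᵇT_{F x} N` of a `b`-map `F`
(and `0` if `F` is not a `b`-map near `x`). -/
def bMap (F : M → N) (x : M) : BTangent I Z x →ₗ[ℝ] BTangent J W (F x) :=
  if hF : IsBMapAt I Z J W F x then
    { toFun := fun b => ⟨_, bMap_mem hF b⟩
      map_add' := fun b b' => by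
        refine Subtype.ext (Prod.ext ?_ (funext fun f => ?_))
        · exact (congrArg _ (map_add (anchor I Z) b b')).trans (map_add (mfderiv I J F x) _ _)
        · change bMapDlog F (b + b') f = bMapDlog F b f + bMapDlog F b' f
          unfold bMapDlog
          split_ifs
          · exact map_add _ _ _
          · rw [add_zero]
      map_smul' := fun c b => by
        refine Subtype.ext (Prod.ext ?_ (funext fun f => ?_))
        · exact (congrArg _ (map_smul (anchor I Z) c b)).trans (map_smul (mfderiv I J F x) _ _)
        · change bMapDlog F (c • b) f = c * bMapDlog F b f
          unfold bMapDlog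
          split_ifs
          · exact map_smul _ _ _
          · rw [mul_zero] }
  else 0

/-- Differential `k`-forms on the `b`-manifold `(M, Z)`: sections (not necessarily smooth) of the
`k`-th exterior power of the `b`-cotangent bundle. -/
abbrev BForm (k : ℕ) : Type _ := ∀ x : M, BTangent I Z x [⋀^Fin k]→ₗ[ℝ] ℝ

variable {I Z J W}

/-- The pull-back of a `b`-form under a `b`-map. -/
def BForm.pullback (F : M → N) {k : ℕ} (α : BForm J W k) : BForm I Z k :=
  fun x => (α (F x)).compLinearMap (bMap I Z J W F x)

variable [IsManifold I ∞ M]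

/-- A `b`-form is smooth if its values on smooth local `b`-vector fields are smooth. -/
def BForm.IsSmooth {k : ℕ} (α : BForm I Z k) : Prop :=
  ∀ (x : M) (V : Fin k → ∀ y : M, TangentSpace I y), (∀ i, IsBVectorFieldAt I Z (V i) x) →
    ContMDiffAt I 𝓘(ℝ) ∞ (fun y => α y fun i => bLift I Z (V i) y) x

/-- Koszul's formula for `dα(V₀, …, Vₙ₊₁)` at `x`, where `α` is a form of degree `n + 1`:
`∑ i, (-1)^i Vᵢ(α(V₀, …, V̂ᵢ, …)) + ∑ i < j, (-1)^(i+j) α([Vᵢ, Vⱼ], V₀, …, V̂ᵢ, …, V̂ⱼ, …)`; in the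
second sum, `j` is replaced by `j + 1`. -/
def BForm.koszul {n : ℕ} (α : BForm I Z (n + 1)) (V : Fin (n + 2) → ∀ y : M, TangentSpace I y)
    (x : M) : ℝ :=
  (∑ i : Fin (n + 2), (-1) ^ (i : ℕ) *
    dir I (fun y => α y (i.removeNth fun k => bLift I Z (V k) y)) x (V i x)) -
  ∑ i : Fin (n + 1), ∑ j ∈ Finset.univ.filter (i ≤ ·), (-1) ^ (i + j : ℕ) *
    α x (Matrix.vecCons (bLift I Z (VectorField.mlieBracket I (V i.castSucc) (V j.succ)) x)
      (j.removeNth (i.castSucc.removeNth fun k => bLift I Z (V k) x)))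

open Classical in
/-- The exterior derivative of a `b`-form of degree at least `1`, given by Koszul's formula on local
`b`-vector fields. -/
def BForm.d {n : ℕ} (α : BForm I Z (n + 1)) : BForm I Z (n + 2) := fun x =>
  if h : ∃ η : BTangent I Z x [⋀^Fin (n + 2)]→ₗ[ℝ] ℝ,
      ∀ V : Fin (n + 2) → ∀ y : M, TangentSpace I y, (∀ i, IsBVectorFieldAt I Z (V i) x) →
        η (fun i => bLift I Z (V i) x) = α.koszul V x
  then h.choose else 0

/-- A `b`-symplectic form: a smooth, closed and nondegenerate `b`-form of degree `2`. -/
structure BForm.IsSymplectic (α : BForm I Z 2) : Prop where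
  smooth : α.IsSmooth
  closed : ∀ (x : M) (V : Fin 3 → ∀ y : M, TangentSpace I y),
    (∀ i, IsBVectorFieldAt I Z (V i) x) → α.koszul V x = 0
  nondegenerate : ∀ (x : M) (b : BTangent I Z x), (∀ c, α x ![b, c] = 0) → b = 0

end Maps

section Canonical

variable (E : Type*) [NormedAddCommGroup E] [NormedSpace ℝ E] [FiniteDimensional ℝ E]
  {M : Type*} [TopologicalSpace M] [ChartedSpace E M] [IsManifold 𝓘(ℝ, E) ∞ M]
  (Z : Set M) [IsHypersurface 𝓘(ℝ, E) Z]

/-- The critical hypersurface `ᵇT*M|_Z` of the `b`-cotangent bundle. -/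
def cotangentCritical : Set (BCotangentBundle E Z) := {p | p.proj ∈ Z}

/-- The canonical (Liouville) `b`-form `λ_p(w) = ⟨p, τ_* w⟩` on the `b`-cotangent bundle, where
`τ : ᵇT*M → M` is the projection. -/
def liouvilleForm : BForm (𝓘(ℝ, E).prod 𝓘(ℝ, E →L[ℝ] ℝ)) (cotangentCritical E Z) 1 := fun p =>
  AlternatingMap.ofSubsingleton ℝ _ _ (0 : Fin 1)
    (p.2.toLinearMap ∘ₗ bMap (𝓘(ℝ, E).prod 𝓘(ℝ, E →L[ℝ] ℝ)) (cotangentCritical E Z) 𝓘(ℝ, E) Z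
      (TotalSpace.proj : BCotangentBundle E Z → M) p)

/-- The canonical `b`-symplectic form `ω = -dλ` on the `b`-cotangent bundle. -/
def canonicalForm : BForm (𝓘(ℝ, E).prod 𝓘(ℝ, E →L[ℝ] ℝ)) (cotangentCritical E Z) 2 :=
  -(liouvilleForm E Z).d

end Canonical

section Group

variable {E : Type*} [NormedAddCommGroup E] [NormedSpace ℝ E] [FiniteDimensional ℝ E]
  {G : Type*} [TopologicalSpace G] [ChartedSpace E G] [Group G] [LieGroup 𝓘(ℝ, E) ∞ G]
  (H : Subgroup G) [IsHypersurface 𝓘(ℝ, E) (H : Set G)]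

/-- The adjoint action `Ad_h` on `T_e G`. -/
def Ad (h : G) (X : E) : E := mfderiv 𝓘(ℝ, E) 𝓘(ℝ, E) (fun x : G => h * x * h⁻¹) 1 X

variable (E) in
/-- A principal `H`-`b`-connection for `π : G → G/H`: an `𝔥`-valued `b`-form `θ` of degree `1` on
`(G, H)` with `θ(ζ_g X) = X` and `θ((L_h)_* v) = Ad_h (θ v)`. -/
structure BConnection where
  /-- The values of the connection form. -/
  toFun (g : G) : BTangent 𝓘(ℝ, E) (H : Set G) g →L[ℝ] lieAlg E H
  smooth : ∀ (x : G) (V : ∀ y : G, TangentSpace 𝓘(ℝ, E) y),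
    IsBVectorFieldAt 𝓘(ℝ, E) (H : Set G) V x →
      ContMDiffAt 𝓘(ℝ, E) 𝓘(ℝ, lieAlg E H) ∞
        (fun y => toFun y (bLift 𝓘(ℝ, E) (H : Set G) V y)) x
  apply_zeta : ∀ (g : G) (X : lieAlg E H), toFun g (zeta H g X) = X
  equivariant : ∀ h ∈ H, ∀ (g : G) (v : BTangent 𝓘(ℝ, E) (H : Set G) g),
    (toFun (h * g) (bMap 𝓘(ℝ, E) (H : Set G) 𝓘(ℝ, E) (H : Set G) (fun y : G => h * y) g v) : E) =
      Ad h (toFun g v : E)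

variable (E) in
/-- The infinitesimal action `ζ_g`, as a continuous linear map. -/
def zetaL (g : G) : lieAlg E H →L[ℝ] BTangent 𝓘(ℝ, E) (H : Set G) g :=
  ⟨zeta H g, (zeta H g).continuous_of_finiteDimensional⟩

variable (E) in
/-- The model of the manifold `𝓗° × 𝔥*`. -/
abbrev annDualModel := (𝓘(ℝ, E).prod 𝓘(ℝ)).prod 𝓘(ℝ, lieAlg E H →L[ℝ] ℝ)

variable (E) in
/-- The critical hypersurface `𝓗°|_H` of `𝓗°`. -/
def annCritical : Set (AnnBundle E H) := {α | α.proj ∈ H}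

variable (E) in
/-- The critical hypersurface `𝓗°|_H × 𝔥*` of `𝓗° × 𝔥*`. -/
def annDualCritical : Set (AnnBundle E H × (lieAlg E H →L[ℝ] ℝ)) := {n | n.1.proj ∈ H}

variable {H}

/-- The map `ψ_θ : ᵇT*G → 𝓗° × 𝔥*`, `α_g ↦ (α_g - α_g ∘ ζ_g ∘ θ_g, α_g ∘ ζ_g)`. -/
def psi (θ : BConnection E H) (p : BCotangentBundle E (H : Set G)) :
    AnnBundle E H × (lieAlg E H →L[ℝ] ℝ) :=
  (⟨p.1, Ann.mk (p.2 - (p.2.comp (zetaL E H p.1)).comp (θ.toFun p.1)) fun X => by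
    change p.2 (zeta H p.1 X) - p.2 (zeta H p.1 (θ.toFun p.1 (zeta H p.1 X))) = 0
    rw [θ.apply_zeta, sub_self]⟩, p.2.comp (zetaL E H p.1))

open Classical in
/-- The map `π̄ : 𝓗° → ᵇT*(G/H)`, where `π̄(α_g)` is the `b`-covector at `π(g)` with
`⟨π̄(α_g), π_* v⟩ = ⟨α_g, v⟩` for all `v`. -/
def piBar (α : AnnBundle E H) :
    BCotangentBundle ℝ ({CosetSpace.mk E H 1} : Set (CosetSpace E H)) :=
  ⟨CosetSpace.mk E H α.1,
    if h : ∃ β : BTangent 𝓘(ℝ) ({CosetSpace.mk E H 1} : Set (CosetSpace E H))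
        (CosetSpace.mk E H α.1) →L[ℝ] ℝ,
      ∀ v, β (bMap 𝓘(ℝ, E) (H : Set G) 𝓘(ℝ) {CosetSpace.mk E H 1} (CosetSpace.mk E H) α.1 v) =
        α.2.1 v
    then h.choose else 0⟩

/-- The `b`-form `λ^θ_{(α,μ)}(w, φ) = μ((τ^*θ)(w))` on `𝓗° × 𝔥*`, where `τ : 𝓗° → G` is the
projection. -/
def lambdaForm (θ : BConnection E H) : BForm (annDualModel E H) (annDualCritical E H) 1 := fun n =>
  AlternatingMap.ofSubsingleton ℝ _ _ (0 : Fin 1)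
    (n.2.toLinearMap ∘ₗ (θ.toFun n.1.proj).toLinearMap ∘ₗ
      bMap (𝓘(ℝ, E).prod 𝓘(ℝ)) (annCritical E H) 𝓘(ℝ, E) (H : Set G)
        (TotalSpace.proj : AnnBundle E H → G) n.1 ∘ₗ
      bMap (annDualModel E H) (annDualCritical E H) (𝓘(ℝ, E).prod 𝓘(ℝ)) (annCritical E H)
        (Prod.fst : AnnBundle E H × (lieAlg E H →L[ℝ] ℝ) → AnnBundle E H) n)

variable (E H) in
/-- The `b`-form `π̄^* ω_{G/H}` on `𝓗° × 𝔥*`. -/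
def reducedForm : BForm (annDualModel E H) (annDualCritical E H) 2 :=
  BForm.pullback (Prod.fst : AnnBundle E H × (lieAlg E H →L[ℝ] ℝ) → AnnBundle E H)
    (BForm.pullback (I := 𝓘(ℝ, E).prod 𝓘(ℝ)) (Z := annCritical E H) piBar
      (canonicalForm ℝ ({CosetSpace.mk E H 1} : Set (CosetSpace E H))))

end Group

end

end BGeom

end

open BGeom

/-! The identity already holds for the Liouville forms, before differentiating. The inverse of `ψ_θ`
is `(α, μ) ↦ α + μ ∘ θ` (`psiInv`), and it covers the identity of `G`. So the pull-back of `λ_G` to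
`𝓗° × 𝔥*` takes a vector `w` at `(α, μ)` to `⟨α, τ_* w⟩ + μ(θ(τ_* w))`. The second term is `λ^θ`.
The first is `⟨π̄ α, π_* τ_* w⟩`, the value of the pull-back of `λ_{G/H}`, because the projection of
`ᵇT*(G/H)` composed with `π̄` is `π ∘ τ` (`pullback_psiInv_liouvilleForm`). Applying `-d`, which is
additive and commutes with pull-back under `b`-maps, gives the formula
(`pullback_psiInv_canonicalForm`).

The substance lies in a usable calculus for `d`, which is defined by choosing some form that
satisfies Koszul's formula. `HasDAt` singles out the forms that are locally sums of `a dg` and `a df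
/ f`, together with the formal differential built from `da ∧ dg` and `da ∧ df / f`. The formal
differential satisfies Koszul's formula because `dg` and `df / f` are closed (`dir_mlieBracket`,
`IsBVectorFieldAt.dlog_mlieBracket`). Koszul's formula determines a form because every `b`-tangent
vector extends to a local `b`-vector field (`exists_isBVectorFieldAt`). Hence `d` is the formal
differential (`HasDAt.d_eq`), which yields additivity, naturality and `d² = 0`. The Liouville forms
and `λ^θ` belong to this class because the coframe of a `b`-frame consists of sums of such
generators (`HasDAt.of_frame`). Identities that involve division by `f` are proved off the
hypersurface and extended by the density of its complement.

Nondegeneracy of the canonical form is the classical duality between vertical directions and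
directions of the base (`canonicalForm_nondegenerate`), and it is carried to `𝓗° × 𝔥*` by the
diffeomorphism. Smoothness of `ψ_θ`, of its inverse and of `π̄` is checked in frames. This uses that
the smooth structure of `𝓗°` is the one seen inside `ᵇT*G`, and that an element of `𝓗°` is locally a
multiple of `π^*(dk / k)` for a defining function `k` of `[e]`. -/

noncomputable section

namespace BGeom

open Set Filter Bundle
open scoped Topology

set_option linter.unusedSectionVars false

open BTangent


/-! ### Derivatives along vector fields on manifolds modelled without boundary. -/

section BoundarylessModel

variable {E : Type*} [NormedAddCommGroup E] [NormedSpace ℝ E]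
  {B : Type*} [TopologicalSpace B] {I : ModelWithCorners ℝ E B}
  {M : Type*} [TopologicalSpace M] [ChartedSpace B M]
  {Z : Set M} {x : M}

/-- `f` is smooth near `x`. -/
def SmoothNear (I : ModelWithCorners ℝ E B) (f : M → ℝ) (x : M) : Prop :=
  ∀ᶠ y in 𝓝 x, ContMDiffAt I 𝓘(ℝ) ∞ f y

namespace SmoothNear

variable {f g : M → ℝ}

theorem contMDiffAt (h : SmoothNear I f x) : ContMDiffAt I 𝓘(ℝ) ∞ f x := Eventually.self_of_nhds h

theorem mdiff (h : SmoothNear I f x) : MDifferentiableAt I 𝓘(ℝ) f x :=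
  h.contMDiffAt.mdifferentiableAt (by simp)

protected theorem eventually (h : SmoothNear I f x) : ∀ᶠ y in 𝓝 x, SmoothNear I f y :=
  h.eventually_nhds

theorem const (c : ℝ) : SmoothNear I (fun _ : M => c) x :=
  Eventually.of_forall fun _ => contMDiffAt_const

theorem add (hf : SmoothNear I f x) (hg : SmoothNear I g x) :
    SmoothNear I (fun y => f y + g y) x := by
  filter_upwards [hf, hg] with y a b using a.add b

theorem sub (hf : SmoothNear I f x) (hg : SmoothNear I g x) :
    SmoothNear I (fun y => f y - g y) x := by
  filter_upwards [hf, hg] with y a b using a.sub b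

theorem neg (hf : SmoothNear I f x) : SmoothNear I (fun y => - f y) x := by
  filter_upwards [hf] with y a using a.neg

theorem mul (hf : SmoothNear I f x) (hg : SmoothNear I g x) :
    SmoothNear I (fun y => f y * g y) x := by
  filter_upwards [hf, hg] with y a b using a.mul b

theorem div (hf : SmoothNear I f x) (hg : SmoothNear I g x) (h0 : g x ≠ 0) :
    SmoothNear I (fun y => f y / g y) x := by
  filter_upwards [hf, hg, hg.contMDiffAt.continuousAt.eventually_ne h0] with y a b c using a.div₀ b c

theorem congr (hf : SmoothNear I f x) (h : ∀ᶠ y in 𝓝 x, g y = f y) : SmoothNear I g x := by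
  filter_upwards [hf, h.eventually_nhds] with y a b using a.congr_of_eventuallyEq b

end SmoothNear

theorem IsDefFun.ne_zero {f : M → ℝ} (hf : IsDefFun I Z f x) (hx : x ∉ Z) : f x ≠ 0 := fun h =>
  hx (hf.zero_iff.self_of_nhds.1 h)

theorem IsDefFun.eq_zero {f : M → ℝ} (hf : IsDefFun I Z f x) (hx : x ∈ Z) : f x = 0 :=
  hf.zero_iff.self_of_nhds.2 hx

section Dir

variable {f g : M → ℝ}

theorem dir_zero (f : M → ℝ) : dir I f x 0 = 0 := map_zero (mfderiv I 𝓘(ℝ) f x)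

theorem dir_neg (f : M → ℝ) (v : TangentSpace I x) : dir I f x (-v) = - dir I f x v :=
  map_neg (mfderiv I 𝓘(ℝ) f x) v

theorem dir_congr_nhds (h : f =ᶠ[𝓝 x] g) (v : TangentSpace I x) :
    dir I f x v = dir I g x v := by
  unfold dir
  rw [h.mfderiv_eq]
  rfl

theorem dir_mul_fun (hu : MDifferentiableAt I 𝓘(ℝ) f x)
    (hg : MDifferentiableAt I 𝓘(ℝ) g x) (v : TangentSpace I x) :
    dir I (fun y => f y * g y) x v = f x * dir I g x v + g x * dir I f x v := by
  have h1 := hu.hasMFDerivAt.mul hg.hasMFDerivAt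
  change dir I (f * g) x v = _
  unfold dir
  rw [h1.mfderiv]
  rfl

theorem dir_add_fun (hu : MDifferentiableAt I 𝓘(ℝ) f x)
    (hg : MDifferentiableAt I 𝓘(ℝ) g x) (v : TangentSpace I x) :
    dir I (fun y => f y + g y) x v = dir I f x v + dir I g x v := by
  have h1 := hu.hasMFDerivAt.add hg.hasMFDerivAt
  change dir I (f + g) x v = _
  unfold dir
  rw [h1.mfderiv]
  rfl

theorem dir_sub_fun (hu : MDifferentiableAt I 𝓘(ℝ) f x)
    (hg : MDifferentiableAt I 𝓘(ℝ) g x) (v : TangentSpace I x) :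
    dir I (fun y => f y - g y) x v = dir I f x v - dir I g x v := by
  have h1 := hu.hasMFDerivAt.sub hg.hasMFDerivAt
  change dir I (f - g) x v = _
  unfold dir
  rw [h1.mfderiv]
  rfl

theorem dir_neg_fun (hu : MDifferentiableAt I 𝓘(ℝ) f x) (v : TangentSpace I x) :
    dir I (fun y => - f y) x v = - dir I f x v := by
  have h1 := hu.hasMFDerivAt.neg
  change dir I (-f) x v = _
  unfold dir
  rw [h1.mfderiv]
  rfl

theorem dir_const_fun (c : ℝ) (v : TangentSpace I x) : dir I (fun _ => c) x v = 0 := by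
  unfold dir
  rw [mfderiv_const]
  rfl

end Dir

section Chart

variable [I.Boundaryless] [IsManifold I ∞ M]

/-- Without boundary, the target of the extended chart is a neighbourhood of each of its points, so
smoothness on the target is smoothness at the point. -/
theorem contMDiffAt_extChartAt_symm {z : E} (hz : z ∈ (extChartAt I x).target) :
    ContMDiffAt 𝓘(ℝ, E) I ∞ (extChartAt I x).symm z :=
  (contMDiffOn_extChartAt_symm x).contMDiffAt (extChartAt_target_mem_nhds' hz)

theorem contDiffAt_comp_extChartAt_symm {V : Type*} [NormedAddCommGroup V] [NormedSpace ℝ V]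
    {f : M → V} {y : M} (hy : y ∈ (extChartAt I x).source) (hf : ContMDiffAt I 𝓘(ℝ, V) ∞ f y) :
    ContDiffAt ℝ ∞ (f ∘ (extChartAt I x).symm) (extChartAt I x y) := by
  rw [← contMDiffAt_iff_contDiffAt]
  refine ContMDiffAt.comp _ (I' := I) (by rwa [(extChartAt I x).left_inv hy])
    (contMDiffAt_extChartAt_symm ((extChartAt I x).map_source hy))

theorem contMDiffAt_comp_extChartAt {V : Type*} [NormedAddCommGroup V] [NormedSpace ℝ V]
    {F : E → V} {y : M} (hy : y ∈ (extChartAt I x).source)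
    (hF : ContDiffAt ℝ ∞ F (extChartAt I x y)) :
    ContMDiffAt I 𝓘(ℝ, V) ∞ (F ∘ extChartAt I x) y :=
  hF.contMDiffAt.comp y (contMDiffAt_extChartAt' (by rwa [extChartAt_source] at hy))

/-- The extended chart is a local homeomorphism onto an open set, again because there is no
boundary; germs in `M` and in `E` therefore correspond. -/
theorem eventually_nhds_extChartAt {y : M} (hy : y ∈ (extChartAt I x).source) {p : E → Prop} :
    (∀ᶠ z in 𝓝 (extChartAt I x y), p z) ↔ ∀ᶠ w in 𝓝 y, p (extChartAt I x w) := by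
  constructor
  · intro h
    exact (continuousAt_extChartAt' hy).eventually h
  · intro h
    have h1 := continuousAt_extChartAt_symm' (I := I) hy
    rw [ContinuousAt, (extChartAt I x).left_inv hy] at h1
    filter_upwards [h1.eventually h,
      extChartAt_target_mem_nhds' ((extChartAt I x).map_source hy)] with z hz hzt
    rwa [(extChartAt I x).right_inv hzt] at hz

theorem mfderiv_extChartAt_symm_apply {y : M} (hy : y ∈ (extChartAt I x).source)
    (v : TangentSpace I y) :
    (mfderivWithin 𝓘(ℝ, E) I (extChartAt I x).symm (range I) (extChartAt I x y)
      (mfderiv I 𝓘(ℝ, E) (extChartAt I x) y v) : E) = v := by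
  have : IsManifold I 1 M := IsManifold.of_le (n := ∞) (by simp)
  exact congrArg (fun L => L v) (mfderivWithin_extChartAt_symm_comp_mfderiv_extChartAt' hy)

/-- The chain rule for `f = (f ∘ φ⁻¹) ∘ φ` near `y`; it turns derivatives on the manifold into
Fréchet derivatives in the model space. -/
theorem dir_eq_fderiv {f : M → ℝ} {y : M} (hy : y ∈ (extChartAt I x).source)
    (hf : ContMDiffAt I 𝓘(ℝ) ∞ f y) (v : TangentSpace I y) :
    dir I f y v = fderiv ℝ (f ∘ (extChartAt I x).symm) (extChartAt I x y)
      (mfderiv I 𝓘(ℝ, E) (extChartAt I x) y v) := by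
  have : IsManifold I 1 M := IsManifold.of_le (n := ∞) (by simp)
  have h1 := contDiffAt_comp_extChartAt_symm hy hf
  have h2 : MDifferentiableAt I 𝓘(ℝ, E) (extChartAt I x) y :=
    mdifferentiableAt_extChartAt (by rwa [extChartAt_source] at hy)
  have h3 : f =ᶠ[𝓝 y] (f ∘ (extChartAt I x).symm) ∘ extChartAt I x := by
    filter_upwards [(isOpen_extChartAt_source (I := I) x).mem_nhds hy] with z hz
    simp only [Function.comp, (extChartAt I x).left_inv hz]
  rw [dir_congr_nhds h3]
  unfold dir
  rw [mfderiv_comp y (h1.differentiableAt (by simp)).mdifferentiableAt h2, mfderiv_eq_fderiv]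
  rfl

theorem exists_dir_ne_zero {f : M → ℝ} {y : M} (h : mfderiv I 𝓘(ℝ) f y ≠ 0) :
    ∃ v, dir I f y v ≠ 0 := by
  by_contra! h0
  exact h (ContinuousLinearMap.ext h0)

/-- The derivatives of the chart and of its inverse are mutually inverse, so the two derivatives of
`f` vanish together. -/
theorem fderiv_ne_zero_iff {f : M → ℝ} {y : M} (hy : y ∈ (extChartAt I x).source)
    (hf : ContMDiffAt I 𝓘(ℝ) ∞ f y) :
    fderiv ℝ (f ∘ (extChartAt I x).symm) (extChartAt I x y) ≠ 0 ↔ mfderiv I 𝓘(ℝ) f y ≠ 0 := by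
  have : IsManifold I 1 M := IsManifold.of_le (n := ∞) (by simp)
  refine not_congr ⟨fun h => ?_, fun h => ?_⟩
  · ext v
    have := dir_eq_fderiv hy hf v
    rw [h] at this
    exact this
  · ext w
    have e := congrArg (fun L => L w) (mfderiv_extChartAt_comp_mfderivWithin_extChartAt_symm'
      (I := I) hy)
    have h1 := dir_eq_fderiv hy hf
      (mfderivWithin 𝓘(ℝ, E) I (extChartAt I x).symm (range I) (extChartAt I x y) w)
    have h2 : dir I f y (mfderivWithin 𝓘(ℝ, E) I (extChartAt I x).symm (range I)
        (extChartAt I x y) w) = 0 := by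
      unfold dir; rw [h]; rfl
    rw [h2] at h1
    refine Eq.trans ?_ h1.symm
    exact congrArg (fderiv ℝ (f ∘ (extChartAt I x).symm) (extChartAt I x y)) e.symm

/-- In the chart at `x` the function is the derivative of the coordinate expression of `f` paired
with `dφ(V)`, and `dφ(V)` is the fibre coordinate of `V` in the tangent bundle. -/
theorem contMDiffAt_dir_of_smoothNear {f : M → ℝ} {V : ∀ x : M, TangentSpace I x}
    (hf : SmoothNear I f x)
    (hV : ContMDiffAt I I.tangent ∞ (fun z => (⟨z, V z⟩ : TangentBundle I M)) x) :
    ContMDiffAt I 𝓘(ℝ) ∞ (fun y => dir I f y (V y)) x := by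
  have : IsManifold I 1 M := IsManifold.of_le (n := ∞) (by simp)
  have h1 : ContMDiffAt I 𝓘(ℝ, E →L[ℝ] ℝ) ∞
      (fun y => fderiv ℝ (f ∘ (extChartAt I x).symm) (extChartAt I x y)) x :=
    contMDiffAt_comp_extChartAt (V := E →L[ℝ] ℝ) (mem_extChartAt_source x)
      ((contDiffAt_comp_extChartAt_symm (mem_extChartAt_source x) hf.contMDiffAt).fderiv_right (by simp))
  have h2 := (Bundle.contMDiffAt_totalSpace.1 hV).2
  refine (h1.clm_apply h2).congr_of_eventuallyEq ?_
  filter_upwards [extChartAt_source_mem_nhds (I := I) x, hf] with y hy hfy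
  have hy' : y ∈ (chartAt B x).source := by rwa [extChartAt_source] at hy
  have e : (trivializationAt E (TangentSpace I) x ⟨y, V y⟩).2 =
      mfderiv I 𝓘(ℝ, E) (extChartAt I x) y (V y) := by
    have h3 := TangentBundle.continuousLinearMapAt_trivializationAt (I := I) (x₀ := x) hy'
    have h4 := Trivialization.continuousLinearMapAt_apply_of_mem ℝ
      (trivializationAt E (TangentSpace I) x) (b := y) (by simpa using hy') (V y)
    rw [h3] at h4
    exact h4.symm
  rw [dir_eq_fderiv hy hfy]
  exact congrArg _ e.symm

/-- The Lie bracket of vector fields is the commutator of derivations. -/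
theorem dir_mlieBracket [CompleteSpace E] {f : M → ℝ} {V W : ∀ x : M, TangentSpace I x}
    (hf : SmoothNear I f x)
    (hV : ContMDiffAt I I.tangent ∞ (fun z => (⟨z, V z⟩ : TangentBundle I M)) x)
    (hW : ContMDiffAt I I.tangent ∞ (fun z => (⟨z, W z⟩ : TangentBundle I M)) x) :
    dir I f x (VectorField.mlieBracket I V W x) =
      dir I (fun y => dir I f y (W y)) x (V x) - dir I (fun y => dir I f y (V y)) x (W x) := by
  have : IsManifold I 1 M := IsManifold.of_le (n := ∞) (by simp)
  have : IsManifold I 2 M := IsManifold.of_le (n := ∞) ENat.LEInfty.out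
  set φ := extChartAt I x
  have hx : x ∈ φ.source := mem_extChartAt_source x
  -- `hat V` is the coordinate expression of `V`; `key` identifies it with `dφ(V)`.
  let hat : (∀ x : M, TangentSpace I x) → E → E := fun V =>
    VectorField.mpullbackWithin 𝓘(ℝ, E) I φ.symm V (range I)
  have key : ∀ V : (∀ x : M, TangentSpace I x), ∀ y ∈ φ.source,
      hat V (φ y) = mfderiv I 𝓘(ℝ, E) φ y (V y) := by
    intro V y hy
    have h1 := isInvertible_mfderivWithin_extChartAt_symm (I := I) (φ.map_source hy)
    have h2 : (mfderivWithin 𝓘(ℝ, E) I φ.symm (range I) (φ y)).inverse (V (φ.symm (φ y))) =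
        mfderiv I 𝓘(ℝ, E) φ y (V y) := by
      have e := mfderiv_extChartAt_symm_apply (I := I) (x := x) hy (V y)
      have e2 : ∀ z, z = y → ∀ L : E →L[ℝ] E, L (V z) = L (V y) := by rintro z rfl L; rfl
      refine (e2 _ (φ.left_inv hy) _).trans ?_
      refine (congrArg (mfderivWithin 𝓘(ℝ, E) I φ.symm (range I) (φ y)).inverse e.symm).trans ?_
      exact h1.inverse_apply_self _
    exact h2
  have hd : ∀ V : (∀ x : M, TangentSpace I x),
      ContMDiffAt I I.tangent ∞ (fun z => (⟨z, V z⟩ : TangentBundle I M)) x →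
      DifferentiableAt ℝ (hat V) (φ x) := by
    intro V hV
    have h1 := MDifferentiableWithinAt.differentiableWithinAt_mpullbackWithin_vectorField
      (s := univ) (hV.mdifferentiableAt (by simp)).mdifferentiableWithinAt
    rw [preimage_univ, univ_inter, I.range_eq_univ] at h1
    have h2 := differentiableWithinAt_univ.1 h1
    simpa only [hat, I.range_eq_univ] using h2
  have hfd := contDiffAt_comp_extChartAt_symm hx hf.contMDiffAt
  set fh := f ∘ φ.symm
  have hdf : DifferentiableAt ℝ (fderiv ℝ fh) (φ x) :=
    (hfd.fderiv_right (m := ∞) (by simp)).differentiableAt (by simp)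
  -- In coordinates `V (W f) = D²f(V, W) + Df(DW(V))`. Antisymmetrizing removes the first term,
  -- since `D²f` is symmetric, and leaves `Df` applied to the coordinate bracket.
  have hdir : ∀ V W : (∀ x : M, TangentSpace I x),
      ContMDiffAt I I.tangent ∞ (fun z => (⟨z, V z⟩ : TangentBundle I M)) x →
      ContMDiffAt I I.tangent ∞ (fun z => (⟨z, W z⟩ : TangentBundle I M)) x →
      dir I (fun y => dir I f y (W y)) x (V x) =
        fderiv ℝ (fderiv ℝ fh) (φ x) (hat V (φ x)) (hat W (φ x)) +
          fderiv ℝ fh (φ x) (fderiv ℝ (hat W) (φ x) (hat V (φ x))) := by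
    intro V W hV hW
    rw [dir_eq_fderiv hx (contMDiffAt_dir_of_smoothNear hf hW)]
    have e : (fun y => dir I f y (W y)) ∘ φ.symm =ᶠ[𝓝 (φ x)]
        fun z => fderiv ℝ fh z (hat W z) := by
      rw [EventuallyEq, eventually_nhds_extChartAt hx]
      filter_upwards [extChartAt_source_mem_nhds (I := I) x, hf] with y hy hfy
      change dir I f (φ.symm (φ y)) (W (φ.symm (φ y))) = fderiv ℝ fh (φ y) (hat W (φ y))
      rw [φ.left_inv hy, dir_eq_fderiv hy hfy, key W y hy]
    rw [e.fderiv_eq]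
    have h1 := congrArg (fun L => L (hat V (φ x)))
      (hdf.hasFDerivAt.clm_apply (hd W hW).hasFDerivAt).fderiv
    refine (congrArg (fderiv ℝ (fun z => fderiv ℝ fh z (hat W z)) (φ x)) (key V x hx).symm).trans ?_
    exact h1.trans (add_comm _ _)
  rw [hdir V W hV hW, hdir W V hW hV]
  have hsym : IsSymmSndFDerivAt ℝ fh (φ x) := hfd.isSymmSndFDerivAt (by
    rw [minSmoothness_of_isRCLikeNormedField]; exact ENat.LEInfty.out)
  rw [dir_eq_fderiv hx hf.contMDiffAt]
  have hb : (mfderiv I 𝓘(ℝ, E) φ x (VectorField.mlieBracket I V W x) : E) =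
      fderiv ℝ (hat W) (φ x) (hat V (φ x)) - fderiv ℝ (hat V) (φ x) (hat W (φ x)) := by
    have h1 : VectorField.mlieBracket I V W x = (mfderiv I 𝓘(ℝ, E) φ x).inverse
        (fderiv ℝ (hat W) (φ x) (hat V (φ x)) - fderiv ℝ (hat V) (φ x) (hat W (φ x))) := by
      rw [← VectorField.mlieBracketWithin_univ, VectorField.mlieBracketWithin_apply]
      change _ = (mfderiv I 𝓘(ℝ, E) φ x).inverse
        (VectorField.lieBracket ℝ (E := E) (hat V) (hat W) (φ x))
      rw [← VectorField.lieBracketWithin_univ, preimage_univ, univ_inter]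
      simp only [hat, φ, I.range_eq_univ]
    rw [h1]
    exact (isInvertible_mfderiv_extChartAt (I := I) hx).self_apply_inverse _
  rw [hb, map_sub, hsym.eq (hat V (φ x)) (hat W (φ x))]
  ring

end Chart

end BoundarylessModel


/-! ### Local defining functions, `b`-tangent vectors and lifts of `b`-vector fields. -/

section BoundarylessDefFun

variable {E : Type*} [NormedAddCommGroup E] [NormedSpace ℝ E]
  {B : Type*} [TopologicalSpace B] {I : ModelWithCorners ℝ E B} [I.Boundaryless]
  {M : Type*} [TopologicalSpace M] [ChartedSpace B M] [IsManifold I ∞ M]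
  {Z : Set M} {x : M} {f f' g u : M → ℝ}

omit [I.Boundaryless] [IsManifold I ∞ M] in
theorem IsDefFun.smoothNear (hf : IsDefFun I Z f x) : SmoothNear I f x := hf.smooth

namespace IsDefFun

/-- Only regularity needs an argument. At a point of `Z` the coordinate derivative is nonzero and
stays so by continuity; at a point off `Z`, `f` is nonzero nearby, so no nearby point lies on `Z`.
-/
theorem eventually_isDefFun (hf : IsDefFun I Z f x) : ∀ᶠ y in 𝓝 x, IsDefFun I Z f y := by
  have hreg : ∀ᶠ y in 𝓝 x, y ∈ Z → mfderiv I 𝓘(ℝ) f y ≠ 0 := by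
    have hxs := mem_extChartAt_source (I := I) x
    by_cases hx : x ∈ Z
    · have h1 := (fderiv_ne_zero_iff hxs hf.smoothNear.contMDiffAt).2 (hf.regular hx)
      have h2 : ContinuousAt (fun y => fderiv ℝ (f ∘ (extChartAt I x).symm) (extChartAt I x y)) x :=
        (contMDiffAt_comp_extChartAt (V := E →L[ℝ] ℝ) hxs ((contDiffAt_comp_extChartAt_symm hxs
          hf.smoothNear.contMDiffAt).fderiv_right (m := ∞) (by simp))).continuousAt
      filter_upwards [h2.eventually_ne h1, hf.smooth, extChartAt_source_mem_nhds (I := I) x]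
        with y hy hs hys _
      exact (fderiv_ne_zero_iff hys hs).1 hy
    · filter_upwards [hf.smoothNear.contMDiffAt.continuousAt.eventually_ne (hf.ne_zero hx),
        hf.zero_iff] with y hy hz hyZ
      exact absurd (hz.2 hyZ) hy
  filter_upwards [hf.smooth.eventually_nhds, hf.zero_iff.eventually_nhds, hreg] with y h1 h2 h3
  exact ⟨h1, h2, h3⟩

omit [I.Boundaryless] [IsManifold I ∞ M] in
-- If `f` vanished near `x`, then `x` would lie on `Z` and `df` would be zero there, against
-- regularity.
theorem frequently_ne_zero (hf : IsDefFun I Z f x) : ∃ᶠ y in 𝓝 x, f y ≠ 0 := by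
  intro h
  simp only [ne_eq, not_not] at h
  have hx : x ∈ Z := hf.zero_iff.self_of_nhds.1 h.self_of_nhds
  apply hf.regular hx
  have : f =ᶠ[𝓝 x] fun _ => 0 := h
  rw [this.mfderiv_eq, mfderiv_const]
  rfl

/-- Makes limits along the complement of `Z` unique, so that identities obtained off `Z` by dividing
by `f` extend to `Z` by continuity. -/
theorem neBot_nhdsWithin_compl (hf : IsDefFun I Z f x) : (𝓝[Zᶜ] x).NeBot := by
  rw [← mem_closure_iff_nhdsWithin_neBot, mem_closure_iff_frequently]
  exact (hf.frequently_ne_zero.and_eventually hf.zero_iff).mono fun y hy hyZ => hy.1 (hy.2.2 hyZ)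

/-- At each point near `x`, `f` can be cancelled off `Z`, and both remaining sides are continuous.
-/
theorem eq_of_mul_eq (hf : IsDefFun I Z f x) (hu : SmoothNear I u x) (hg : SmoothNear I g x)
    (h : ∀ᶠ y in 𝓝 x, f y * u y = f y * g y) : u =ᶠ[𝓝 x] g := by
  filter_upwards [hf.eventually_isDefFun, hu, hg, h.eventually_nhds] with y h1 h2 h3 h4
  have := h1.neBot_nhdsWithin_compl
  refine tendsto_nhds_unique ((h2.continuousAt.tendsto).mono_left nhdsWithin_le_nhds)
    (((h3.continuousAt.tendsto).mono_left (nhdsWithin_le_nhds (s := Zᶜ))).congr' ?_)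
  rw [EventuallyEq, eventually_nhdsWithin_iff]
  filter_upwards [h4, h1.eventually_isDefFun] with z hz hz2 hzZ
  exact (mul_left_cancel₀ (hz2.ne_zero hzZ) hz).symm

/-- Division by a local defining function. -/
theorem exists_eq_mul [FiniteDimensional ℝ E] (hf : IsDefFun I Z f x) (hg : SmoothNear I g x)
    (hgZ : ∀ᶠ y in 𝓝 x, y ∈ Z → g y = 0) :
    ∃ u : M → ℝ, SmoothNear I u x ∧ ∀ᶠ y in 𝓝 x, g y = u y * f y := by
  by_cases hx : x ∈ Z
  swap
  · refine ⟨fun y => g y / f y, hg.div hf.smooth (hf.ne_zero hx), ?_⟩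
    filter_upwards [hf.smoothNear.contMDiffAt.continuousAt.eventually_ne (hf.ne_zero hx)] with y hy
    rw [div_mul_cancel₀ _ hy]
  set φ := extChartAt I x
  have hxs : x ∈ φ.source := mem_extChartAt_source (I := I) x
  have src := extChartAt_source_mem_nhds (I := I) x
  -- At a point of `Z` this is division by a regular function in the model space, read in a chart.
  obtain ⟨u, hu, h⟩ := exists_eq_mul_of_regular (f := f ∘ φ.symm) (g := g ∘ φ.symm) (x := φ x)
    (by
      rw [eventually_nhds_extChartAt hxs]
      filter_upwards [hf.smooth, src] with y hy hys using contDiffAt_comp_extChartAt_symm hys hy)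
    (by simpa [φ] using hf.eq_zero hx)
    ((fderiv_ne_zero_iff hxs hf.smoothNear.contMDiffAt).2 (hf.regular hx))
    (by
      rw [eventually_nhds_extChartAt hxs]
      filter_upwards [hg, src] with y hy hys using contDiffAt_comp_extChartAt_symm hys hy)
    (by
      rw [eventually_nhds_extChartAt hxs]
      filter_upwards [hf.zero_iff, hgZ, src] with y h1 h2 hys
      simp only [Function.comp]
      rw [φ.left_inv hys]
      exact fun h => h2 (h1.1 h))
  refine ⟨u ∘ φ, ?_, ?_⟩
  · filter_upwards [(eventually_nhds_extChartAt hxs).1 hu, src] with y hy hys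
    exact contMDiffAt_comp_extChartAt hys hy
  · filter_upwards [(eventually_nhds_extChartAt hxs).1 h, src] with y hy hys
    simp only [Function.comp] at hy ⊢
    rwa [φ.left_inv hys] at hy

theorem exists_ratio_of_isDefFun [FiniteDimensional ℝ E] (hf : IsDefFun I Z f x)
    (hf' : IsDefFun I Z f' x) :
    ∃ u : M → ℝ, SmoothNear I u x ∧ ∀ᶠ y in 𝓝 x, f' y = u y * f y := by
  refine hf.exists_eq_mul hf'.smooth ?_
  filter_upwards [hf'.zero_iff] with y hy hyZ using hy.2 hyZ

omit [I.Boundaryless] [IsManifold I ∞ M] in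
-- At a point of `Z`, `df' = u df + f du = u df`, so `u x = 0` would contradict the regularity of
-- `f'`; off `Z` already `f' = u f` is nonzero.
theorem ratio_apply_ne_zero (hf : IsDefFun I Z f x) (hf' : IsDefFun I Z f' x)
    (hu : SmoothNear I u x) (h : ∀ᶠ y in 𝓝 x, f' y = u y * f y) : u x ≠ 0 := by
  intro h0
  by_cases hx : x ∈ Z
  · apply hf'.regular hx
    ext v
    have e := dir_congr_nhds (I := I) h v
    rw [dir_mul_fun hu.mdiff hf.smoothNear.mdiff, h0, hf.eq_zero hx] at e
    exact (by simpa using e : dir I f' x v = 0)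
  · exact hf'.ne_zero hx (by simp [h.self_of_nhds, h0])

omit [I.Boundaryless] [IsManifold I ∞ M] in
/-- A nonvanishing multiple of a local defining function is a local defining function. -/
theorem mul_of_ne_zero (hf : IsDefFun I Z f x) (hu : SmoothNear I u x) (hu0 : u x ≠ 0)
    (h : ∀ᶠ y in 𝓝 x, g y = u y * f y) : IsDefFun I Z g x := by
  refine ⟨(hu.mul hf.smooth).congr h, ?_, fun hx h0 => ?_⟩
  · filter_upwards [h, hf.zero_iff, hu.contMDiffAt.continuousAt.eventually_ne hu0] with y a b c
    rw [a, ← b, mul_eq_zero, or_iff_right c]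
  · apply hf.regular hx
    ext v
    have e := dir_congr_nhds (I := I) h v
    have e0 : dir I g x v = 0 := by unfold dir; rw [h0]; rfl
    rw [dir_mul_fun hu.mdiff hf.smoothNear.mdiff, hf.eq_zero hx, e0, zero_mul, add_zero] at e
    exact (mul_eq_zero.1 e.symm).resolve_left hu0

end IsDefFun

variable [FiniteDimensional ℝ E]

/-- The transformation rule forces the value on any other defining function `f' = u f`; on all other
functions both vectors have the default value `0`. -/
theorem BTangent.ext_dlog {b b' : BTangent I Z x} (hf : IsDefFun I Z f x)
    (h1 : anchor I Z b = anchor I Z b') (h2 : dlog I Z f b = dlog I Z f b') : b = b' := by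
  apply Subtype.ext
  refine Prod.ext h1 (funext fun f' => ?_)
  by_cases hf' : IsDefFun I Z f' x
  · obtain ⟨u, hu, hu'⟩ := hf.exists_ratio_of_isDefFun hf'
    have e1 := dlog_mul b hf hf' hu hu'
    have e2 := dlog_mul b' hf hf' hu hu'
    rw [h1, h2, ← e2] at e1
    exact e1
  · exact (b.2.1 f' hf').trans (b'.2.1 f' hf').symm

open Classical in
/-- A `b`-tangent vector is determined by its anchor and one logarithmic derivative. -/
theorem BTangent.exists_anchor_dlog (hf : IsDefFun I Z f x) (v : TangentSpace I x) (c : ℝ)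
    (h : dir I f x v = f x * c) :
    ∃ b : BTangent I Z x, anchor I Z b = v ∧ dlog I Z f b = c := by
  choose r hr hr' using fun f' (hf' : IsDefFun I Z f' x) => hf.exists_ratio_of_isDefFun hf'
  have key : ∀ f' hf' u, SmoothNear I u x →
      (∀ᶠ y in 𝓝 x, f' y = u y * f y) → r f' hf' =ᶠ[𝓝 x] u := by
    intro f' hf' u hu hu'
    refine hf.eq_of_mul_eq (hr f' hf') hu ?_
    filter_upwards [hr' f' hf', hu'] with y a b
    rw [mul_comm, ← a, b, mul_comm]
  -- The value on `f' = r f` that the transformation rule forces from the value `c` on `f`.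
  let D : (M → ℝ) → ℝ := fun f' =>
    if hf' : IsDefFun I Z f' x then c + dir I (r f' hf') x v / r f' hf' x else 0
  have hD : ∀ f' (hf' : IsDefFun I Z f' x),
    D f' = c + dir I (r f' hf') x v / r f' hf' x := fun f' hf' => dif_pos hf'
  refine ⟨⟨(v, D), fun f' hf' => dif_neg hf', fun f' hf' => ?_, fun f₁ f₂ u h1 h2 hu hu' => ?_⟩,
    rfl, ?_⟩
  · have e : ∀ᶠ y in 𝓝 x, f' y = r f' hf' y * f y := hr' f' hf'
    have := hf.ratio_apply_ne_zero hf' (hr f' hf') (hr' f' hf')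
    simp only [hD f' hf']
    rw [dir_congr_nhds e, dir_mul_fun (hr f' hf').mdiff hf.smoothNear.mdiff, h, e.self_of_nhds]
    field_simp
  · have n1 := hf.ratio_apply_ne_zero h1 (hr f₁ h1) (hr' f₁ h1)
    have nu := h1.ratio_apply_ne_zero h2 hu hu'
    -- Ratios are unique, so `f₂ / f = u · (f₁ / f)`; the logarithmic derivative of this product is
    -- the transformation rule for `D`.
    have e : ∀ᶠ y in 𝓝 x, r f₂ h2 y = u y * r f₁ h1 y := by
      refine key f₂ h2 _ (SmoothNear.mul hu (hr f₁ h1)) ?_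
      filter_upwards [hu', hr' f₁ h1] with y a b
      rw [a, b, mul_assoc]
    simp only [hD f₁ h1, hD f₂ h2]
    rw [dir_congr_nhds e, dir_mul_fun (SmoothNear.mdiff hu) (hr f₁ h1).mdiff, e.self_of_nhds]
    field_simp
    ring
  · have e : ∀ᶠ y in 𝓝 x, r f hf y = 1 := key f hf _ (SmoothNear.const 1) (by simp)
    change D f = c
    rw [hD f hf, dir_congr_nhds e, dir_const_fun, zero_div, add_zero]

section Lift

variable {V W : ∀ x : M, TangentSpace I x}

theorem IsBVectorFieldAt.smooth (hV : IsBVectorFieldAt I Z V x) :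
    ContMDiffAt I I.tangent ∞ (fun z => (⟨z, V z⟩ : TangentBundle I M)) x := hV.1.self_of_nhds

theorem IsBVectorFieldAt.eventually_isBVectorFieldAt (hV : IsBVectorFieldAt I Z V x) :
    ∀ᶠ y in 𝓝 x, IsBVectorFieldAt I Z V y := by
  filter_upwards [hV.1.eventually_nhds, hV.2.eventually_nhds] with y a b using ⟨a, b⟩

theorem IsBVectorFieldAt.smoothNear_dir (hV : IsBVectorFieldAt I Z V x) (hf : SmoothNear I f x) :
    SmoothNear I (fun y => dir I f y (V y)) x := by
  filter_upwards [hf.eventually, hV.1] with y h1 h2 using contMDiffAt_dir_of_smoothNear h1 h2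

theorem IsBLift.eq_of_isDefFun {b b' : BTangent I Z x} (hf : IsDefFun I Z f x)
    (h : IsBLift I Z V x b) (h' : IsBLift I Z V x b') : b = b' := by
  have := hf.neBot_nhdsWithin_compl
  exact BTangent.ext_dlog hf (h.1.trans h'.1.symm) (tendsto_nhds_unique (h.2 f hf) (h'.2 f hf))

/-- `V f` vanishes on `Z` because `V` is tangent to `Z`, hence is divisible by `f`; `k` is the
smooth extension of `V f / f` across `Z`. -/
theorem IsBVectorFieldAt.exists_quotient (hV : IsBVectorFieldAt I Z V x) (hf : IsDefFun I Z f x) :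
    ∃ k : M → ℝ, SmoothNear I k x ∧ ∀ᶠ y in 𝓝 x, dir I f y (V y) = k y * f y := by
  refine hf.exists_eq_mul (hV.smoothNear_dir hf.smooth) ?_
  filter_upwards [hV.2, hf.eventually_isDefFun] with y h1 h2 h3 using h1 h3 f h2

/-- Write `V f = k f` and take the vector with anchor `V x` and `dlog f = k x`. For `f' = u f` one
has `V f' / f' = k + V u / u` off `Z`, and the right-hand side is continuous at `x`. -/
theorem IsBVectorFieldAt.exists_isBLift_of_isDefFun (hV : IsBVectorFieldAt I Z V x)
    (hf : IsDefFun I Z f x) : ∃ b, IsBLift I Z V x b := by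
  obtain ⟨k, hk, hk'⟩ := hV.exists_quotient hf
  obtain ⟨b, hb, hb'⟩ := BTangent.exists_anchor_dlog hf (V x) (k x)
    (by rw [hk'.self_of_nhds]; ring)
  refine ⟨b, hb, fun f' hf' => ?_⟩
  obtain ⟨u, hu, hu'⟩ := hf.exists_ratio_of_isDefFun hf'
  have u0 := hf.ratio_apply_ne_zero hf' hu hu'
  rw [dlog_mul b hf hf' hu hu', hb, hb']
  have hc : ContinuousAt (fun y => k y + dir I u y (V y) / u y) x :=
    (hk.add ((hV.smoothNear_dir hu).div hu u0)).contMDiffAt.continuousAt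
  refine (hc.tendsto.mono_left nhdsWithin_le_nhds).congr' ?_
  rw [EventuallyEq, eventually_nhdsWithin_iff]
  filter_upwards [hf.zero_iff, hu.eventually, hu'.eventually_nhds, hf.smooth, hk',
    hu.contMDiffAt.continuousAt.eventually_ne u0] with y h1 h2 h3 h4 h5 h6 hy
  have hfy : f y ≠ 0 := fun h => hy (h1.1 h)
  rw [dir_congr_nhds h3, dir_mul_fun h2.mdiff (h4.mdifferentiableAt (by simp)), h5,
    h3.self_of_nhds]
  field_simp

variable [hZ : IsHypersurface I Z]

theorem IsBVectorFieldAt.isBLift (hV : IsBVectorFieldAt I Z V x) :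
    IsBLift I Z V x (bLift I Z V x) := by
  obtain ⟨f, hf⟩ := hZ.exists_defFun x
  have h := hV.exists_isBLift_of_isDefFun hf
  rw [bLift, dif_pos h]
  exact h.choose_spec

theorem IsBVectorFieldAt.anchor_bLift (hV : IsBVectorFieldAt I Z V x) :
    anchor I Z (bLift I Z V x) = V x := hV.isBLift.1

theorem IsBVectorFieldAt.dlog_bLift_mul (hV : IsBVectorFieldAt I Z V x)
    (hf : IsDefFun I Z f x) : dir I f x (V x) = f x * dlog I Z f (bLift I Z V x) := by
  rw [← dir_anchor _ hf, hV.anchor_bLift]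

/-- The logarithmic derivative of a local defining function along a `b`-vector field is smooth. -/
theorem IsBVectorFieldAt.smoothNear_dlog (hV : IsBVectorFieldAt I Z V x)
    (hf : IsDefFun I Z f x) : SmoothNear I (fun y => dlog I Z f (bLift I Z V y)) x := by
  obtain ⟨k, hk, hk'⟩ := hV.exists_quotient hf
  refine hk.congr ?_
  filter_upwards [hV.eventually_isBVectorFieldAt, hk'.eventually_nhds, hk.eventually,
    hf.eventually_isDefFun] with y h1 h2 h3 h4
  have := h4.neBot_nhdsWithin_compl
  refine tendsto_nhds_unique (h1.isBLift.2 f h4)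
    (((h3.contMDiffAt.continuousAt.tendsto).mono_left nhdsWithin_le_nhds).congr' ?_)
  rw [EventuallyEq, eventually_nhdsWithin_iff]
  filter_upwards [h2, h4.eventually_isDefFun] with z a b c
  rw [a, mul_div_cancel_right₀ _ (b.ne_zero c)]

/-- Tangency can be tested on one defining function: any other is `u f`, and `V (u f) = u k f + f V
u` vanishes on `Z`. -/
theorem IsBVectorFieldAt.of_dir_eq_mul {k : M → ℝ}
    (hV : ∀ᶠ y in 𝓝 x, ContMDiffAt I I.tangent ∞ (fun z => (⟨z, V z⟩ : TangentBundle I M)) y)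
    (hf : IsDefFun I Z f x) (h : ∀ᶠ y in 𝓝 x, dir I f y (V y) = k y * f y) :
    IsBVectorFieldAt I Z V x := by
  refine ⟨hV, ?_⟩
  filter_upwards [hf.eventually_isDefFun, h] with y h1 h2 hyZ f' hf'
  obtain ⟨u, hu, hu'⟩ := h1.exists_ratio_of_isDefFun hf'
  rw [dir_congr_nhds hu', dir_mul_fun hu.mdiff h1.smoothNear.mdiff, h2, h1.eq_zero hyZ]
  ring

/-- For computing lifts: off `Z` the quotient `V f / f` is `k`, so the limit that defines the lift
is `k x`. -/
theorem IsBVectorFieldAt.bLift_eq (hV : IsBVectorFieldAt I Z V x) (hf : IsDefFun I Z f x)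
    {k : M → ℝ} (hk : ContinuousAt k x) (h : ∀ᶠ y in 𝓝 x, dir I f y (V y) = k y * f y)
    {b : BTangent I Z x} (h1 : anchor I Z b = V x) (h2 : dlog I Z f b = k x) :
    bLift I Z V x = b := by
  have := hf.neBot_nhdsWithin_compl
  refine BTangent.ext_dlog hf (hV.anchor_bLift.trans h1.symm) ?_
  rw [h2]
  refine tendsto_nhds_unique (hV.isBLift.2 f hf)
    ((hk.tendsto.mono_left nhdsWithin_le_nhds).congr' ?_)
  rw [EventuallyEq, eventually_nhdsWithin_iff]
  filter_upwards [h, hf.eventually_isDefFun] with z a b c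
  rw [a, mul_div_cancel_right₀ _ (b.ne_zero c)]

omit [FiniteDimensional ℝ E] hZ in
theorem exists_vectorField (v : TangentSpace I x) : ∃ V : ∀ y : M, TangentSpace I y, V x = v ∧
    ∀ᶠ y in 𝓝 x, ContMDiffAt I I.tangent ∞ (fun z => (⟨z, V z⟩ : TangentBundle I M)) y := by
  have : IsManifold I 1 M := IsManifold.of_le (n := ∞) (by simp)
  let e := trivializationAt E (TangentSpace I) x
  have hx : x ∈ e.baseSet := mem_baseSet_trivializationAt E (TangentSpace I) x
  refine ⟨fun y => e.symm y (e ⟨x, v⟩).2, ?_, ?_⟩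
  · exact e.symm_apply_apply_mk hx v
  · filter_upwards [e.open_baseSet.mem_nhds hx] with y hy
    rw [e.contMDiffAt_section_iff (IB := I) (x₀ := y) hy]
    refine (contMDiffAt_const (c := (e ⟨x, v⟩).2)).congr_of_eventuallyEq ?_
    filter_upwards [e.open_baseSet.mem_nhds hy] with z hz
    exact e.apply_mk_symm hz _ ▸ rfl

variable (I Z) in
/-- Every `b`-tangent vector extends to a local `b`-vector field. -/
theorem exists_isBVectorFieldAt (b : BTangent I Z x) :
    ∃ V, IsBVectorFieldAt I Z V x ∧ bLift I Z V x = b := by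
  obtain ⟨f, hf⟩ := hZ.exists_defFun x
  obtain ⟨V, hVx, hV⟩ := exists_vectorField (anchor I Z b)
  have hVf : SmoothNear I (fun y => dir I f y (V y)) x := by
    filter_upwards [hf.smoothNear.eventually, hV] with y h1 h2
      using contMDiffAt_dir_of_smoothNear h1 h2
  by_cases hx : x ∈ Z
  · obtain ⟨v, hv⟩ := exists_dir_ne_zero (hf.regular hx)
    obtain ⟨T, hTx, hT⟩ := exists_vectorField v
    have hTf : SmoothNear I (fun y => dir I f y (T y)) x := by
      filter_upwards [hf.smoothNear.eventually, hT] with y h1 h2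
        using contMDiffAt_dir_of_smoothNear h1 h2
    have h0 : dir I f x (T x) ≠ 0 := by rwa [hTx]
    set c := dlog I Z f b
    -- `T` is transverse to `Z`, and `k` is chosen so that `(V + k T) f = c f` near `x`. Since `V f
    -- = f c` at `x`, `k x = 0`, and the correction does not change the anchor.
    let k : M → ℝ := fun y => (c * f y - dir I f y (V y)) / dir I f y (T y)
    have hk : SmoothNear I k x := (((SmoothNear.const c).mul hf.smooth).sub hVf).div hTf h0
    have hW : ∀ᶠ y in 𝓝 x, ContMDiffAt I I.tangent ∞
        (fun z => (⟨z, V z + k z • T z⟩ : TangentBundle I M)) y := by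
      filter_upwards [hV, hk, hT] with y h1 h2 h3 using h1.add_section (h2.smul_section h3)
    have hWf : ∀ᶠ y in 𝓝 x, dir I f y (V y + k y • T y) = c * f y := by
      filter_upwards [hTf.contMDiffAt.continuousAt.eventually_ne h0] with y hy
      rw [dir_add, dir_smul, div_mul_cancel₀ _ hy]
      ring
    have hB := IsBVectorFieldAt.of_dir_eq_mul hW hf hWf
    refine ⟨_, hB, hB.bLift_eq hf (k := fun _ => c) continuousAt_const hWf ?_ rfl⟩
    have : k x = 0 := by
      simp only [k, hVx, dir_anchor b hf, c]
      ring
    simp [this, hVx]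
  -- Off `Z` tangency is vacuous nearby, and `f x ≠ 0` lets the anchor determine `dlog f`.
  · have hB : IsBVectorFieldAt I Z V x := by
      refine ⟨hV, ?_⟩
      filter_upwards [hf.smoothNear.contMDiffAt.continuousAt.eventually_ne (hf.ne_zero hx),
        hf.zero_iff] with y a b c using absurd (b.2 c) a
    refine ⟨V, hB, BTangent.ext_dlog hf (hB.anchor_bLift.trans hVx) ?_⟩
    refine mul_left_cancel₀ (hf.ne_zero hx) ?_
    rw [← hB.dlog_bLift_mul hf, ← dir_anchor b hf, hVx]

/-- The lift consists of the value at `x` and of a limit at `x`, so it depends only on the germ of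
the field. -/
theorem bLift_congr (hV : IsBVectorFieldAt I Z V x) (h : ∀ᶠ y in 𝓝 x, W y = V y) :
    bLift I Z W x = bLift I Z V x := by
  obtain ⟨f, hf⟩ := hZ.exists_defFun x
  have hW : IsBVectorFieldAt I Z W x := by
    refine ⟨?_, ?_⟩
    · filter_upwards [hV.1, h.eventually_nhds] with y h1 h2
      refine h1.congr_of_eventuallyEq ?_
      filter_upwards [h2] with z hz
      rw [hz]
    · filter_upwards [hV.2, h] with y h1 h2
      rwa [h2]
  obtain ⟨k, hk, hk'⟩ := hV.exists_quotient hf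
  refine (hV.bLift_eq hf hk.contMDiffAt.continuousAt hk'
    (hW.anchor_bLift.trans h.self_of_nhds) ?_).symm
  have := hf.neBot_nhdsWithin_compl
  refine tendsto_nhds_unique (hW.isBLift.2 f hf)
    ((hk.contMDiffAt.continuousAt.tendsto.mono_left nhdsWithin_le_nhds).congr' ?_)
  rw [EventuallyEq, eventually_nhdsWithin_iff]
  filter_upwards [h, hk', hf.eventually_isDefFun] with z h1 a b c
  rw [h1, a, mul_div_cancel_right₀ _ (b.ne_zero c)]

omit hZ in
/-- The bracket of `b`-vector fields is a `b`-vector field. -/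
theorem IsBVectorFieldAt.mlieBracket (hV : IsBVectorFieldAt I Z V x)
    (hW : IsBVectorFieldAt I Z W x) :
    IsBVectorFieldAt I Z (VectorField.mlieBracket I V W) x := by
  have hc : CompleteSpace E := FiniteDimensional.complete ℝ E
  refine ⟨?_, ?_⟩
  · filter_upwards [hV.1, hW.1] with y h1 h2
    have : IsManifold I ((⊤ : ℕ∞) + 1) M := by simpa using ‹IsManifold I ∞ M›
    have : IsManifold I (minSmoothness ℝ 2) M := by
      rw [minSmoothness_of_isRCLikeNormedField]
      exact IsManifold.of_le (n := ∞) ENat.LEInfty.out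
    exact ContMDiffAt.mlieBracket_vectorField (m := ⊤) (n := ⊤) h1 h2 (by
      rw [minSmoothness_of_isRCLikeNormedField]; simp)
  · filter_upwards [hV.eventually_isBVectorFieldAt, hW.eventually_isBVectorFieldAt]
      with y h1 h2 hyZ f hf
    -- With `V f = k f` and `W f = l f`, `[V, W] f = V (l f) - W (k f)`; every term contains `f`, `V
    -- f` or `W f`, all zero at a point of `Z`.
    obtain ⟨k, hk, hk'⟩ := h1.exists_quotient hf
    obtain ⟨l, hl, hl'⟩ := h2.exists_quotient hf
    rw [dir_mlieBracket hf.smooth h1.smooth h2.smooth, dir_congr_nhds hl', dir_congr_nhds hk',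
      dir_mul_fun hl.mdiff hf.smoothNear.mdiff, dir_mul_fun hk.mdiff hf.smoothNear.mdiff,
      hf.eq_zero hyZ, h1.2.self_of_nhds hyZ f hf, h2.2.self_of_nhds hyZ f hf]
    ring

/-- The logarithmic differential of a local defining function is closed. -/
theorem IsBVectorFieldAt.dlog_mlieBracket (hV : IsBVectorFieldAt I Z V x)
    (hW : IsBVectorFieldAt I Z W x) (hf : IsDefFun I Z f x) :
    dlog I Z f (bLift I Z (VectorField.mlieBracket I V W) x) =
      dir I (fun y => dlog I Z f (bLift I Z W y)) x (V x) -
        dir I (fun y => dlog I Z f (bLift I Z V y)) x (W x) := by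
  have hc : CompleteSpace E := FiniteDimensional.complete ℝ E
  have hVW := hV.mlieBracket hW
  have s1 := hVW.smoothNear_dlog hf
  have dV := hV.smoothNear_dlog hf
  have dW := hW.smoothNear_dlog hf
  -- The identity is proved after multiplication by `f`. If `V f = f a` and `W f = f b`, then `[V,
  -- W] f = V (f b) - W (f a) = f (V b - W a)`, because the two terms `f a b` cancel.
  refine (hf.eq_of_mul_eq s1 ((hV.smoothNear_dir dW).sub (hW.smoothNear_dir dV)) ?_).self_of_nhds
  filter_upwards [hV.eventually_isBVectorFieldAt.eventually_nhds,
    hW.eventually_isBVectorFieldAt.eventually_nhds, hVW.eventually_isBVectorFieldAt,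
    hf.eventually_isDefFun.eventually_nhds, dV.eventually, dW.eventually] with y h1 h2 h3 h4 h5 h6
  have hfy := h4.self_of_nhds
  have e1 : ∀ᶠ z in 𝓝 y, dir I f z (V z) = f z * dlog I Z f (bLift I Z V z) := by
    filter_upwards [h1, h4] with z a b using a.dlog_bLift_mul b
  have e2 : ∀ᶠ z in 𝓝 y, dir I f z (W z) = f z * dlog I Z f (bLift I Z W z) := by
    filter_upwards [h2, h4] with z a b using a.dlog_bLift_mul b
  rw [← h3.dlog_bLift_mul hfy, dir_mlieBracket hfy.smooth h1.self_of_nhds.smooth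
    h2.self_of_nhds.smooth, dir_congr_nhds e1, dir_congr_nhds e2,
    dir_mul_fun hfy.smoothNear.mdiff h5.mdiff, dir_mul_fun hfy.smoothNear.mdiff h6.mdiff,
    e1.self_of_nhds, e2.self_of_nhds]
  ring

end Lift

end BoundarylessDefFun


/-! ### Wedge products of linear forms. -/

section Wedge

variable {V W : Type*} [AddCommGroup V] [Module ℝ V] [AddCommGroup W] [Module ℝ W]

/-- The wedge product of two linear forms. -/
def wedge (l m : V →ₗ[ℝ] ℝ) : V [⋀^Fin 2]→ₗ[ℝ] ℝ :=
  (Matrix.detRowAlternating (R := ℝ) (n := Fin 2)).compLinearMap (LinearMap.pi ![l, m])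

theorem wedge_apply (l m : V →ₗ[ℝ] ℝ) (v : Fin 2 → V) :
    wedge l m v = l (v 0) * m (v 1) - l (v 1) * m (v 0) := by
  refine (Matrix.det_fin_two (Matrix.of fun i => LinearMap.pi ![l, m] (v i))).trans ?_
  simp [mul_comm]

theorem wedge_comp (l m : V →ₗ[ℝ] ℝ) (f : W →ₗ[ℝ] V) :
    (wedge l m).compLinearMap f = wedge (l ∘ₗ f) (m ∘ₗ f) := by
  ext v
  simp [wedge_apply, AlternatingMap.compLinearMap_apply]

/-- A linear form, as an alternating form of degree `1`. -/
def oneForm : (V →ₗ[ℝ] ℝ) ≃ (V [⋀^Fin 1]→ₗ[ℝ] ℝ) := AlternatingMap.ofSubsingleton ℝ V ℝ 0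

@[simp] theorem oneForm_apply (l : V →ₗ[ℝ] ℝ) (v : Fin 1 → V) : oneForm l v = l (v 0) := rfl

theorem oneForm_ext {α β : V [⋀^Fin 1]→ₗ[ℝ] ℝ} (h : ∀ b, α ![b] = β ![b]) : α = β := by
  ext v
  have : v = ![v 0] := by ext i; fin_cases i; rfl
  rw [this, h]

end Wedge

/-! ### The exterior derivative of `b`-forms of degree one. -/

section Calculus

variable {E : Type*} [NormedAddCommGroup E] [NormedSpace ℝ E]
  {B : Type*} [TopologicalSpace B] {I : ModelWithCorners ℝ E B}
  {M : Type*} [TopologicalSpace M] [ChartedSpace B M] [IsManifold I ∞ M]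
  {Z : Set M} {x : M}

theorem koszul_one (α : BForm I Z 1) (V : Fin 2 → ∀ y : M, TangentSpace I y) :
    α.koszul V x = dir I (fun y => α y ![bLift I Z (V 1) y]) x (V 0 x) -
      dir I (fun y => α y ![bLift I Z (V 0) y]) x (V 1 x) -
      α x ![bLift I Z (VectorField.mlieBracket I (V 0) (V 1)) x] := by
  have e0 : ∀ y, ((0 : Fin 2).removeNth fun k => bLift I Z (V k) y) = ![bLift I Z (V 1) y] := by
    intro y; ext i; fin_cases i; rfl
  have e1 : ∀ y, ((1 : Fin 2).removeNth fun k => bLift I Z (V k) y) = ![bLift I Z (V 0) y] := by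
    intro y; ext i; fin_cases i; rfl
  have f0 : Finset.univ.filter ((0 : Fin 1) ≤ ·) = {0} := by decide
  have g : (∑ i : Fin 1, ∑ j ∈ Finset.univ.filter (i ≤ ·), (-1) ^ (i + j : ℕ) *
    α x (Matrix.vecCons (bLift I Z (VectorField.mlieBracket I (V i.castSucc) (V j.succ)) x)
      (j.removeNth (i.castSucc.removeNth fun k => bLift I Z (V k) x)))) =
      α x ![bLift I Z (VectorField.mlieBracket I (V 0) (V 1)) x] := by
    rw [Fin.sum_univ_one, f0, Finset.sum_singleton]
    change (-1 : ℝ) ^ 0 * _ = _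
    rw [pow_zero, one_mul]
    refine congrArg (α x) ?_
    ext i
    fin_cases i
    rfl
  unfold BForm.koszul
  rw [g, Fin.sum_univ_two]
  simp only [e0, e1]
  change (-1 : ℝ) ^ 0 * _ + (-1) ^ 1 * _ - _ = _
  ring

/-- Because the second index is shifted by one, the pairs `(0, 0)`, `(0, 1)`, `(1, 1)` of the double
sum stand for the brackets of `V 0, V 1`, of `V 0, V 2` and of `V 1, V 2`. -/
theorem koszul_two (α : BForm I Z 2) (V : Fin 3 → ∀ y : M, TangentSpace I y) :
    α.koszul V x = dir I (fun y => α y ![bLift I Z (V 1) y, bLift I Z (V 2) y]) x (V 0 x) -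
      dir I (fun y => α y ![bLift I Z (V 0) y, bLift I Z (V 2) y]) x (V 1 x) +
      dir I (fun y => α y ![bLift I Z (V 0) y, bLift I Z (V 1) y]) x (V 2 x) -
      α x ![bLift I Z (VectorField.mlieBracket I (V 0) (V 1)) x, bLift I Z (V 2) x] +
      α x ![bLift I Z (VectorField.mlieBracket I (V 0) (V 2)) x, bLift I Z (V 1) x] -
      α x ![bLift I Z (VectorField.mlieBracket I (V 1) (V 2)) x, bLift I Z (V 0) x] := by
  have e0 : ∀ y, ((0 : Fin 3).removeNth fun k => bLift I Z (V k) y) =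
      ![bLift I Z (V 1) y, bLift I Z (V 2) y] := by
    intro y; ext i; fin_cases i <;> rfl
  have e1 : ∀ y, ((1 : Fin 3).removeNth fun k => bLift I Z (V k) y) =
      ![bLift I Z (V 0) y, bLift I Z (V 2) y] := by
    intro y; ext i; fin_cases i <;> rfl
  have e2 : ∀ y, ((2 : Fin 3).removeNth fun k => bLift I Z (V k) y) =
      ![bLift I Z (V 0) y, bLift I Z (V 1) y] := by
    intro y; ext i; fin_cases i <;> rfl
  have f0 : Finset.univ.filter ((0 : Fin 2) ≤ ·) = {0, 1} := by decide
  have f1 : Finset.univ.filter ((1 : Fin 2) ≤ ·) = {1} := by decide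
  have q0 : ∀ f : Fin 3 → BTangent I Z x,
      (0 : Fin 2).removeNth ((0 : Fin 2).castSucc.removeNth f) = ![f 2] := by
    intro f; ext i; fin_cases i; rfl
  have q1 : ∀ f : Fin 3 → BTangent I Z x,
      (1 : Fin 2).removeNth ((0 : Fin 2).castSucc.removeNth f) = ![f 1] := by
    intro f; ext i; fin_cases i; rfl
  have q2 : ∀ f : Fin 3 → BTangent I Z x,
      (1 : Fin 2).removeNth ((1 : Fin 2).castSucc.removeNth f) = ![f 0] := by
    intro f; ext i; fin_cases i; rfl
  have g : (∑ i : Fin 2, ∑ j ∈ Finset.univ.filter (i ≤ ·), (-1) ^ (i + j : ℕ) *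
    α x (Matrix.vecCons (bLift I Z (VectorField.mlieBracket I (V i.castSucc) (V j.succ)) x)
      (j.removeNth (i.castSucc.removeNth fun k => bLift I Z (V k) x)))) =
      α x ![bLift I Z (VectorField.mlieBracket I (V 0) (V 1)) x, bLift I Z (V 2) x] -
      α x ![bLift I Z (VectorField.mlieBracket I (V 0) (V 2)) x, bLift I Z (V 1) x] +
      α x ![bLift I Z (VectorField.mlieBracket I (V 1) (V 2)) x, bLift I Z (V 0) x] := by
    rw [Fin.sum_univ_two, f0, f1, Finset.sum_pair (by decide), Finset.sum_singleton]
    simp only [q0, q1, q2]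
    change (-1 : ℝ) ^ 0 * α x ![bLift I Z (VectorField.mlieBracket I (V 0) (V 1)) x, bLift I Z (V 2) x] +
      (-1) ^ 1 * α x ![bLift I Z (VectorField.mlieBracket I (V 0) (V 2)) x, bLift I Z (V 1) x] +
      (-1) ^ 2 * α x ![bLift I Z (VectorField.mlieBracket I (V 1) (V 2)) x, bLift I Z (V 0) x] = _
    ring
  unfold BForm.koszul
  rw [g, Fin.sum_univ_three]
  simp only [e0, e1, e2]
  change (-1 : ℝ) ^ 0 * _ + (-1) ^ 1 * _ + (-1) ^ 2 * _ - _ = _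
  ring

variable (Z) in
/-- The differential of a function, as a `b`-covector. -/
def bDiff (f : M → ℝ) (y : M) : BTangent I Z y →ₗ[ℝ] ℝ :=
  (mfderiv I 𝓘(ℝ) f y).toLinearMap ∘ₗ (anchor I Z).toLinearMap

omit [IsManifold I ∞ M] in
theorem bDiff_apply (f : M → ℝ) (y : M) (b : BTangent I Z y) :
    bDiff Z f y b = dir I f y (anchor I Z b) := rfl

/-- `HasDAt x α η`: near `x` the `b`-form `α` is a sum of forms `a dg` and `a df / f`, with `a` and
`g` smooth and `f` a local defining function of `Z`, and `η` is the corresponding sum of the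
products `da ∧ dg` and `da ∧ df / f` at `x`. -/
inductive HasDAt (x : M) : BForm I Z 1 → (BTangent I Z x [⋀^Fin 2]→ₗ[ℝ] ℝ) → Prop
  | exact (a g : M → ℝ) (ha : SmoothNear I a x) (hg : SmoothNear I g x) :
      HasDAt x (fun y => oneForm (a y • bDiff Z g y)) (wedge (bDiff Z a x) (bDiff Z g x))
  | log (a f : M → ℝ) (ha : SmoothNear I a x) (hf : IsDefFun I Z f x) :
      HasDAt x (fun y => oneForm (a y • (dlog I Z f (x := y)).toLinearMap))
        (wedge (bDiff Z a x) (dlog I Z f).toLinearMap)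
  | add (α β : BForm I Z 1) (η ξ) (hα : HasDAt x α η) (hβ : HasDAt x β ξ) :
      HasDAt x (α + β) (η + ξ)
  | congr (α β : BForm I Z 1) (η) (hα : HasDAt x α η) (h : ∀ᶠ y in 𝓝 x, β y = α y) :
      HasDAt x β η

variable [I.Boundaryless] [FiniteDimensional ℝ E]

section Lift

variable [hZ : IsHypersurface I Z] {V W : ∀ x : M, TangentSpace I x}

theorem IsBVectorFieldAt.bDiff_bLift (hV : IsBVectorFieldAt I Z V x) (f : M → ℝ) :
    bDiff Z f x (bLift I Z V x) = dir I f x (V x) := by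
  rw [bDiff_apply, hV.anchor_bLift]

theorem HasDAt.smoothNear {α : BForm I Z 1} {η} (h : HasDAt x α η)
    (hV : IsBVectorFieldAt I Z V x) : SmoothNear I (fun y => α y ![bLift I Z V y]) x := by
  induction h with
  | exact a g ha hg =>
    refine (ha.mul (hV.smoothNear_dir hg)).congr ?_
    filter_upwards [hV.eventually_isBVectorFieldAt] with y h
    change a y * bDiff Z g y (bLift I Z V y) = _
    rw [h.bDiff_bLift]
  | log a f ha hf =>
    exact (ha.mul (hV.smoothNear_dlog hf)).congr (Eventually.of_forall fun y => rfl)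
  | add α β η ξ hα hβ h1 h2 => exact h1.add h2
  | congr α β η hα h h1 =>
    refine h1.congr ?_
    filter_upwards [h] with y h
    rw [h]

/-- The Leibniz rule `d(a β) = da ∧ β + a dβ`, where `hβ` says that `dβ` vanishes on `V 0, V 1`. -/
theorem koszul_smul {a : M → ℝ} {β : ∀ y : M, BTangent I Z y →ₗ[ℝ] ℝ}
    {V : Fin 2 → ∀ y : M, TangentSpace I y} (hV : ∀ i, IsBVectorFieldAt I Z (V i) x)
    (ha : SmoothNear I a x) (h0 : SmoothNear I (fun y => β y (bLift I Z (V 0) y)) x)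
    (h1 : SmoothNear I (fun y => β y (bLift I Z (V 1) y)) x)
    (hβ : β x (bLift I Z (VectorField.mlieBracket I (V 0) (V 1)) x) =
      dir I (fun y => β y (bLift I Z (V 1) y)) x (V 0 x) -
        dir I (fun y => β y (bLift I Z (V 0) y)) x (V 1 x)) :
    wedge (bDiff Z a x) (β x) (fun i => bLift I Z (V i) x) =
      BForm.koszul (fun y => oneForm (a y • β y)) V x := by
  rw [koszul_one, wedge_apply, (hV 0).bDiff_bLift, (hV 1).bDiff_bLift]
  change _ = dir I (fun y => a y * β y (bLift I Z (V 1) y)) x (V 0 x) -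
    dir I (fun y => a y * β y (bLift I Z (V 0) y)) x (V 1 x) -
    a x * β x (bLift I Z (VectorField.mlieBracket I (V 0) (V 1)) x)
  rw [hβ, dir_mul_fun ha.mdiff h0.mdiff, dir_mul_fun ha.mdiff h1.mdiff]
  ring

/-- Each generator is a function times a closed form: `dg` is closed because the bracket is the
commutator of derivations, and `df / f` by `IsBVectorFieldAt.dlog_mlieBracket`. Both sides are
additive and local. -/
theorem HasDAt.eq_koszul {α : BForm I Z 1} {η} (h : HasDAt x α η)
    {V : Fin 2 → ∀ y : M, TangentSpace I y} (hV : ∀ i, IsBVectorFieldAt I Z (V i) x) :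
    η (fun i => bLift I Z (V i) x) = α.koszul V x := by
  have hc : CompleteSpace E := FiniteDimensional.complete ℝ E
  induction h with
  | exact a g ha hg =>
    have e : ∀ i, ∀ᶠ y in 𝓝 x, bDiff Z g y (bLift I Z (V i) y) = dir I g y (V i y) := fun i => by
      filter_upwards [(hV i).eventually_isBVectorFieldAt] with y h using h.bDiff_bLift g
    refine koszul_smul hV ha (((hV 0).smoothNear_dir hg).congr (e 0))
      (((hV 1).smoothNear_dir hg).congr (e 1)) ?_
    rw [((hV 0).mlieBracket (hV 1)).bDiff_bLift, dir_congr_nhds (e 0), dir_congr_nhds (e 1),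
      dir_mlieBracket hg (hV 0).smooth (hV 1).smooth]
  | log a f ha hf =>
    exact koszul_smul (β := fun y => (dlog I Z f (x := y)).toLinearMap) hV ha
      ((hV 0).smoothNear_dlog hf) ((hV 1).smoothNear_dlog hf)
      ((hV 0).dlog_mlieBracket (hV 1) hf)
  | add α β η ξ hα hβ h1 h2 =>
    rw [AlternatingMap.add_apply, h1, h2]
    simp only [koszul_one, Pi.add_apply, AlternatingMap.add_apply]
    rw [dir_add_fun (hα.smoothNear (hV 0)).mdiff (hβ.smoothNear (hV 0)).mdiff,
      dir_add_fun (hα.smoothNear (hV 1)).mdiff (hβ.smoothNear (hV 1)).mdiff]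
    ring
  | congr α β η hα h h1 =>
    rw [h1]
    have e : ∀ i, ∀ᶠ y in 𝓝 x, α y ![bLift I Z (V i) y] = β y ![bLift I Z (V i) y] := fun i => by
      filter_upwards [h] with y h
      rw [h]
    simp only [koszul_one]
    rw [dir_congr_nhds (e 0), dir_congr_nhds (e 1), h.self_of_nhds]

/-- `η` shows that the choice in `BForm.d` is not the default value. Any two forms satisfying
Koszul's formula agree, because every tuple of `b`-tangent vectors is a tuple of lifts of `b`-vector
fields. -/
theorem HasDAt.d_eq {α : BForm I Z 1} {η} (h : HasDAt x α η) : α.d x = η := by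
  have h1 : ∃ η : BTangent I Z x [⋀^Fin 2]→ₗ[ℝ] ℝ,
      ∀ V : Fin 2 → ∀ y : M, TangentSpace I y, (∀ i, IsBVectorFieldAt I Z (V i) x) →
        η (fun i => bLift I Z (V i) x) = α.koszul V x := ⟨η, fun V hV => h.eq_koszul hV⟩
  have h2 : α.d x = h1.choose := dif_pos h1
  rw [h2]
  ext v
  choose V hV hVv using fun i => exists_isBVectorFieldAt I Z (v i)
  have e : v = fun i => bLift I Z (V i) x := funext fun i => (hVv i).symm
  rw [e, h1.choose_spec V hV, h.eq_koszul hV]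

theorem IsBVectorFieldAt.neg (hV : IsBVectorFieldAt I Z V x) : IsBVectorFieldAt I Z (-V) x := by
  refine ⟨?_, ?_⟩
  · filter_upwards [hV.1] with y h using h.neg_section
  · filter_upwards [hV.2] with y h hy f hf
    have := h hy f hf
    rw [Pi.neg_apply, dir_neg, this, neg_zero]

theorem IsBVectorFieldAt.add (hV : IsBVectorFieldAt I Z V x) (hW : IsBVectorFieldAt I Z W x) :
    IsBVectorFieldAt I Z (V + W) x := by
  refine ⟨?_, ?_⟩
  · filter_upwards [hV.1, hW.1] with y h h' using h.add_section h'
  · filter_upwards [hV.2, hW.2] with y h h' hy f hf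
    rw [Pi.add_apply, dir_add, h hy f hf, h' hy f hf, add_zero]

theorem IsBVectorFieldAt.bLift_neg (hV : IsBVectorFieldAt I Z V x) :
    bLift I Z (-V) x = - bLift I Z V x := by
  obtain ⟨f, hf⟩ := hZ.exists_defFun x
  refine hV.neg.isBLift.eq_of_isDefFun hf ⟨?_, fun f' hf' => ?_⟩
  · rw [map_neg, hV.anchor_bLift, Pi.neg_apply]
  · rw [map_neg]
    refine (hV.isBLift.2 f' hf').neg.congr fun y => ?_
    rw [Pi.neg_apply, dir_neg, neg_div]

theorem IsBVectorFieldAt.bLift_add (hV : IsBVectorFieldAt I Z V x)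
    (hW : IsBVectorFieldAt I Z W x) :
    bLift I Z (V + W) x = bLift I Z V x + bLift I Z W x := by
  obtain ⟨f, hf⟩ := hZ.exists_defFun x
  refine (hV.add hW).isBLift.eq_of_isDefFun hf ⟨?_, fun f' hf' => ?_⟩
  · rw [map_add, hV.anchor_bLift, hW.anchor_bLift, Pi.add_apply]
  · rw [map_add]
    refine ((hV.isBLift.2 f' hf').add (hW.isBLift.2 f' hf')).congr fun y => ?_
    rw [Pi.add_apply, dir_add, add_div]

/-- The Jacobi identity for lifts of `b`-vector fields. -/
theorem IsBVectorFieldAt.bLift_jacobi {U : ∀ x : M, TangentSpace I x}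
    (hU : IsBVectorFieldAt I Z U x) (hV : IsBVectorFieldAt I Z V x)
    (hW : IsBVectorFieldAt I Z W x) :
    bLift I Z (VectorField.mlieBracket I (VectorField.mlieBracket I V W) U) x =
      - bLift I Z (VectorField.mlieBracket I (VectorField.mlieBracket I U V) W) x +
        bLift I Z (VectorField.mlieBracket I (VectorField.mlieBracket I U W) V) x := by
  have hc : CompleteSpace E := FiniteDimensional.complete ℝ E
  have m2 : ∀ {V : ∀ x : M, TangentSpace I x} {y},
      ContMDiffAt I I.tangent ∞ (fun z => (⟨z, V z⟩ : TangentBundle I M)) y →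
      ContMDiffAt I I.tangent (minSmoothness ℝ 2)
        (fun z => (⟨z, V z⟩ : TangentBundle I M)) y := fun h => h.of_le (by
    rw [minSmoothness_of_isRCLikeNormedField]
    exact ENat.LEInfty.out)
  have : IsManifold I (minSmoothness ℝ 3) M := by
    rw [minSmoothness_of_isRCLikeNormedField]
    exact IsManifold.of_le (n := ∞) ENat.LEInfty.out
  have h1 := (hU.mlieBracket hV).mlieBracket hW
  have h2 := (hU.mlieBracket hW).mlieBracket hV
  have h3 := (hV.mlieBracket hW).mlieBracket hU
  rw [← h1.bLift_neg, ← h1.neg.bLift_add h2]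
  refine bLift_congr (h1.neg.add h2) ?_
  filter_upwards [hU.1, hV.1, hW.1] with y a b c
  -- The Jacobi identity in the form `[U, [V, W]] = [[U, V], W] + [V, [U, W]]`; antisymmetry gives
  -- the arrangement needed here.
  have e := VectorField.leibniz_identity_mlieBracket_apply (m2 a) (m2 b) (m2 c)
  rw [VectorField.mlieBracket_swap_apply, e,
    VectorField.mlieBracket_swap_apply (V := V) (W := VectorField.mlieBracket I U W)]
  simp only [Pi.add_apply, Pi.neg_apply]
  abel

end Lift

/-- A `b`-form of degree `1` that is locally a sum of forms `a dg` and `a df / f`. -/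
def BForm.HasD (α : BForm I Z 1) : Prop := ∀ x, ∃ η, HasDAt x α η

section HasD

variable [hZ : IsHypersurface I Z] {α β : BForm I Z 1}

theorem BForm.HasD.at (h : α.HasD) (x : M) : HasDAt x α (α.d x) := by
  obtain ⟨η, hη⟩ := h x
  rwa [hη.d_eq]

theorem BForm.HasD.d_add (hα : α.HasD) (hβ : β.HasD) : (α + β).d = α.d + β.d :=
  funext fun x => (HasDAt.add _ _ _ _ (hα.at x) (hβ.at x)).d_eq

omit [I.Boundaryless] [FiniteDimensional ℝ E] hZ in
-- The sign is absorbed into the coefficients `a` of the generators.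
theorem HasDAt.neg {η} (h : HasDAt x α η) : HasDAt x (-α) (-η) := by
  have hw : ∀ (a : M → ℝ) (_ : SmoothNear I a x) (m : BTangent I Z x →ₗ[ℝ] ℝ),
      wedge (bDiff Z (fun y => - a y) x) m = - wedge (bDiff Z a x) m := by
    intro a ha m
    ext v
    rw [AlternatingMap.neg_apply, wedge_apply, wedge_apply]
    simp only [bDiff_apply, dir_neg_fun ha.mdiff]
    ring
  induction h with
  | exact a g ha hg =>
    rw [← hw a ha]
    refine .congr _ _ _ (.exact (fun y => - a y) g ha.neg hg) (Eventually.of_forall fun y => ?_)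
    refine oneForm_ext fun b => ?_
    simp
  | log a f ha hf =>
    rw [← hw a ha]
    refine .congr _ _ _ (.log (fun y => - a y) f ha.neg hf) (Eventually.of_forall fun y => ?_)
    refine oneForm_ext fun b => ?_
    simp
  | add α β η ξ hα hβ h1 h2 =>
    rw [neg_add, neg_add]
    exact .add _ _ _ _ h1 h2
  | congr α β η hα h h1 =>
    refine .congr _ _ _ h1 ?_
    filter_upwards [h] with y h
    rw [Pi.neg_apply, h, Pi.neg_apply]

theorem BForm.HasD.neg (hα : α.HasD) : (-α).HasD := fun x => ⟨_, (hα.at x).neg⟩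

theorem BForm.HasD.d_neg (hα : α.HasD) : (-α).d = -α.d :=
  funext fun x => (hα.at x).neg.d_eq

theorem BForm.HasD.isSmooth (hα : α.HasD) : α.IsSmooth := fun x V hV => by
  refine ((hα.at x).smoothNear (hV 0)).contMDiffAt.congr_of_eventuallyEq
    (Eventually.of_forall fun y => congrArg (α y) ?_)
  ext i
  fin_cases i
  rfl

theorem BForm.HasD.d_apply (hα : α.HasD) {U V : ∀ x : M, TangentSpace I x}
    (hU : IsBVectorFieldAt I Z U x) (hV : IsBVectorFieldAt I Z V x) :
    α.d x ![bLift I Z U x, bLift I Z V x] = dir I (fun y => α y ![bLift I Z V y]) x (U x) -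
      dir I (fun y => α y ![bLift I Z U y]) x (V x) -
      α x ![bLift I Z (VectorField.mlieBracket I U V) x] := by
  have h := (hα.at x).eq_koszul (V := ![U, V]) (fun i => by fin_cases i <;> assumption)
  rw [koszul_one] at h
  refine Eq.trans (congrArg (α.d x) ?_) h
  ext i
  fin_cases i <;> rfl

theorem BForm.HasD.smoothNear_d (hα : α.HasD) {U V : ∀ x : M, TangentSpace I x}
    (hU : IsBVectorFieldAt I Z U x) (hV : IsBVectorFieldAt I Z V x) :
    SmoothNear I (fun y => α.d y ![bLift I Z U y, bLift I Z V y]) x := by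
  refine (((hU.smoothNear_dir ((hα.at x).smoothNear hV)).sub
    (hV.smoothNear_dir ((hα.at x).smoothNear hU))).sub
      ((hα.at x).smoothNear (hU.mlieBracket hV))).congr ?_
  filter_upwards [hU.eventually_isBVectorFieldAt, hV.eventually_isBVectorFieldAt] with y h1 h2
  exact hα.d_apply h1 h2

theorem BForm.HasD.isSmooth_d (hα : α.HasD) : α.d.IsSmooth := fun x V hV => by
  refine (hα.smoothNear_d (hV 0) (hV 1)).contMDiffAt.congr_of_eventuallyEq
    (Eventually.of_forall fun y => congrArg (α.d y) ?_)
  ext i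
  fin_cases i <;> rfl

/-- The differential of a `b`-form of degree `1` is closed. -/
theorem BForm.HasD.koszul_d (hα : α.HasD) {V : Fin 3 → ∀ y : M, TangentSpace I y}
    (hV : ∀ i, IsBVectorFieldAt I Z (V i) x) : α.d.koszul V x = 0 := by
  have hc : CompleteSpace E := FiniteDimensional.complete ℝ E
  have e : ∀ {U V : ∀ x : M, TangentSpace I x}, IsBVectorFieldAt I Z U x →
      IsBVectorFieldAt I Z V x → ∀ᶠ y in 𝓝 x, α.d y ![bLift I Z U y, bLift I Z V y] =
      dir I (fun y => α y ![bLift I Z V y]) y (U y) -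
      dir I (fun y => α y ![bLift I Z U y]) y (V y) -
      α y ![bLift I Z (VectorField.mlieBracket I U V) y] := fun hU hV => by
    filter_upwards [hU.eventually_isBVectorFieldAt, hV.eventually_isBVectorFieldAt] with y h1 h2
      using hα.d_apply h1 h2
  have s : ∀ {U : ∀ x : M, TangentSpace I x}, IsBVectorFieldAt I Z U x →
      SmoothNear I (fun y => α y ![bLift I Z U y]) x := fun hU => (hα.at x).smoothNear hU
  have de : ∀ {U V : ∀ x : M, TangentSpace I x}, IsBVectorFieldAt I Z U x →
      IsBVectorFieldAt I Z V x → ∀ w, dir I (fun y => α.d y ![bLift I Z U y, bLift I Z V y]) x w =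
      dir I (fun y => dir I (fun y => α y ![bLift I Z V y]) y (U y)) x w -
      dir I (fun y => dir I (fun y => α y ![bLift I Z U y]) y (V y)) x w -
      dir I (fun y => α y ![bLift I Z (VectorField.mlieBracket I U V) y]) x w := fun hU hV w => by
    rw [dir_congr_nhds (e hU hV), dir_sub_fun ((hU.smoothNear_dir (s hV)).sub
      (hV.smoothNear_dir (s hU))).mdiff (s (hU.mlieBracket hV)).mdiff,
      dir_sub_fun (hU.smoothNear_dir (s hV)).mdiff (hV.smoothNear_dir (s hU)).mdiff]
  have h01 := (hV 0).mlieBracket (hV 1)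
  have h02 := (hV 0).mlieBracket (hV 2)
  have h12 := (hV 1).mlieBracket (hV 2)
  have hJ := (hV 0).bLift_jacobi (hV 1) (hV 2)
  have lin : ∀ b c : BTangent I Z x, α x ![-b + c] = - α x ![b] + α x ![c] := fun b c => by
    obtain ⟨l, hl⟩ := (oneForm (V := BTangent I Z x)).surjective (α x)
    rw [← hl]
    simp
  -- The second derivatives of `α (Vₖ)` cancel against the derivatives along brackets, the
  -- derivatives of `α ([Vᵢ, Vⱼ])` cancel in pairs, and the double brackets cancel by the Jacobi
  -- identity.
  rw [koszul_two, de (hV 1) (hV 2), de (hV 0) (hV 2), de (hV 0) (hV 1), hα.d_apply h01 (hV 2),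
    hα.d_apply h02 (hV 1), hα.d_apply h12 (hV 0), hJ, lin,
    dir_mlieBracket (s (hV 2)) (hV 0).smooth (hV 1).smooth,
    dir_mlieBracket (s (hV 1)) (hV 0).smooth (hV 2).smooth,
    dir_mlieBracket (s (hV 0)) (hV 1).smooth (hV 2).smooth]
  ring

end HasD

end Calculus


/-! ### `b`-maps, their tangent maps, and naturality of the exterior derivative. -/

section BMaps

variable {E : Type*} [NormedAddCommGroup E] [NormedSpace ℝ E]
  {B : Type*} [TopologicalSpace B] {I : ModelWithCorners ℝ E B} [I.Boundaryless]
  {M : Type*} [TopologicalSpace M] [ChartedSpace B M] [IsManifold I ∞ M] {Z : Set M}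
  {E' : Type*} [NormedAddCommGroup E'] [NormedSpace ℝ E']
  {B' : Type*} [TopologicalSpace B'] {J : ModelWithCorners ℝ E' B'} [J.Boundaryless]
  {N : Type*} [TopologicalSpace N] [ChartedSpace B' N] [IsManifold J ∞ N] {W : Set N}
  {E'' : Type*} [NormedAddCommGroup E''] [NormedSpace ℝ E'']
  {B'' : Type*} [TopologicalSpace B''] {K : ModelWithCorners ℝ E'' B''} [K.Boundaryless]
  {P : Type*} [TopologicalSpace P] [ChartedSpace B'' P] [IsManifold K ∞ P] {Y : Set P}
  {F : M → N} {G : N → P} {x : M}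

theorem SmoothNear.comp {f : N → ℝ} (hf : SmoothNear J f (F x))
    (hF : ∀ᶠ y in 𝓝 x, ContMDiffAt I J ∞ F y) : SmoothNear I (fun y => f (F y)) x := by
  filter_upwards [hF, hF.self_of_nhds.continuousAt.eventually hf] with y h1 h2 using h2.comp y h1

/-- Differentiating `F ∘ σ = id` shows that `dσ v` is a preimage of `v`. -/
theorem mfderiv_surjective_of_section {σ : N → M} (hF : ContMDiffAt I J ∞ F x)
    (hσ : ContMDiffAt J I ∞ σ (F x)) (hx : σ (F x) = x) (h : ∀ᶠ y in 𝓝 (F x), F (σ y) = y)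
    (v : TangentSpace J (F x)) : ∃ w, mfderiv I J F x w = v := by
  have h1 : MDifferentiableAt I J F (σ (F x)) := by
    rw [hx]; exact hF.mdifferentiableAt (by simp)
  have h2 := mfderiv_comp (F x) h1 (hσ.mdifferentiableAt (by simp))
  have h3 : F ∘ σ =ᶠ[𝓝 (F x)] id := h
  rw [h3.mfderiv_eq, mfderiv_id] at h2
  -- `σ (F x)` and `x` are equal only propositionally; this moves the tangent vector to the fibre at
  -- `x`.
  have h4 : ∀ z, z = x → ∀ w : E, ∃ w' : E,
      (mfderiv I J F x w' : E') = (mfderiv I J F z w : E') := by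
    rintro z rfl w; exact ⟨w, rfl⟩
  obtain ⟨w, hw⟩ := h4 (σ (F x)) hx (mfderiv J I σ (F x) v)
  exact ⟨w, hw.trans (congrArg (fun L : E' →L[ℝ] E' => L v) h2).symm⟩

/-- A submersion `F` is a `b`-map if `F ⁻¹ W = Z`. -/
theorem IsBMapAt.of_surjective (hF : ∀ᶠ y in 𝓝 x, ContMDiffAt I J ∞ F y)
    (hZ : ∀ᶠ y in 𝓝 x, (F y ∈ W ↔ y ∈ Z)) (h : ∀ v, ∃ w, mfderiv I J F x w = v) :
    IsBMapAt I Z J W F x := by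
  refine ⟨hF, fun f hf => ⟨hf.smoothNear.comp hF, ?_, fun hx h0 => ?_⟩⟩
  · filter_upwards [hZ, hF.self_of_nhds.continuousAt.eventually hf.zero_iff] with y h1 h2
    exact h2.trans h1
  · apply hf.regular (hZ.self_of_nhds.2 hx)
    ext v
    obtain ⟨w, rfl⟩ := h v
    have h1 := dir_comp hf.smoothNear.contMDiffAt hF.self_of_nhds w
    refine h1.symm.trans ?_
    unfold dir
    rw [h0]
    rfl

/-- If `F` pulls one local defining function back to a local defining function, then it is a
`b`-map. -/
theorem IsBMapAt.of_isDefFun [FiniteDimensional ℝ E'] {f : N → ℝ}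
    (hF : ∀ᶠ y in 𝓝 x, ContMDiffAt I J ∞ F y)
    (hf : IsDefFun J W f (F x)) (hfF : IsDefFun I Z (f ∘ F) x) : IsBMapAt I Z J W F x := by
  refine ⟨hF, fun f' hf' => ?_⟩
  obtain ⟨u, hu, hu'⟩ := hf.exists_ratio_of_isDefFun hf'
  exact hfF.mul_of_ne_zero (hu.comp hF) (hf.ratio_apply_ne_zero hf' hu hu')
    (hF.self_of_nhds.continuousAt.eventually hu')

theorem IsBMapAt.comp_isBMapAt (hG : IsBMapAt J W K Y G (F x)) (hF : IsBMapAt I Z J W F x) :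
    IsBMapAt I Z K Y (G ∘ F) x := by
  refine ⟨?_, fun f hf => hF.comp _ (hG.comp f hf)⟩
  filter_upwards [hF.smooth, hF.smooth.self_of_nhds.continuousAt.eventually hG.smooth]
    with y h1 h2 using h2.comp y h1

/-- A defining function `f` and its pull-back `f ∘ F` remain defining functions at nearby points,
and one such pair is enough to recognize a `b`-map. -/
theorem IsBMapAt.eventually [FiniteDimensional ℝ E'] [hW : IsHypersurface J W]
    (hF : IsBMapAt I Z J W F x) : ∀ᶠ y in 𝓝 x, IsBMapAt I Z J W F y := by
  obtain ⟨f, hf⟩ := hW.exists_defFun (F x)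
  filter_upwards [hF.smooth.eventually_nhds, (hF.comp f hf).eventually_isDefFun,
    hF.smooth.self_of_nhds.continuousAt.eventually hf.eventually_isDefFun] with y h1 h2 h3
  exact .of_isDefFun h1 h3 h2

theorem anchor_bMap (hF : IsBMapAt I Z J W F x) (b : BTangent I Z x) :
    anchor J W (bMap I Z J W F x b) = mfderiv I J F x (anchor I Z b) := by
  rw [bMap, dif_pos hF]
  rfl

theorem dlog_bMap (hF : IsBMapAt I Z J W F x) {f : N → ℝ} (hf : IsDefFun J W f (F x))
    (b : BTangent I Z x) : dlog J W f (bMap I Z J W F x b) = dlog I Z (f ∘ F) b := by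
  rw [bMap, dif_pos hF]
  exact if_pos hf

theorem bDiff_bMap (hF : IsBMapAt I Z J W F x) {f : N → ℝ} (hf : SmoothNear J f (F x))
    (b : BTangent I Z x) : bDiff W f (F x) (bMap I Z J W F x b) = bDiff Z (f ∘ F) x b := by
  rw [bDiff_apply, anchor_bMap hF, bDiff_apply,
    dir_comp hf.contMDiffAt hF.smooth.self_of_nhds]

theorem bMap_comp [FiniteDimensional ℝ E''] [hY : IsHypersurface K Y]
    (hG : IsBMapAt J W K Y G (F x)) (hF : IsBMapAt I Z J W F x) (b : BTangent I Z x) :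
    bMap I Z K Y (G ∘ F) x b = bMap J W K Y G (F x) (bMap I Z J W F x b) := by
  obtain ⟨f, hf⟩ := hY.exists_defFun (G (F x))
  refine BTangent.ext_dlog hf ?_ ?_
  · rw [anchor_bMap hG, anchor_bMap hF, anchor_bMap (hG.comp_isBMapAt hF),
      mfderiv_comp x (hG.smooth.self_of_nhds.mdifferentiableAt (by simp))
        (hF.smooth.self_of_nhds.mdifferentiableAt (by simp))]
    rfl
  · rw [dlog_bMap hG hf, dlog_bMap hF (hG.comp f hf), dlog_bMap (hG.comp_isBMapAt hF) hf]
    rfl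

/-- The preimage has as anchor a preimage `w` of the anchor of `b`, and takes the value `dlog f b`
on `f ∘ F`. These data are compatible, since `w` differentiates `f ∘ F` as the anchor of `b`
differentiates `f`. -/
theorem bMap_surjective [FiniteDimensional ℝ E] [FiniteDimensional ℝ E'] [hW : IsHypersurface J W]
    (hF : IsBMapAt I Z J W F x) (h : ∀ v, ∃ w, mfderiv I J F x w = v) :
    Function.Surjective (bMap I Z J W F x) := by
  intro b
  obtain ⟨f, hf⟩ := hW.exists_defFun (F x)
  obtain ⟨w, hw⟩ := h (anchor J W b)
  obtain ⟨c, hc, hc'⟩ := BTangent.exists_anchor_dlog (hF.comp f hf) w (dlog J W f b) (by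
    rw [dir_comp hf.smoothNear.contMDiffAt hF.smooth.self_of_nhds, hw, dir_anchor b hf]
    rfl)
  refine ⟨c, BTangent.ext_dlog hf ?_ ?_⟩
  · rw [anchor_bMap hF, hc, hw]
  · rw [dlog_bMap hF hf, hc']

theorem bMap_eq_zero_iff [FiniteDimensional ℝ E'] {f : N → ℝ} (hf : IsDefFun J W f (F x))
    (hF : IsBMapAt I Z J W F x) {b : BTangent I Z x} :
    bMap I Z J W F x b = 0 ↔
      mfderiv I J F x (anchor I Z b) = 0 ∧ dlog I Z (f ∘ F) b = 0 := by
  rw [← anchor_bMap hF, ← dlog_bMap hF hf]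
  refine ⟨fun h => by simp [h], fun h => BTangent.ext_dlog hf ?_ ?_⟩
  · rw [h.1, map_zero]
  · rw [h.2, map_zero]

/-- Defining functions pull back; the critical hypersurfaces of the total spaces below arise in this
way from their projections. -/
theorem IsHypersurface.of_isBMapAt [hW : IsHypersurface J W] (hF : ∀ x, IsBMapAt I Z J W F x) :
    IsHypersurface I Z where
  exists_defFun x := by
    obtain ⟨f, hf⟩ := hW.exists_defFun (F x)
    exact ⟨_, (hF x).comp f hf⟩

theorem pullback_apply {k : ℕ} (α : BForm J W k) (F : M → N) (x : M)
    (v : Fin k → BTangent I Z x) :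
    BForm.pullback F α x v = α (F x) (fun i => bMap I Z J W F x (v i)) := rfl

theorem pullback_apply_one (α : BForm J W 1) (F : M → N) (x : M) (b : BTangent I Z x) :
    BForm.pullback F α x ![b] = α (F x) ![bMap I Z J W F x b] := by
  rw [pullback_apply]
  congr 1
  ext i
  fin_cases i
  rfl

theorem pullback_apply_two (α : BForm J W 2) (F : M → N) (x : M) (b c : BTangent I Z x) :
    BForm.pullback F α x ![b, c] = α (F x) ![bMap I Z J W F x b, bMap I Z J W F x c] := by
  rw [pullback_apply]
  congr 1
  ext i
  fin_cases i <;> rfl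

section Pullback

variable [FiniteDimensional ℝ E'] [hW : IsHypersurface J W]

/-- Generators pull back to generators: `a dg` to `(a ∘ F) d(g ∘ F)`, and `a df / f` to the same
expression in `a ∘ F` and `f ∘ F`, which is a defining function because `F` is a `b`-map. -/
theorem HasDAt.pullback {α : BForm J W 1} {η} (h : HasDAt (F x) α η)
    (hF : IsBMapAt I Z J W F x) :
    HasDAt x (BForm.pullback (I := I) (Z := Z) F α) (η.compLinearMap (bMap I Z J W F x)) := by
  have hc := hF.smooth.self_of_nhds.continuousAt
  induction h with
  | exact a g ha hg =>
    rw [wedge_comp]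
    have e : ∀ f : N → ℝ, SmoothNear J f (F x) →
        bDiff W f (F x) ∘ₗ bMap I Z J W F x = bDiff Z (f ∘ F) x :=
      fun f hf => LinearMap.ext fun b => bDiff_bMap hF hf b
    rw [e a ha, e g hg]
    refine .congr _ _ _ (.exact (a ∘ F) (g ∘ F) (ha.comp hF.smooth) (hg.comp hF.smooth)) ?_
    filter_upwards [hF.eventually, hc.eventually hg.eventually] with y h1 h2
    refine oneForm_ext fun b => ?_
    rw [pullback_apply_one]
    exact congrArg (a (F y) * ·) (bDiff_bMap h1 h2 b)
  | log a f ha hf =>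
    rw [wedge_comp]
    have e : bDiff W a (F x) ∘ₗ bMap I Z J W F x = bDiff Z (a ∘ F) x :=
      LinearMap.ext fun b => bDiff_bMap hF ha b
    have e' : (dlog J W f).toLinearMap ∘ₗ bMap I Z J W F x = (dlog I Z (f ∘ F)).toLinearMap :=
      LinearMap.ext fun b => dlog_bMap hF hf b
    rw [e, e']
    refine .congr _ _ _ (.log (a ∘ F) (f ∘ F) (ha.comp hF.smooth) (hF.comp f hf)) ?_
    filter_upwards [hF.eventually, hc.eventually hf.eventually_isDefFun] with y h1 h2
    refine oneForm_ext fun b => ?_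
    rw [pullback_apply_one]
    exact congrArg (a (F y) * ·) (dlog_bMap h1 h2 b)
  | add α β η ξ hα hβ h1 h2 => exact .add _ _ _ _ h1 h2
  | congr α β η hα h h1 =>
    refine .congr _ _ _ h1 ?_
    filter_upwards [hc.eventually h] with y h
    unfold BForm.pullback
    rw [h]

theorem BForm.HasD.pullback {α : BForm J W 1} (hα : α.HasD) (hF : ∀ x, IsBMapAt I Z J W F x) :
    (BForm.pullback (I := I) (Z := Z) F α).HasD := fun x => by
  exact ⟨_, (hα.at (F x)).pullback (hF x)⟩

/-- The formal differential pulls back together with the form, so naturality needs no comparison of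
vector fields along `F`. -/
theorem BForm.HasD.d_pullback [FiniteDimensional ℝ E] [IsHypersurface I Z] {α : BForm J W 1}
    (hα : α.HasD) (hF : ∀ x, IsBMapAt I Z J W F x) :
    (BForm.pullback (I := I) (Z := Z) F α).d = BForm.pullback F α.d :=
  funext fun x => ((hα.at (F x)).pullback (hF x)).d_eq

end Pullback

end BMaps

/-! ### Forms given by coefficients in a local coframe. -/

section FrameForms

variable {E : Type*} [NormedAddCommGroup E] [NormedSpace ℝ E] [FiniteDimensional ℝ E]
  {M : Type*} [TopologicalSpace M] [ChartedSpace E M] [IsManifold 𝓘(ℝ, E) ∞ M]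
  {Z : Set M} [hZ : IsHypersurface 𝓘(ℝ, E) Z]
  {E' : Type*} [NormedAddCommGroup E'] [NormedSpace ℝ E'] [FiniteDimensional ℝ E']
  {B' : Type*} [TopologicalSpace B'] {J : ModelWithCorners ℝ E' B'} [J.Boundaryless]
  {N : Type*} [TopologicalSpace N] [ChartedSpace B' N] [IsManifold J ∞ N] {W : Set N}
  {F : N → M} {x : N}

omit [IsManifold J ∞ N] [J.Boundaryless] [FiniteDimensional ℝ E'] in
theorem HasDAt.zero : HasDAt x (0 : BForm J W 1) 0 := by
  have h := HasDAt.exact (Z := W) (I := J) (x := x) (fun _ => 0) (fun _ => 0)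
    (SmoothNear.const 0) (SmoothNear.const 0)
  have e : wedge (bDiff (I := J) W (fun _ => (0 : ℝ)) x) (bDiff W (fun _ => (0 : ℝ)) x) = 0 := by
    ext v
    simp [wedge_apply, bDiff_apply, dir_const_fun]
  rw [e] at h
  refine .congr _ _ _ h (Eventually.of_forall fun y => oneForm_ext fun b => ?_)
  simp

omit [IsManifold J ∞ N] [J.Boundaryless] [FiniteDimensional ℝ E'] in
theorem HasDAt.sum {ι : Type*} (s : Finset ι) {α : ι → BForm J W 1}
    {η : ι → BTangent J W x [⋀^Fin 2]→ₗ[ℝ] ℝ} (h : ∀ i, HasDAt x (α i) (η i)) :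
    HasDAt x (∑ i ∈ s, α i) (∑ i ∈ s, η i) := by
  classical
  induction s using Finset.induction_on with
  | empty => simpa using HasDAt.zero
  | insert i s hi ih =>
    rw [Finset.sum_insert hi, Finset.sum_insert hi]
    exact .add _ _ _ _ (h i) ih

omit [NormedAddCommGroup E] [NormedSpace ℝ E] [FiniteDimensional ℝ E] in
theorem alternatingMap_sum_apply {V ι κ : Type*} [AddCommGroup V] [Module ℝ V] (s : Finset κ)
    (f : κ → V [⋀^ι]→ₗ[ℝ] ℝ) (v : ι → V) : (∑ i ∈ s, f i) v = ∑ i ∈ s, f i v := by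
  classical
  induction s using Finset.induction_on with
  | empty => simp
  | insert i s hi ih => rw [Finset.sum_insert hi, Finset.sum_insert hi, AlternatingMap.add_apply, ih]

theorem BFrame.contMDiffAt_φ (A : BFrame (E := E) Z) {y : M} (hy : y ∈ A.U) :
    ContMDiffAt 𝓘(ℝ, E) 𝓘(ℝ, E) ∞ A.φ y :=
  contMDiffAt_of_mem_maximalAtlas (IsManifold.subset_maximalAtlas A.φ_mem) (A.subset hy)

/-- Brings the coframe within reach of `HasDAt`: by the definition of `BFrame.coord`, each component
is an exact form plus a function times `df / f`. -/
theorem BFrame.apply_coord (A : BFrame (E := E) Z) {y : M} (hy : y ∈ A.U) (l : E →L[ℝ] ℝ)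
    (b : BTangent 𝓘(ℝ, E) Z y) : l (A.coord y b) = bDiff Z (fun y => l (A.φ y)) y b +
      ((1 - A.f y) * l (A.ε y)) * dlog 𝓘(ℝ, E) Z A.f b := by
  have hdφ : ∀ v, dir 𝓘(ℝ, E) (fun y => l (A.φ y)) y v = l (chartCoord A.φ y v) := by
    intro v
    unfold dir
    change mfderiv 𝓘(ℝ, E) 𝓘(ℝ) (l ∘ A.φ) y v = _
    rw [mfderiv_comp y l.mdifferentiableAt ((A.contMDiffAt_φ hy).mdifferentiableAt (by simp)),
      l.mfderiv_eq]
    rfl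
  rw [bDiff_apply, hdφ]
  change l (chartCoord A.φ y (anchor _ Z b) + (1 - A.f y) • (dlog _ Z A.f b) • A.ε y) = _
  rw [map_add, map_smul, map_smul, smul_eq_mul, smul_eq_mul]
  ring

/-- The product of a function and of the pull-back of a component of the coframe of a local
frame. -/
theorem HasDAt.frame_component (A : BFrame (E := E) Z) (hF : IsBMapAt J W 𝓘(ℝ, E) Z F x)
    (hx : F x ∈ A.U) (l : E →L[ℝ] ℝ) {a : N → ℝ} (ha : SmoothNear J a x) :
    ∃ η, HasDAt x (fun y => oneForm (a y •
        (l.toLinearMap ∘ₗ (A.coord (F y)).toLinearMap ∘ₗ bMap J W 𝓘(ℝ, E) Z F y))) η ∧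
      ∀ b c, bMap J W 𝓘(ℝ, E) Z F x c = 0 → η ![b, c] =
        - dir J a x (anchor J W c) * l (A.coord (F x) (bMap J W 𝓘(ℝ, E) Z F x b)) := by
  have hU := A.isOpen.mem_nhds hx
  have hc := hF.smooth.self_of_nhds.continuousAt
  have hφ : SmoothNear 𝓘(ℝ, E) (fun y => l (A.φ y)) (F x) := by
    filter_upwards [hU] with y hy using (l.contMDiff.contMDiffAt).comp y (A.contMDiffAt_φ hy)
  have hk : SmoothNear 𝓘(ℝ, E) (fun y => (1 - A.f y) * l (A.ε y)) (F x) := by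
    filter_upwards [hU] with y hy
    exact (contMDiffAt_const.sub (A.contMDiffAt_f hy)).mul
      ((l.contMDiff.contMDiffAt).comp y (A.smooth y hy))
  have hf := A.isDefFun _ hx
  have key : ∀ y ∈ A.U, ∀ b : BTangent 𝓘(ℝ, E) Z y, l (A.coord y b) =
      bDiff Z (fun y => l (A.φ y)) y b +
        ((1 - A.f y) * l (A.ε y)) * dlog 𝓘(ℝ, E) Z A.f b := fun y hy b => A.apply_coord hy l b
  set k : M → ℝ := fun y => (1 - A.f y) * l (A.ε y)
  set p : M → ℝ := fun y => l (A.φ y)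
  have hkF := hk.comp hF.smooth
  -- The form is `a d(p ∘ F)` plus the multiple `a (k ∘ F)` of the logarithmic differential of `A.f
  -- ∘ F`.
  refine ⟨_, .congr _ _ _ (.add _ _ _ _ (.exact a (p ∘ F) ha (hφ.comp hF.smooth))
    (.log (fun y => a y * k (F y)) (A.f ∘ F) (ha.mul hkF) (hF.comp _ hf))) ?_, fun b c h0 => ?_⟩
  · filter_upwards [hF.eventually, hc.eventually hU, hc.eventually hφ.eventually] with y h1 h2 h3
    refine oneForm_ext fun b => ?_
    have e := key _ h2 (bMap J W 𝓘(ℝ, E) Z F y b)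
    rw [bDiff_bMap h1 h3, dlog_bMap h1 (A.isDefFun _ h2)] at e
    change a y * l (A.coord (F y) (bMap J W 𝓘(ℝ, E) Z F y b)) =
      a y * bDiff W (p ∘ F) y b + (a y * k (F y)) * dlog J W (A.f ∘ F) b
    rw [e]
    ring
  · have e := key _ hx (bMap J W 𝓘(ℝ, E) Z F x b)
    rw [bDiff_bMap hF hφ, dlog_bMap hF hf] at e
    -- A vector `c` with `F_* c = 0` kills everything pulled back from `M`, so `η ![b, c]` involves
    -- only the derivative of `a` along `c`.
    have c1 : bDiff W (p ∘ F) x c = 0 := by rw [← bDiff_bMap hF hφ, h0, map_zero]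
    have c2 : dlog J W (A.f ∘ F) c = 0 := by rw [← dlog_bMap hF hf, h0, map_zero]
    have c3 : dir J (fun y => k (F y)) x (anchor J W c) = 0 := by
      have : bDiff W (k ∘ F) x c = 0 := by rw [← bDiff_bMap hF hk, h0, map_zero]
      exact this
    rw [AlternatingMap.add_apply, wedge_apply, wedge_apply, e]
    simp only [Matrix.cons_val_zero, Matrix.cons_val_one, ContinuousLinearMap.coe_coe, c1, c2]
    rw [bDiff_apply (fun y => a y * k (F y)) x c, bDiff_apply a x c, dir_mul_fun ha.mdiff hkF.mdiff, c3]
    simp only [k]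
    ring

/-- A `b`-form `y ↦ ∑ i, aᵢ(y) lᵢ(F_* ·)`, where `lᵢ` are components of the coframe of a local
frame. -/
theorem HasDAt.of_frame (A : BFrame (E := E) Z) (hF : IsBMapAt J W 𝓘(ℝ, E) Z F x)
    (hx : F x ∈ A.U) {α : BForm J W 1} {a : N → E →L[ℝ] ℝ}
    (ha : ∀ w, SmoothNear J (fun y => a y w) x)
    (hα : ∀ᶠ y in 𝓝 x, ∀ b, α y ![b] = a y (A.coord (F y) (bMap J W 𝓘(ℝ, E) Z F y b))) :
    ∃ η, HasDAt x α η ∧ ∀ b c, bMap J W 𝓘(ℝ, E) Z F x c = 0 →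
      ∃ l : E →ₗ[ℝ] ℝ, (∀ w, l w = dir J (fun y => a y w) x (anchor J W c)) ∧
        η ![b, c] = - l (A.coord (F x) (bMap J W 𝓘(ℝ, E) Z F x b)) := by
  -- In a basis of `E`, `α` is a finite sum of the forms of `HasDAt.frame_component`, with
  -- coefficients `a y (e i)`.
  let e := Module.finBasis ℝ E
  let l := fun i => LinearMap.toContinuousLinearMap (e.coord i)
  choose η hη hη' using fun i => HasDAt.frame_component A hF hx (l i) (ha (e i))
  have hl : ∀ w : E, ∑ i, l i w • e i = w := fun w => e.sum_repr w
  refine ⟨_, .congr _ _ _ (HasDAt.sum Finset.univ hη) ?_, fun b c h0 => ?_⟩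
  · filter_upwards [hα] with y hy
    refine oneForm_ext fun b => ?_
    rw [hy, Finset.sum_apply, alternatingMap_sum_apply]
    conv_lhs => rw [← hl (A.coord (F y) (bMap J W 𝓘(ℝ, E) Z F y b)), map_sum]
    refine Finset.sum_congr rfl fun i _ => ?_
    rw [map_smul, smul_eq_mul, mul_comm]
    rfl
  -- The derivative of the covector-valued coefficient `a` along `c`, assembled from its values on
  -- the basis; linearity of `dir` gives its value on every `w`.
  · refine ⟨∑ i, dir J (fun y => a y (e i)) x (anchor J W c) • (l i).toLinearMap, fun w => ?_, ?_⟩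
    · have h1 : (fun y => a y w) = fun y => ∑ i, l i w * a y (e i) := by
        ext y
        conv_lhs => rw [← hl w, map_sum]
        simp
      have h2 : ∀ s : Finset (Fin (Module.finrank ℝ E)),
          SmoothNear J (fun y => ∑ i ∈ s, l i w * a y (e i)) x ∧
          dir J (fun y => ∑ i ∈ s, l i w * a y (e i)) x (anchor J W c) =
          ∑ i ∈ s, dir J (fun y => a y (e i)) x (anchor J W c) * l i w := by
        intro s
        induction s using Finset.induction_on with
        | empty => exact ⟨by simpa using SmoothNear.const 0, by simp [dir_const_fun]⟩
        | insert i s hi ih =>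
          have h3 := (SmoothNear.const (I := J) (x := x) (l i w)).mul (ha (e i))
          simp only [Finset.sum_insert hi]
          refine ⟨h3.add ih.1, ?_⟩
          rw [dir_add_fun h3.mdiff ih.1.mdiff, ih.2,
            dir_mul_fun (SmoothNear.const _).mdiff (ha (e i)).mdiff, dir_const_fun]
          ring
      rw [h1, (h2 _).2, LinearMap.sum_apply]
      rfl
    · rw [alternatingMap_sum_apply, LinearMap.sum_apply, ← Finset.sum_neg_distrib]
      refine Finset.sum_congr rfl fun i _ => ?_
      rw [hη' i b c h0, neg_mul]
      rfl

end FrameForms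


/-! ### Smoothness of maps into the `b`-cotangent bundle. -/

section Cotangent

variable {E : Type*} [NormedAddCommGroup E] [NormedSpace ℝ E] [FiniteDimensional ℝ E]
  {M : Type*} [TopologicalSpace M] [ChartedSpace E M] [IsManifold 𝓘(ℝ, E) ∞ M]
  {Z : Set M} [hZ : IsHypersurface 𝓘(ℝ, E) Z]
  {E' : Type*} [NormedAddCommGroup E'] [NormedSpace ℝ E']
  {B' : Type*} [TopologicalSpace B'] {J : ModelWithCorners ℝ E' B'}
  {N : Type*} [TopologicalSpace N] [ChartedSpace B' N]

/-- The coordinates of a `b`-covector in a frame. -/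
def BFrame.covec (A : BFrame (E := E) Z) (p : BCotangentBundle E Z) : E →L[ℝ] ℝ :=
  LinearMap.toContinuousLinearMap (p.2.toLinearMap ∘ₗ A.vec p.1)

theorem BFrame.covec_apply (A : BFrame (E := E) Z) (p : BCotangentBundle E Z) (w : E) :
    A.covec p w = p.2 (A.vec p.1 w) := rfl

theorem BFrame.covec_coord (A : BFrame (E := E) Z) {p : BCotangentBundle E Z} (hp : p.1 ∈ A.U)
    (b : BTangent 𝓘(ℝ, E) Z p.1) : A.covec p (A.coord p.1 b) = p.2 b := by
  rw [A.covec_apply, A.vec_coord hp]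

/-- The trivialization at `x` is the frame selected there, with fibrewise inverse `vec`, while the
trivialization of the trivial line bundle is the identity. -/
theorem inCoordinates_cotangent {x y : M} (hy : y ∈ ((bFrameFamily E Z).idx x).U)
    (φ : BTangent 𝓘(ℝ, E) Z y →L[ℝ] ℝ) :
    ContinuousLinearMap.inCoordinates E (BTangent 𝓘(ℝ, E) Z) ℝ (Bundle.Trivial M ℝ) x y x y φ =
      ((bFrameFamily E Z).idx x).covec ⟨y, φ⟩ := by
  ext w
  rw [ContinuousLinearMap.inCoordinates]
  have h2 : (trivializationAt E (BTangent 𝓘(ℝ, E) Z) x).symmL ℝ y w =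
      ((bFrameFamily E Z).idx x).vec y w := by
    set T := trivializationAt E (BTangent 𝓘(ℝ, E) Z) x
    have hT : y ∈ T.baseSet := hy
    have h4 : T.continuousLinearMapAt ℝ y (((bFrameFamily E Z).idx x).vec y w) = w := by
      rw [Trivialization.continuousLinearMapAt_apply_of_mem ℝ T hT]
      exact ((bFrameFamily E Z).idx x).coord_vec hy w
    conv_lhs => rw [← h4]
    exact T.symmL_continuousLinearMapAt hT _
  have h3 : (trivializationAt ℝ (Bundle.Trivial M ℝ) x).continuousLinearMapAt ℝ y =
      ContinuousLinearMap.id ℝ ℝ := by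
    exact Bundle.Trivial.continuousLinearMapAt_trivialization ℝ M ℝ y
  rw [h3]
  exact congrArg φ h2

theorem contMDiffAt_cotangent_iff_idx {f : N → BCotangentBundle E Z} {x₀ : N} :
    ContMDiffAt J (𝓘(ℝ, E).prod 𝓘(ℝ, E →L[ℝ] ℝ)) ∞ f x₀ ↔
      ContMDiffAt J 𝓘(ℝ, E) ∞ (fun x => (f x).1) x₀ ∧
      ContMDiffAt J 𝓘(ℝ, E →L[ℝ] ℝ) ∞
        (fun x => ((bFrameFamily E Z).idx (f x₀).1).covec (f x)) x₀ := by
  rw [contMDiffAt_hom_bundle]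
  refine and_congr_right fun h => ?_
  have hU : ∀ᶠ x in 𝓝 x₀, (f x).1 ∈ ((bFrameFamily E Z).idx (f x₀).1).U :=
    h.continuousAt.eventually (((bFrameFamily E Z).idx (f x₀).1).isOpen.mem_nhds
      ((bFrameFamily E Z).mem_idx (f x₀).1))
  refine Filter.EventuallyEq.contMDiffAt_iff ?_
  filter_upwards [hU] with x hx
  exact inCoordinates_cotangent hx (f x).2

/-- A map to the `b`-cotangent bundle is smooth if and only if its base point and its coordinates
in a frame are smooth. -/
theorem contMDiffAt_cotangent_iff {f : N → BCotangentBundle E Z} {x₀ : N}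
    (A : BFrame (E := E) Z) (hA : (f x₀).1 ∈ A.U) :
    ContMDiffAt J (𝓘(ℝ, E).prod 𝓘(ℝ, E →L[ℝ] ℝ)) ∞ f x₀ ↔
      ContMDiffAt J 𝓘(ℝ, E) ∞ (fun x => (f x).1) x₀ ∧
      ContMDiffAt J 𝓘(ℝ, E →L[ℝ] ℝ) ∞ (fun x => A.covec (f x)) x₀ := by
  rw [contMDiffAt_cotangent_iff_idx]
  refine and_congr_right fun h => ?_
  have hA' : (f x₀).1 ∈ ((bFrameFamily E Z).idx (f x₀).1).U := (bFrameFamily E Z).mem_idx (f x₀).1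
  -- The coordinates in two frames differ by composition with the smooth change of frame `C.coord ∘
  -- D.vec`.
  have key : ∀ C D : BFrame (E := E) Z, (f x₀).1 ∈ C.U → (f x₀).1 ∈ D.U →
      ContMDiffAt J 𝓘(ℝ, E →L[ℝ] ℝ) ∞ (fun x => C.covec (f x)) x₀ →
      ContMDiffAt J 𝓘(ℝ, E →L[ℝ] ℝ) ∞ (fun x => D.covec (f x)) x₀ := by
    intro C D hC hD hs
    have h1 := ContMDiffAt.comp x₀ (D.contMDiffAt_change C ⟨hD, hC⟩) h
    refine (hs.clm_comp h1).congr_of_eventuallyEq ?_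
    filter_upwards [h.continuousAt.eventually (C.isOpen.mem_nhds hC)] with x hx
    ext w
    exact (C.covec_coord hx (D.vec (f x).1 w)).symm
  exact ⟨key _ _ hA' hA, key _ _ hA hA'⟩

theorem BFrame.contMDiffAt_covec (A : BFrame (E := E) Z) {p : BCotangentBundle E Z}
    (hp : p.1 ∈ A.U) : ContMDiffAt (𝓘(ℝ, E).prod 𝓘(ℝ, E →L[ℝ] ℝ)) 𝓘(ℝ, E →L[ℝ] ℝ) ∞ A.covec p :=
  ((contMDiffAt_cotangent_iff (f := id) A hp).1 contMDiffAt_id).2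

/-- A linear map on a finite-dimensional space is a fixed finite combination of its values on a
basis, so smoothness may be tested on vectors. -/
theorem contMDiffAt_clm_of_apply {V : Type*} [NormedAddCommGroup V] [NormedSpace ℝ V]
    {f : N → E →L[ℝ] V} {x : N} (h : ∀ w, ContMDiffAt J 𝓘(ℝ, V) ∞ (fun y => f y w) x) :
    ContMDiffAt J 𝓘(ℝ, E →L[ℝ] V) ∞ f x := by
  let e := Module.finBasis ℝ E
  let l := fun i => LinearMap.toContinuousLinearMap (e.coord i)
  have h1 : f = fun y => ∑ i, (ContinuousLinearMap.smulRightL ℝ E V (l i)) (f y (e i)) := by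
    ext y w
    conv_lhs => rw [← e.sum_repr w, map_sum]
    rw [sum_apply]
    refine Finset.sum_congr rfl fun i _ => ?_
    rw [map_smul]
    rfl
  rw [h1]
  exact contMDiffAt_finsetSum fun i _ =>
    (contMDiffAt_const (c := ContinuousLinearMap.smulRightL ℝ E V (l i))).clm_apply (h (e i))

end Cotangent


/-! ### The canonical form on the `b`-cotangent bundle is `b`-symplectic. -/

section CanonicalForm

variable {E : Type*} [NormedAddCommGroup E] [NormedSpace ℝ E] [FiniteDimensional ℝ E]
  {M : Type*} [TopologicalSpace M] [ChartedSpace E M] [IsManifold 𝓘(ℝ, E) ∞ M]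
  {Z : Set M} [hZ : IsHypersurface 𝓘(ℝ, E) Z]

/-- The `b`-covector at `y` with given coordinates in a frame. -/
def BFrame.ofCovec (A : BFrame (E := E) Z) (q : M × (E →L[ℝ] ℝ)) : BCotangentBundle E Z :=
  ⟨q.1, q.2.comp (A.coord q.1)⟩

theorem BFrame.covec_ofCovec (A : BFrame (E := E) Z) {q : M × (E →L[ℝ] ℝ)} (hq : q.1 ∈ A.U) :
    A.covec (A.ofCovec q) = q.2 := by
  ext w
  exact congrArg q.2 (A.coord_vec hq w)

theorem BFrame.ofCovec_covec (A : BFrame (E := E) Z) {p : BCotangentBundle E Z}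
    (hp : p.1 ∈ A.U) : A.ofCovec (p.1, A.covec p) = p := by
  refine congrArg (TotalSpace.mk p.1) ?_
  ext b
  exact A.covec_coord hp b

theorem BFrame.contMDiffAt_ofCovec (A : BFrame (E := E) Z) {q : M × (E →L[ℝ] ℝ)}
    (hq : q.1 ∈ A.U) : ContMDiffAt (𝓘(ℝ, E).prod 𝓘(ℝ, E →L[ℝ] ℝ))
      (𝓘(ℝ, E).prod 𝓘(ℝ, E →L[ℝ] ℝ)) ∞ A.ofCovec q := by
  refine (contMDiffAt_cotangent_iff A hq).2 ⟨contMDiffAt_fst, ?_⟩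
  refine contMDiffAt_snd.congr_of_eventuallyEq ?_
  filter_upwards [continuousAt_fst.eventually (A.isOpen.mem_nhds hq)] with y hy
  exact A.covec_ofCovec hy

/-- The local trivialization of the `b`-cotangent bundle defined by a frame. -/
def BFrame.trivialize (A : BFrame (E := E) Z) (p : BCotangentBundle E Z) : M × (E →L[ℝ] ℝ) :=
  (p.1, A.covec p)

theorem contMDiffAt_cotangent_proj (p : BCotangentBundle E Z) :
    ContMDiffAt (𝓘(ℝ, E).prod 𝓘(ℝ, E →L[ℝ] ℝ)) 𝓘(ℝ, E) ∞
      (TotalSpace.proj : BCotangentBundle E Z → M) p := by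
  obtain ⟨A, hA⟩ := exists_bFrame (E := E) Z p.1
  exact ((contMDiffAt_cotangent_iff (f := id) A hA).1 contMDiffAt_id).1

theorem BFrame.contMDiffAt_trivialize (A : BFrame (E := E) Z) {p : BCotangentBundle E Z}
    (hp : p.1 ∈ A.U) : ContMDiffAt (𝓘(ℝ, E).prod 𝓘(ℝ, E →L[ℝ] ℝ))
      (𝓘(ℝ, E).prod 𝓘(ℝ, E →L[ℝ] ℝ)) ∞ A.trivialize p :=
  (contMDiffAt_cotangent_proj p).prodMk (A.contMDiffAt_covec hp)

/-- The derivative of the coordinates of a `b`-covector. -/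
def BFrame.dcovec (A : BFrame (E := E) Z) (p : BCotangentBundle E Z) :
    TangentSpace (𝓘(ℝ, E).prod 𝓘(ℝ, E →L[ℝ] ℝ)) p →L[ℝ] (E →L[ℝ] ℝ) :=
  mfderiv (𝓘(ℝ, E).prod 𝓘(ℝ, E →L[ℝ] ℝ)) 𝓘(ℝ, E →L[ℝ] ℝ) A.covec p

/-- The local trivialization has the smooth inverse `ofCovec`, so its derivative is onto, and the
base and fibre components can be prescribed independently. -/
theorem BFrame.exists_mfderiv_trivialize (A : BFrame (E := E) Z) {p : BCotangentBundle E Z}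
    (hp : p.1 ∈ A.U) (u : E) (δ : E →L[ℝ] ℝ) :
    ∃ v, mfderiv (𝓘(ℝ, E).prod 𝓘(ℝ, E →L[ℝ] ℝ)) 𝓘(ℝ, E)
        (TotalSpace.proj : BCotangentBundle E Z → M) p v = u ∧
      A.dcovec p v = δ := by
  have h1 := mfderiv_surjective_of_section (σ := A.ofCovec) (A.contMDiffAt_trivialize hp)
    (A.contMDiffAt_ofCovec hp) (A.ofCovec_covec hp) (by
      filter_upwards [continuousAt_fst.eventually (A.isOpen.mem_nhds hp)] with q hq
      exact Prod.ext rfl (A.covec_ofCovec hq)) (u, δ)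
  obtain ⟨v, hv⟩ := h1
  have h2 := mfderiv_prodMk ((contMDiffAt_cotangent_proj p).mdifferentiableAt (by simp))
    ((A.contMDiffAt_covec hp).mdifferentiableAt (by simp))
  have h3 := (congrArg (fun L : E × (E →L[ℝ] ℝ) →L[ℝ] E × (E →L[ℝ] ℝ) => L v) h2).symm.trans hv
  exact ⟨v, congrArg Prod.fst h3, congrArg Prod.snd h3⟩

/-- The two components form a surjective endomorphism of the finite-dimensional space `E × E*`,
which is therefore injective. -/
theorem BFrame.eq_zero_of_mfderiv (A : BFrame (E := E) Z) {p : BCotangentBundle E Z}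
    (hp : p.1 ∈ A.U) {v : TangentSpace (𝓘(ℝ, E).prod 𝓘(ℝ, E →L[ℝ] ℝ)) p}
    (h1 : mfderiv (𝓘(ℝ, E).prod 𝓘(ℝ, E →L[ℝ] ℝ)) 𝓘(ℝ, E)
        (TotalSpace.proj : BCotangentBundle E Z → M) p v = 0)
    (h2 : A.dcovec p v = 0) : v = 0 := by
  let L1 : E × (E →L[ℝ] ℝ) →L[ℝ] E := mfderiv (𝓘(ℝ, E).prod 𝓘(ℝ, E →L[ℝ] ℝ)) 𝓘(ℝ, E)
        (TotalSpace.proj : BCotangentBundle E Z → M) p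
  let L2 : E × (E →L[ℝ] ℝ) →L[ℝ] (E →L[ℝ] ℝ) := A.dcovec p
  let L := L1.prod L2
  have hs : Function.Surjective L.toLinearMap := by
    rintro ⟨u, δ⟩
    obtain ⟨v, hv, hv'⟩ := A.exists_mfderiv_trivialize hp u δ
    exact ⟨v, Prod.ext hv hv'⟩
  have hi : Function.Injective L.toLinearMap := LinearMap.injective_iff_surjective.2 hs
  exact hi ((Prod.ext h1 h2 : L v = 0).trans (map_zero L).symm)

theorem isBMapAt_cotangent_proj (p : BCotangentBundle E Z) :
    IsBMapAt (𝓘(ℝ, E).prod 𝓘(ℝ, E →L[ℝ] ℝ)) (cotangentCritical E Z) 𝓘(ℝ, E) Z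
      (TotalSpace.proj : BCotangentBundle E Z → M) p := by
  refine .of_surjective (Eventually.of_forall contMDiffAt_cotangent_proj)
    (Eventually.of_forall fun _ => Iff.rfl) fun u => ?_
  obtain ⟨A, hA⟩ := exists_bFrame (E := E) Z p.1
  obtain ⟨v, hv, -⟩ := A.exists_mfderiv_trivialize hA u 0
  exact ⟨v, hv⟩

instance : IsHypersurface (𝓘(ℝ, E).prod 𝓘(ℝ, E →L[ℝ] ℝ)) (cotangentCritical E Z) :=
  .of_isBMapAt isBMapAt_cotangent_proj

theorem liouvilleForm_apply (p : BCotangentBundle E Z)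
    (b : BTangent (𝓘(ℝ, E).prod 𝓘(ℝ, E →L[ℝ] ℝ)) (cotangentCritical E Z) p) :
    liouvilleForm E Z p ![b] = p.2 (bMap (𝓘(ℝ, E).prod 𝓘(ℝ, E →L[ℝ] ℝ)) (cotangentCritical E Z)
      𝓘(ℝ, E) Z (TotalSpace.proj : BCotangentBundle E Z → M) p b) := rfl

theorem BFrame.smoothNear_covec (A : BFrame (E := E) Z) {p : BCotangentBundle E Z}
    (hp : p.1 ∈ A.U) (w : E) :
    SmoothNear (𝓘(ℝ, E).prod 𝓘(ℝ, E →L[ℝ] ℝ)) (fun q => A.covec q w) p := by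
  filter_upwards [(contMDiffAt_cotangent_proj p).continuousAt.eventually
    (A.isOpen.mem_nhds hp)] with q hq
  exact (A.contMDiffAt_covec hq).clm_apply contMDiffAt_const

theorem BFrame.dir_covec (A : BFrame (E := E) Z) {p : BCotangentBundle E Z} (hp : p.1 ∈ A.U)
    (w : E) (v : TangentSpace (𝓘(ℝ, E).prod 𝓘(ℝ, E →L[ℝ] ℝ)) p) :
    dir (𝓘(ℝ, E).prod 𝓘(ℝ, E →L[ℝ] ℝ)) (fun q => A.covec q w) p v = A.dcovec p v w := by
  unfold dir
  let ev : (E →L[ℝ] ℝ) →L[ℝ] ℝ := ContinuousLinearMap.apply ℝ ℝ w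
  change mfderiv _ 𝓘(ℝ) (ev ∘ A.covec) p v = _
  rw [mfderiv_comp p ev.mdifferentiableAt ((A.contMDiffAt_covec hp).mdifferentiableAt (by simp)),
    ev.mfderiv_eq]
  rfl

/-- In a frame `λ = ∑ pᵢ eⁱ`, with the fibre coordinates as coefficients. The coframe `eⁱ` is pulled
back from `M`, so against a vertical vector only the part `dpᵢ ∧ eⁱ` of the differential
contributes. -/
theorem exists_hasDAt_liouvilleForm (A : BFrame (E := E) Z) {p : BCotangentBundle E Z}
    (hp : p.1 ∈ A.U) : ∃ η, HasDAt p (liouvilleForm E Z) η ∧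
      ∀ b c, bMap (𝓘(ℝ, E).prod 𝓘(ℝ, E →L[ℝ] ℝ)) (cotangentCritical E Z)
        𝓘(ℝ, E) Z (TotalSpace.proj : BCotangentBundle E Z → M) p c = 0 →
        η ![b, c] = - A.dcovec p (anchor _ _ c) (A.coord p.1
            (bMap (𝓘(ℝ, E).prod 𝓘(ℝ, E →L[ℝ] ℝ)) (cotangentCritical E Z)
        𝓘(ℝ, E) Z (TotalSpace.proj : BCotangentBundle E Z → M) p b)) := by
  obtain ⟨η, h1, h2⟩ := HasDAt.of_frame A (isBMapAt_cotangent_proj p) hp (α := liouvilleForm E Z)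
    (A.smoothNear_covec hp) (by
      filter_upwards [(contMDiffAt_cotangent_proj p).continuousAt.eventually
        (A.isOpen.mem_nhds hp)] with q hq b
      rw [liouvilleForm_apply, A.covec_coord hq])
  refine ⟨η, h1, fun b c hc => ?_⟩
  obtain ⟨l, hl, hl'⟩ := h2 b c hc
  rw [hl', hl, A.dir_covec hp]

variable (E Z) in
theorem hasD_liouvilleForm : (liouvilleForm E Z).HasD := fun p => by
  obtain ⟨A, hA⟩ := exists_bFrame (E := E) Z p.1
  obtain ⟨η, h, -⟩ := exists_hasDAt_liouvilleForm A hA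
  exact ⟨η, h⟩

theorem alternatingMap_two_swap {V : Type*} [AddCommGroup V] [Module ℝ V]
    (η : V [⋀^Fin 2]→ₗ[ℝ] ℝ) (b c : V) : η ![c, b] = - η ![b, c] := by
  have := η.map_swap ![b, c] (i := 0) (j := 1) (by simp)
  rw [← this]
  congr 1
  ext i
  fin_cases i <;> rfl

theorem BTangent.eq_zero_of_isDefFun {E : Type*} [NormedAddCommGroup E] [NormedSpace ℝ E]
    [FiniteDimensional ℝ E] {B : Type*} [TopologicalSpace B] {I : ModelWithCorners ℝ E B}
    [I.Boundaryless] {M : Type*} [TopologicalSpace M] [ChartedSpace B M] [IsManifold I ∞ M]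
    {Z : Set M} {x : M} {b : BTangent I Z x} {f : M → ℝ} (hf : IsDefFun I Z f x)
    (h : anchor I Z b = 0) (h' : dlog I Z f b = 0) : b = 0 :=
  BTangent.ext_dlog hf (by rw [h, map_zero]) (by rw [h', map_zero])

/-- Pairing `b` with vertical vectors tests its projection against all covectors, so `b` is
vertical. Pairing a vertical `b` with all vectors tests its fibre component against all vectors of
the base, so that component vanishes too. -/
theorem canonicalForm_nondegenerate (p : BCotangentBundle E Z)
    (b : BTangent (𝓘(ℝ, E).prod 𝓘(ℝ, E →L[ℝ] ℝ)) (cotangentCritical E Z) p)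
    (h : ∀ c, canonicalForm E Z p ![b, c] = 0) : b = 0 := by
  obtain ⟨A, hA⟩ := exists_bFrame (E := E) Z p.1
  obtain ⟨η, h1, h2⟩ := exists_hasDAt_liouvilleForm A hA
  have h0 : ∀ c, η ![b, c] = 0 := fun c => by
    have := h c
    rw [canonicalForm] at this
    rw [← h1.d_eq]
    exact neg_eq_zero.1 this
  have hF := isBMapAt_cotangent_proj p
  have hf := A.isDefFun p.1 hA
  have hb : bMap (𝓘(ℝ, E).prod 𝓘(ℝ, E →L[ℝ] ℝ)) (cotangentCritical E Z)
        𝓘(ℝ, E) Z (TotalSpace.proj : BCotangentBundle E Z → M) p b = 0 := by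
    apply (A.coord_bijective hA).1
    rw [map_zero]
    by_contra hne
    -- `δ` is a norming functional of the coordinates `u ≠ 0` of `τ_* b`, and `c` is the vertical
    -- `b`-vector with fibre component `δ`; then `η ![b, c] = -‖u‖`.
    obtain ⟨δ, -, hδ⟩ := exists_dual_vector ℝ _ (norm_ne_zero_iff.2 hne)
    obtain ⟨v, hv, hv'⟩ := A.exists_mfderiv_trivialize hA 0 δ
    obtain ⟨c, hc, hc'⟩ := BTangent.exists_anchor_dlog (hF.comp _ hf) v 0 (by
      rw [dir_comp hf.smoothNear.contMDiffAt hF.smooth.self_of_nhds, hv, mul_zero]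
      exact dir_zero _)
    have h3 := h2 b c ((bMap_eq_zero_iff hf hF).2 ⟨by rw [hc]; exact hv, hc'⟩)
    rw [h0, hc, hv', hδ] at h3
    apply hne
    simpa using h3
  have hb' := (bMap_eq_zero_iff hf hF).1 hb
  have hs := bMap_surjective hF fun u => by
    obtain ⟨v, hv, -⟩ := A.exists_mfderiv_trivialize hA u 0
    exact ⟨v, hv⟩
  -- Since `b` is vertical, the formula for `η` applies with `b` in the second place, and the
  -- coordinates of `τ_* c` exhaust `E`.
  have hz : anchor _ _ b = 0 := by
    refine A.eq_zero_of_mfderiv hA hb'.1 ?_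
    ext w
    obtain ⟨e, rfl⟩ := (A.coord_bijective hA).2 w
    obtain ⟨c, rfl⟩ := hs e
    have h3 := h2 c b hb
    rw [alternatingMap_two_swap, h0 c, neg_zero] at h3
    exact neg_eq_zero.1 h3.symm
  exact BTangent.eq_zero_of_isDefFun (hF.comp _ hf) hz hb'.2

/-- `-dα` is the differential of `-α`, so its smoothness and closedness are instances of the general
calculus; nondegeneracy alone is special to `α`. -/
theorem isSymplectic_neg_d {E : Type*} [NormedAddCommGroup E] [NormedSpace ℝ E]
    [FiniteDimensional ℝ E] {B : Type*} [TopologicalSpace B] {I : ModelWithCorners ℝ E B}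
    [I.Boundaryless] {M : Type*} [TopologicalSpace M] [ChartedSpace B M] [IsManifold I ∞ M]
    {Z : Set M} [IsHypersurface I Z] {α : BForm I Z 1} (hα : α.HasD)
    (h : ∀ (x : M) (b : BTangent I Z x), (∀ c, (-α.d) x ![b, c] = 0) → b = 0) :
    (-α.d).IsSymplectic := by
  rw [← hα.d_neg] at h ⊢
  exact ⟨hα.neg.isSmooth_d, fun x V hV => hα.neg.koszul_d hV, h⟩

variable (E Z) in
theorem isSymplectic_canonicalForm : (canonicalForm E Z).IsSymplectic :=
  isSymplectic_neg_d (hasD_liouvilleForm E Z) canonicalForm_nondegenerate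

end CanonicalForm


/-! ### Frames as `b`-vector fields, and coordinates of lifts. -/

section FrameFields

variable {E : Type*} [NormedAddCommGroup E] [NormedSpace ℝ E] [FiniteDimensional ℝ E]
  {M : Type*} [TopologicalSpace M] [ChartedSpace E M] [IsManifold 𝓘(ℝ, E) ∞ M]
  {Z : Set M} {x : M}

theorem contMDiffAt_of_dual {E' : Type*} [NormedAddCommGroup E'] [NormedSpace ℝ E']
    {B' : Type*} [TopologicalSpace B'] {J : ModelWithCorners ℝ E' B'}
    {N : Type*} [TopologicalSpace N] [ChartedSpace B' N] {f : N → E} {x : N}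
    (h : ∀ l : E →L[ℝ] ℝ, ContMDiffAt J 𝓘(ℝ) ∞ (fun y => l (f y)) x) :
    ContMDiffAt J 𝓘(ℝ, E) ∞ f x := by
  let e := Module.finBasis ℝ E
  have h1 : f = fun y => ∑ i, LinearMap.toContinuousLinearMap (e.coord i) (f y) • e i :=
    funext fun y => (e.sum_repr (f y)).symm
  rw [h1]
  exact contMDiffAt_finsetSum fun i _ => (h _).smul contMDiffAt_const

/-- The fibre coordinate in the tangent bundle at `x` is the derivative of the chart at `x` applied
to `V`. -/
theorem contMDiffAt_vectorField_iff {V : ∀ x : M, TangentSpace 𝓘(ℝ, E) x} :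
    ContMDiffAt 𝓘(ℝ, E) 𝓘(ℝ, E).tangent ∞ (fun z => (⟨z, V z⟩ : TangentBundle 𝓘(ℝ, E) M)) x ↔
      ContMDiffAt 𝓘(ℝ, E) 𝓘(ℝ, E) ∞ (fun y => chartCoord (chartAt E x) y (V y)) x := by
  have : IsManifold 𝓘(ℝ, E) 1 M := IsManifold.of_le (n := ∞) (by simp)
  rw [Bundle.contMDiffAt_totalSpace]
  refine (and_iff_right contMDiffAt_id).trans (Filter.EventuallyEq.contMDiffAt_iff ?_)
  filter_upwards [(chartAt E x).open_source.mem_nhds (mem_chart_source E x)] with y hy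
  have h3 := TangentBundle.continuousLinearMapAt_trivializationAt (I := 𝓘(ℝ, E)) (x₀ := x) hy
  have h4 := Trivialization.continuousLinearMapAt_apply_of_mem ℝ
    (trivializationAt E (TangentSpace 𝓘(ℝ, E)) x) (b := y) (by simpa using hy) (V y)
  rw [h3] at h4
  rw [← h4]
  simp [chartCoord]

variable (A : BFrame (E := E) Z)

/-- In the chart at `x` the field is the derivative of the transition map from `A.φ`, applied to the
smooth map `anchorCoord`. -/
theorem BFrame.contMDiffAt_vecAnchor (hx : x ∈ A.U) (w : E) :
    ContMDiffAt 𝓘(ℝ, E) 𝓘(ℝ, E).tangent ∞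
      (fun z => (⟨z, A.vecAnchor z w⟩ : TangentBundle 𝓘(ℝ, E) M)) x := by
  rw [contMDiffAt_vectorField_iff]
  have hφ : ∀ y ∈ (chartAt E x).source, ContMDiffAt 𝓘(ℝ, E) 𝓘(ℝ, E) ∞ (chartAt E x) y :=
    fun y hy => contMDiffAt_of_mem_maximalAtlas (IsManifold.chart_mem_maximalAtlas x) hy
  have h1 := contMDiffAt_fderiv_chart A.φ_mem (A.subset hx) (hφ x (mem_chart_source E x))
  refine (h1.clm_apply ((A.contMDiffAt_anchorCoord hx).clm_apply
    (contMDiffAt_const (c := w)))).congr_of_eventuallyEq ?_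
  filter_upwards [A.isOpen.mem_nhds hx, (chartAt E x).open_source.mem_nhds (mem_chart_source E x)]
    with y hy hy'
  rw [A.vecAnchor_eq hy]
  exact mfderiv_chartVec A.φ_mem (A.subset hy) (hφ y hy') _

theorem BFrame.dir_vecAnchor {y : M} (hy : y ∈ A.U) (w : E) :
    dir 𝓘(ℝ, E) A.f y (A.vecAnchor y w) = dir 𝓘(ℝ, E) A.f y (chartVec A.φ y w) * A.f y := by
  rw [← A.anchor_vec hy, dir_anchor _ (A.isDefFun y hy), A.dlog_vec hy, mul_comm]

variable [hZ : IsHypersurface 𝓘(ℝ, E) Z]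

theorem BFrame.isBVectorFieldAt_vecAnchor (hx : x ∈ A.U) (w : E) :
    IsBVectorFieldAt 𝓘(ℝ, E) Z (fun y => A.vecAnchor y w) x := by
  refine .of_dir_eq_mul (k := fun y => dir 𝓘(ℝ, E) A.f y (chartVec A.φ y w)) ?_
    (A.isDefFun x hx) ?_
  · filter_upwards [A.isOpen.mem_nhds hx] with y hy using A.contMDiffAt_vecAnchor hy w
  · filter_upwards [A.isOpen.mem_nhds hx] with y hy using A.dir_vecAnchor hy w

/-- The frame consists of `b`-vector fields. -/
theorem BFrame.bLift_vecAnchor (hx : x ∈ A.U) (w : E) :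
    bLift 𝓘(ℝ, E) Z (fun y => A.vecAnchor y w) x = A.vec x w := by
  refine (A.isBVectorFieldAt_vecAnchor hx w).bLift_eq (A.isDefFun x hx)
    (k := fun y => dir 𝓘(ℝ, E) A.f y (chartVec A.φ y w)) ?_ ?_ (A.anchor_vec hx w)
    (A.dlog_vec hx w)
  · have h := (contMDiffAt_fderiv_chart A.φ_mem (A.subset hx) (A.contMDiffAt_f hx)).clm_apply
      (contMDiffAt_const (c := w))
    refine h.continuousAt.congr ?_
    filter_upwards [A.isOpen.mem_nhds hx] with y hy
    exact (dir_chartVec A.φ_mem (A.subset hy) (A.contMDiffAt_f hy) w).symm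
  · filter_upwards [A.isOpen.mem_nhds hx] with y hy using A.dir_vecAnchor hy w

/-- Tested on functionals `l`: by `BFrame.apply_coord` the component is `V (l ∘ φ)` plus a smooth
multiple of `dlog f` on the lift of `V`, and the latter is smooth up to `Z`. -/
theorem BFrame.contMDiffAt_coord_bLift (hx : x ∈ A.U) {V : ∀ x : M, TangentSpace 𝓘(ℝ, E) x}
    (hV : IsBVectorFieldAt 𝓘(ℝ, E) Z V x) :
    ContMDiffAt 𝓘(ℝ, E) 𝓘(ℝ, E) ∞ (fun y => A.coord y (bLift 𝓘(ℝ, E) Z V y)) x := by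
  refine contMDiffAt_of_dual fun l => ?_
  have hl : SmoothNear 𝓘(ℝ, E) (fun y => l (A.φ y)) x := by
    filter_upwards [A.isOpen.mem_nhds hx] with y hy
    exact (l.contMDiff.contMDiffAt).comp y (A.contMDiffAt_φ hy)
  have h1 := ((contMDiffAt_const (c := (1 : ℝ))).sub (A.contMDiffAt_f hx)).mul
    ((l.contMDiff.contMDiffAt).comp x (A.smooth x hx))
  refine ((hV.smoothNear_dir hl).contMDiffAt.add
    (h1.mul (hV.smoothNear_dlog (A.isDefFun x hx)).contMDiffAt)).congr_of_eventuallyEq ?_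
  filter_upwards [A.isOpen.mem_nhds hx, hV.eventually_isBVectorFieldAt] with y hy h
  rw [A.apply_coord hy, bDiff_apply, h.anchor_bLift]
  rfl

end FrameFields

/-! ### The bundle `𝓗°` and the product `𝓗° × 𝔥*`. -/

section AnnBundle

variable {E : Type*} [NormedAddCommGroup E] [NormedSpace ℝ E] [FiniteDimensional ℝ E]
  {G : Type*} [TopologicalSpace G] [ChartedSpace E G] [Group G] [LieGroup 𝓘(ℝ, E) ∞ G]
  {H : Subgroup G} [hH : IsHypersurface 𝓘(ℝ, E) (H : Set G)]
  {E' : Type*} [NormedAddCommGroup E'] [NormedSpace ℝ E']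
  {B' : Type*} [TopologicalSpace B'] {J : ModelWithCorners ℝ E' B'}
  {N : Type*} [TopologicalSpace N] [ChartedSpace B' N]

/-- The inclusion of `𝓗°` into the `b`-cotangent bundle. -/
def annToCotangent (α : AnnBundle E H) : BCotangentBundle E (H : Set G) := ⟨α.1, α.2.1⟩

theorem BFrame.contMDiffAt_vec_dlog (B : BFrame (E := E) (H : Set G)) (A : AnnFrame E H) {y : G}
    (hB : y ∈ B.U) (hA : y ∈ A.U) (w : E) : ContMDiffAt 𝓘(ℝ, E) 𝓘(ℝ) ∞
      (fun y => dlog 𝓘(ℝ, E) (H : Set G) A.f (B.vec y w)) y :=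
  (B.contMDiffAt_dlog hB (A.isDefFun y hA)).clm_apply (contMDiffAt_const (c := w))

/-- The frames `df / f` of `𝓗°` and the frames of `ᵇT*G` define the same notion of smoothness: the
components of `a df / f` are `a` times smooth functions, one of which is nonzero, so `a` is
recovered by smooth division. -/
theorem contMDiffAt_annToCotangent_comp_iff {f : N → AnnBundle E H} {x : N} (A : AnnFrame E H)
    (hA : (f x).1 ∈ A.U) :
    ContMDiffAt J (𝓘(ℝ, E).prod 𝓘(ℝ, E →L[ℝ] ℝ)) ∞ (fun y => annToCotangent (f y)) x ↔
      ContMDiffAt J 𝓘(ℝ, E) ∞ (fun y => (f y).1) x ∧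
        ContMDiffAt J 𝓘(ℝ) ∞ (fun y => A.coord (f y).1 (f y).2) x := by
  obtain ⟨B, hB⟩ := exists_bFrame (E := E) (H : Set G) (f x).1
  rw [contMDiffAt_cotangent_iff B (f := fun y => annToCotangent (f y)) hB]
  refine and_congr_right fun h => ?_
  have h : ContMDiffAt J 𝓘(ℝ, E) ∞ (fun y => (f y).1) x := h
  have hA' := h.continuousAt.eventually (A.isOpen.mem_nhds hA)
  have hd := fun w => ContMDiffAt.comp x (B.contMDiffAt_vec_dlog A hB hA w) h
  have e : ∀ y, (f y).1 ∈ A.U → ∀ w, B.covec (annToCotangent (f y)) w =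
      A.coord (f y).1 (f y).2 * dlog 𝓘(ℝ, E) (H : Set G) A.f (B.vec (f y).1 w) :=
    fun y hy w => A.apply_eq hy (f y).2 _
  constructor
  · intro h'
    -- The direction dual to `df / f` at the base point: the divisor is `1` there, hence nonzero
    -- nearby.
    set w := B.coord (f x).1 (A.dual (f x).1)
    have h0 : dlog 𝓘(ℝ, E) (H : Set G) A.f (B.vec (f x).1 w) ≠ 0 := by
      rw [B.vec_coord hB, A.dlog_dual hA]
      exact one_ne_zero
    refine ((h'.clm_apply (contMDiffAt_const (c := w))).div₀ (hd w) h0).congr_of_eventuallyEq ?_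
    filter_upwards [hA', (hd w).continuousAt.eventually_ne h0] with y hy hy0
    change _ = B.covec (annToCotangent (f y)) w / _
    rw [e y hy]
    exact (mul_div_cancel_right₀ _ hy0).symm
  · refine fun h' => contMDiffAt_clm_of_apply fun w => (h'.mul (hd w)).congr_of_eventuallyEq ?_
    filter_upwards [hA'] with y hy using e y hy w

/-- A map to `𝓗°` is smooth if and only if it is smooth as a map to the `b`-cotangent bundle. -/
theorem contMDiffAt_annBundle_iff {f : N → AnnBundle E H} {x : N} :
    ContMDiffAt J (𝓘(ℝ, E).prod 𝓘(ℝ)) ∞ f x ↔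
      ContMDiffAt J (𝓘(ℝ, E).prod 𝓘(ℝ, E →L[ℝ] ℝ)) ∞ (fun y => annToCotangent (f y)) x := by
  rw [contMDiffAt_annToCotangent_comp_iff ((annFrameFamily E H).idx (f x).1)
    ((annFrameFamily E H).mem_idx (f x).1), Bundle.contMDiffAt_totalSpace]
  rfl

theorem contMDiffAt_annBundle_iff_coord {f : N → AnnBundle E H} {x : N} (A : AnnFrame E H)
    (hA : (f x).1 ∈ A.U) :
    ContMDiffAt J (𝓘(ℝ, E).prod 𝓘(ℝ)) ∞ f x ↔ ContMDiffAt J 𝓘(ℝ, E) ∞ (fun y => (f y).1) x ∧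
        ContMDiffAt J 𝓘(ℝ) ∞ (fun y => A.coord (f y).1 (f y).2) x :=
  contMDiffAt_annBundle_iff.trans (contMDiffAt_annToCotangent_comp_iff A hA)

theorem contMDiffAt_ann_proj (α : AnnBundle E H) :
    ContMDiffAt (𝓘(ℝ, E).prod 𝓘(ℝ)) 𝓘(ℝ, E) ∞ (TotalSpace.proj : AnnBundle E H → G) α := by
  obtain ⟨A, hA⟩ := exists_annFrame E H α.1
  exact ((contMDiffAt_annBundle_iff_coord (f := id) A hA).1 contMDiffAt_id).1

/-- Through each element passes the local section with constant coordinate in a frame, so the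
projection is a submersion. -/
theorem isBMapAt_ann_proj (α : AnnBundle E H) :
    IsBMapAt (𝓘(ℝ, E).prod 𝓘(ℝ)) (annCritical E H) 𝓘(ℝ, E) (H : Set G)
      (TotalSpace.proj : AnnBundle E H → G) α := by
  refine .of_surjective (Eventually.of_forall contMDiffAt_ann_proj)
    (Eventually.of_forall fun _ => Iff.rfl) fun u => ?_
  obtain ⟨A, hA⟩ := exists_annFrame E H α.1
  refine mfderiv_surjective_of_section
    (σ := fun y => (⟨y, A.vec y (A.coord α.1 α.2)⟩ : AnnBundle E H)) (contMDiffAt_ann_proj α) ?_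
    (congrArg (TotalSpace.mk α.1) (A.vec_coord hA α.2)) (Eventually.of_forall fun _ => rfl) u
  refine (contMDiffAt_annBundle_iff_coord A hA).2 ⟨contMDiffAt_id,
    (contMDiffAt_const (c := A.coord α.1 α.2)).congr_of_eventuallyEq ?_⟩
  filter_upwards [A.isOpen.mem_nhds hA] with y hy using A.coord_vec hy _

instance : IsHypersurface (𝓘(ℝ, E).prod 𝓘(ℝ)) (annCritical E H) := .of_isBMapAt isBMapAt_ann_proj

theorem isBMapAt_ann_fst (n : AnnBundle E H × (lieAlg E H →L[ℝ] ℝ)) :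
    IsBMapAt (annDualModel E H) (annDualCritical E H) (𝓘(ℝ, E).prod 𝓘(ℝ)) (annCritical E H)
      (Prod.fst : AnnBundle E H × (lieAlg E H →L[ℝ] ℝ) → AnnBundle E H) n := by
  refine .of_surjective (Eventually.of_forall fun _ => contMDiffAt_fst)
    (Eventually.of_forall fun _ => Iff.rfl) fun u => ?_
  exact mfderiv_surjective_of_section (σ := fun α => (α, n.2)) contMDiffAt_fst
    (contMDiffAt_id.prodMk contMDiffAt_const) rfl (Eventually.of_forall fun _ => rfl) u

instance : IsHypersurface (annDualModel E H) (annDualCritical E H) := .of_isBMapAt isBMapAt_ann_fst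

/-- The projection `𝓗° × 𝔥* → G`. -/
def annDualProj (n : AnnBundle E H × (lieAlg E H →L[ℝ] ℝ)) : G := n.1.proj

theorem isBMapAt_annDualProj (n : AnnBundle E H × (lieAlg E H →L[ℝ] ℝ)) :
    IsBMapAt (annDualModel E H) (annDualCritical E H) 𝓘(ℝ, E) (H : Set G) annDualProj n :=
  (isBMapAt_ann_proj n.1).comp_isBMapAt (isBMapAt_ann_fst n)

theorem bMap_annDualProj (n : AnnBundle E H × (lieAlg E H →L[ℝ] ℝ))
    (b : BTangent (annDualModel E H) (annDualCritical E H) n) :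
    bMap (annDualModel E H) (annDualCritical E H) 𝓘(ℝ, E) (H : Set G) annDualProj n b =
      bMap (𝓘(ℝ, E).prod 𝓘(ℝ)) (annCritical E H) 𝓘(ℝ, E) (H : Set G)
        (TotalSpace.proj : AnnBundle E H → G) n.1
      (bMap (annDualModel E H) (annDualCritical E H) (𝓘(ℝ, E).prod 𝓘(ℝ)) (annCritical E H)
        (Prod.fst : AnnBundle E H × (lieAlg E H →L[ℝ] ℝ) → AnnBundle E H) n b) :=
  bMap_comp (isBMapAt_ann_proj n.1) (isBMapAt_ann_fst n) b

end AnnBundle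


/-! ### The diffeomorphism `ψ_θ` and the form `λ^θ`. -/

section Connection

variable {E : Type*} [NormedAddCommGroup E] [NormedSpace ℝ E] [FiniteDimensional ℝ E]
  {G : Type*} [TopologicalSpace G] [ChartedSpace E G] [Group G] [LieGroup 𝓘(ℝ, E) ∞ G]
  {H : Subgroup G} [hH : IsHypersurface 𝓘(ℝ, E) (H : Set G)]

/-- A connection form in a frame. -/
def BConnection.inFrame (θ : BConnection E H) (B : BFrame (E := E) (H : Set G)) (y : G) :
    E →L[ℝ] lieAlg E H :=
  LinearMap.toContinuousLinearMap ((θ.toFun y).toLinearMap ∘ₗ B.vec y)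

theorem BConnection.inFrame_coord (θ : BConnection E H) (B : BFrame (E := E) (H : Set G)) {y : G}
    (hy : y ∈ B.U) (b : BTangent 𝓘(ℝ, E) (H : Set G) y) :
    θ.inFrame B y (B.coord y b) = θ.toFun y b :=
  congrArg (θ.toFun y) (B.vec_coord hy b)

/-- Smoothness of `θ` is assumed on lifts of `b`-vector fields, and the vectors of a frame are such
lifts. -/
theorem BConnection.contMDiffAt_inFrame (θ : BConnection E H) (B : BFrame (E := E) (H : Set G))
    {y : G} (hy : y ∈ B.U) :
    ContMDiffAt 𝓘(ℝ, E) 𝓘(ℝ, E →L[ℝ] lieAlg E H) ∞ (θ.inFrame B) y := by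
  refine contMDiffAt_clm_of_apply fun w => ?_
  refine (θ.smooth y _ (B.isBVectorFieldAt_vecAnchor hy w)).congr_of_eventuallyEq ?_
  filter_upwards [B.isOpen.mem_nhds hy] with z hz
  rw [B.bLift_vecAnchor hz]
  rfl

/-- The infinitesimal action in a frame. -/
def zetaInFrame (B : BFrame (E := E) (H : Set G)) (y : G) : lieAlg E H →L[ℝ] E :=
  (B.coord y).comp (zetaL E H y)

/-- `ζ(X)` is the lift of the right-invariant field generated by `X`, and the coordinates of lifts
are smooth. -/
theorem contMDiffAt_zetaInFrame (B : BFrame (E := E) (H : Set G)) {y : G} (hy : y ∈ B.U) :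
    ContMDiffAt 𝓘(ℝ, E) 𝓘(ℝ, lieAlg E H →L[ℝ] E) ∞ (zetaInFrame B) y :=
  contMDiffAt_clm_of_apply fun X =>
    B.contMDiffAt_coord_bLift hy (isBVectorFieldAt_rightField X.2 y)

/-- In a frame this is `p ↦ (p - p ∘ ζ ∘ θ, p ∘ ζ)`, with `ζ` and `θ` depending smoothly on the base
point; smoothness of the component in `𝓗°` may be tested in `ᵇT*G`. -/
theorem contMDiff_psi (θ : BConnection E H) :
    ContMDiff (𝓘(ℝ, E).prod 𝓘(ℝ, E →L[ℝ] ℝ)) (annDualModel E H) ∞ (psi θ) := by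
  intro p
  obtain ⟨B, hB⟩ := exists_bFrame (E := E) (H : Set G) p.1
  have hp := contMDiffAt_cotangent_proj p
  have hU := hp.continuousAt.eventually (B.isOpen.mem_nhds hB)
  have h1 := B.contMDiffAt_covec hB
  have h2 := ContMDiffAt.comp p (contMDiffAt_zetaInFrame B hB) hp
  have h3 := ContMDiffAt.comp p (θ.contMDiffAt_inFrame B hB) hp
  have h4 := h1.clm_comp h2
  have e4 : ∀ q : BCotangentBundle E (H : Set G), q.1 ∈ B.U →
      (B.covec q).comp (zetaInFrame B q.1) = q.2.comp (zetaL E H q.1) := fun q hq => by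
    ext X
    exact B.covec_coord hq _
  refine ContMDiffAt.prodMk ?_ ?_
  · rw [contMDiffAt_annBundle_iff, contMDiffAt_cotangent_iff B hB]
    refine ⟨hp, (h1.sub (h4.clm_comp h3)).congr_of_eventuallyEq ?_⟩
    filter_upwards [hU] with q hq
    change _ = B.covec q - ((B.covec q).comp (zetaInFrame B q.1)).comp (θ.inFrame B q.1)
    rw [e4 q hq]
    rfl
  · refine h4.congr_of_eventuallyEq ?_
    filter_upwards [hU] with q hq using (e4 q hq).symm

/-- The inverse `(α, μ) ↦ α + μ ∘ θ` of `ψ_θ`. -/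
def psiInv (θ : BConnection E H) (n : AnnBundle E H × (lieAlg E H →L[ℝ] ℝ)) :
    BCotangentBundle E (H : Set G) :=
  ⟨n.1.proj, n.1.2.1 + n.2.comp (θ.toFun n.1.proj)⟩

theorem contMDiff_psiInv (θ : BConnection E H) :
    ContMDiff (annDualModel E H) (𝓘(ℝ, E).prod 𝓘(ℝ, E →L[ℝ] ℝ)) ∞ (psiInv θ) := by
  intro n
  obtain ⟨B, hB⟩ := exists_bFrame (E := E) (H : Set G) n.1.proj
  have hp : ContMDiffAt (annDualModel E H) 𝓘(ℝ, E) ∞ annDualProj n :=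
    ContMDiffAt.comp n (contMDiffAt_ann_proj n.1) contMDiffAt_fst
  have h1 : ContMDiffAt (annDualModel E H) (𝓘(ℝ, E).prod 𝓘(ℝ, E →L[ℝ] ℝ)) ∞
      (fun n : AnnBundle E H × (lieAlg E H →L[ℝ] ℝ) => annToCotangent n.1) n :=
    contMDiffAt_annBundle_iff.1 contMDiffAt_fst
  have h2 := ((contMDiffAt_cotangent_iff B hB).1 h1).2
  have h3 := ContMDiffAt.comp n (θ.contMDiffAt_inFrame B hB) hp
  have h4 : ContMDiffAt (annDualModel E H) 𝓘(ℝ, lieAlg E H →L[ℝ] ℝ) ∞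
    (Prod.snd : AnnBundle E H × (lieAlg E H →L[ℝ] ℝ) → _) n := contMDiffAt_snd
  exact (contMDiffAt_cotangent_iff B hB).2 ⟨hp, h2.add (h4.clm_comp h3)⟩

theorem psiInv_psi (θ : BConnection E H) (p : BCotangentBundle E (H : Set G)) :
    psiInv θ (psi θ p) = p := by
  refine congrArg (TotalSpace.mk p.1) ?_
  exact sub_add_cancel _ _

/-- `α` annihilates the image of `ζ` and `θ ∘ ζ = id`, so `(α + μ ∘ θ) ∘ ζ = μ`; subtracting `μ ∘ θ`
leaves `α`. -/
theorem psi_psiInv (θ : BConnection E H) (n : AnnBundle E H × (lieAlg E H →L[ℝ] ℝ)) :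
    psi θ (psiInv θ n) = n := by
  have h : (n.1.2.1 + n.2.comp (θ.toFun n.1.proj)).comp (zetaL E H n.1.proj) = n.2 := by
    ext X
    change n.1.2.1 (zeta H n.1.proj X) + n.2 (θ.toFun n.1.proj (zeta H n.1.proj X)) = n.2 X
    rw [n.1.2.2 X, θ.apply_zeta, zero_add]
  refine Prod.ext (congrArg (TotalSpace.mk n.1.proj) (Subtype.ext ?_)) h
  change n.1.2.1 + n.2.comp (θ.toFun n.1.proj) -
    ((n.1.2.1 + n.2.comp (θ.toFun n.1.proj)).comp (zetaL E H n.1.proj)).comp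
      (θ.toFun n.1.proj) = n.1.2.1
  rw [h, add_sub_cancel_right]

/-- The diffeomorphism `ψ_θ`. -/
def psiDiffeomorph (θ : BConnection E H) :
    Diffeomorph (𝓘(ℝ, E).prod 𝓘(ℝ, E →L[ℝ] ℝ)) (annDualModel E H)
        (BCotangentBundle E (H : Set G)) (AnnBundle E H × (lieAlg E H →L[ℝ] ℝ)) ∞ where
  toFun := psi θ
  invFun := psiInv θ
  left_inv := psiInv_psi θ
  right_inv := psi_psiInv θ
  contMDiff_toFun := contMDiff_psi θ
  contMDiff_invFun := contMDiff_psiInv θ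

/-- `psiInv` covers the identity of `G`, so a defining function of `H` has the same pull-back to `𝓗°
× 𝔥*` directly and through `ᵇT*G`. -/
theorem isBMapAt_psiInv (θ : BConnection E H) (n : AnnBundle E H × (lieAlg E H →L[ℝ] ℝ)) :
    IsBMapAt (annDualModel E H) (annDualCritical E H) (𝓘(ℝ, E).prod 𝓘(ℝ, E →L[ℝ] ℝ))
      (cotangentCritical E (H : Set G)) (psiInv θ) n := by
  obtain ⟨f, hf⟩ := hH.exists_defFun n.1.proj
  exact .of_isDefFun (Eventually.of_forall (contMDiff_psiInv θ))
    ((isBMapAt_cotangent_proj (psiInv θ n)).comp f hf) ((isBMapAt_annDualProj n).comp f hf)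

theorem lambdaForm_apply (θ : BConnection E H) (n : AnnBundle E H × (lieAlg E H →L[ℝ] ℝ))
    (b : BTangent (annDualModel E H) (annDualCritical E H) n) :
    lambdaForm θ n ![b] = n.2 (θ.toFun n.1.proj
      (bMap (annDualModel E H) (annDualCritical E H) 𝓘(ℝ, E) (H : Set G) annDualProj n b)) := by
  rw [bMap_annDualProj]
  rfl

/-- In a frame, `λ^θ` is the smooth covector `μ ∘ θ` applied to the coframe pulled back from `G`, so
`HasDAt.of_frame` applies. -/
theorem hasD_lambdaForm (θ : BConnection E H) : (lambdaForm θ).HasD := fun n => by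
  obtain ⟨B, hB⟩ := exists_bFrame (E := E) (H : Set G) n.1.proj
  have hF := isBMapAt_annDualProj n
  have hU := hF.smooth.self_of_nhds.continuousAt.eventually (B.isOpen.mem_nhds hB)
  obtain ⟨η, hη, -⟩ := HasDAt.of_frame B hF hB (α := lambdaForm θ)
    (a := fun m => m.2.comp (θ.inFrame B m.1.proj)) (fun w => by
      filter_upwards [hU, hF.smooth] with m hm hm'
      have h3 := (ContMDiffAt.comp m (θ.contMDiffAt_inFrame B hm) hm').clm_apply
        (contMDiffAt_const (c := w))
      have h4 : ContMDiffAt (annDualModel E H) 𝓘(ℝ, lieAlg E H →L[ℝ] ℝ) ∞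
        (Prod.snd : AnnBundle E H × (lieAlg E H →L[ℝ] ℝ) → _) m := contMDiffAt_snd
      exact h4.clm_apply h3) (by
      filter_upwards [hU] with m hm b
      rw [lambdaForm_apply]
      exact congrArg m.2 (θ.inFrame_coord B hm _).symm)
  exact ⟨η, hη⟩

end Connection


/-! ### The quotient `G/H`, the map `π̄`, and the comparison of forms. -/

section Quotient

variable {E : Type*} [NormedAddCommGroup E] [NormedSpace ℝ E] [FiniteDimensional ℝ E]
  {G : Type*} [TopologicalSpace G] [ChartedSpace E G] [Group G] [LieGroup 𝓘(ℝ, E) ∞ G]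
  {H : Subgroup G} [hH : IsHypersurface 𝓘(ℝ, E) (H : Set G)]

theorem dlog_congr_nhds {E : Type*} [NormedAddCommGroup E] [NormedSpace ℝ E]
    {B : Type*} [TopologicalSpace B] {I : ModelWithCorners ℝ E B}
    {M : Type*} [TopologicalSpace M] [ChartedSpace B M] {Z : Set M} {x : M} {f f' : M → ℝ}
    (hf : IsDefFun I Z f x) (hf' : IsDefFun I Z f' x) (h : ∀ᶠ y in 𝓝 x, f' y = f y)
    (b : BTangent I Z x) : dlog I Z f' b = dlog I Z f b := by
  rw [dlog_mul b hf hf' (u := fun _ => 1) (Eventually.of_forall fun _ => contMDiffAt_const)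
    (by simpa using h), dir_const_fun, zero_div, add_zero]

/-- Near `g` the projection is a slice followed by the inverse of the chart of `G/H` which that
slice defines. -/
theorem contMDiff_cosetMk : ContMDiff 𝓘(ℝ, E) 𝓘(ℝ) ∞ (CosetSpace.mk E H) := fun g => by
  obtain ⟨S, hS⟩ := exists_slice (E := E) (H := H) g
  have hm : S.chart ∈ atlas ℝ (CosetSpace E H) := mem_range_self S
  have ht : S.s g ∈ S.chart.target := mem_image_of_mem _ hS
  have h1 : ContMDiffAt 𝓘(ℝ) 𝓘(ℝ) ∞ S.chart.symm (S.s g) :=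
    contMDiffAt_symm_of_mem_maximalAtlas (IsManifold.subset_maximalAtlas hm) ht
  refine (h1.comp g (S.smooth g hS)).congr_of_eventuallyEq ?_
  filter_upwards [S.isOpen.mem_nhds hS] with y hy using (S.chart_symm hy).symm

theorem exists_section_cosetMk (g : G) : ∃ σ : CosetSpace E H → G, σ (CosetSpace.mk E H g) = g ∧
    ContMDiffAt 𝓘(ℝ) 𝓘(ℝ, E) ∞ σ (CosetSpace.mk E H g) ∧
      ∀ᶠ q in 𝓝 (CosetSpace.mk E H g), CosetSpace.mk E H (σ q) = q := by
  obtain ⟨S, hS⟩ := exists_slice (E := E) (H := H) g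
  obtain ⟨σ, h1, h2, h3⟩ := S.exists_section hS
  have hm : S.chart ∈ atlas ℝ (CosetSpace E H) := mem_range_self S
  have hs : CosetSpace.mk E H g ∈ S.chart.source := mem_image_of_mem _ hS
  have h4 : ContMDiffAt 𝓘(ℝ) 𝓘(ℝ) ∞ S.chart (CosetSpace.mk E H g) :=
    contMDiffAt_of_mem_maximalAtlas (IsManifold.subset_maximalAtlas hm) hs
  have e := S.chart_mk hS
  rw [← e] at h1 h2 h3
  refine ⟨σ ∘ S.chart, h1, h2.comp _ h4, ?_⟩
  filter_upwards [S.chart.open_source.mem_nhds hs, h4.continuousAt.eventually h3] with q hq hq'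
  change CosetSpace.mk E H (σ (S.chart q)) = q
  rw [← S.chart_symm hq'.1, hq'.2, S.chart.left_inv hq]

/-- Neighbourhoods in `G/H` are images of neighbourhoods in `G`, and near each such point `k = (k ∘
π) ∘ σ` for a smooth local section `σ`. -/
theorem smoothNear_of_comp_cosetMk {k : CosetSpace E H → ℝ} {g : G}
    (h : SmoothNear 𝓘(ℝ, E) (fun y => k (CosetSpace.mk E H y)) g) :
    SmoothNear 𝓘(ℝ) k (CosetSpace.mk E H g) := by
  unfold SmoothNear
  rw [← CosetSpace.map_nhds, eventually_map]
  filter_upwards [h] with y hy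
  obtain ⟨σ, h1, h2, h3⟩ := exists_section_cosetMk (E := E) (H := H) y
  rw [← h1] at hy
  refine (ContMDiffAt.comp _ hy h2).congr_of_eventuallyEq ?_
  filter_upwards [h3] with q hq
  exact (congrArg k hq).symm

theorem cosetMk_eq_one_iff {g : G} : CosetSpace.mk E H g = CosetSpace.mk E H 1 ↔ g ∈ H := by
  rw [CosetSpace.mk_eq, inv_one, mul_one]

theorem exists_mfderiv_cosetMk (g : G) (u : TangentSpace 𝓘(ℝ) (CosetSpace.mk E H g)) :
    ∃ v, mfderiv 𝓘(ℝ, E) 𝓘(ℝ) (CosetSpace.mk E H) g v = u := by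
  obtain ⟨σ, h1, h2, h3⟩ := exists_section_cosetMk (E := E) (H := H) g
  exact mfderiv_surjective_of_section (contMDiff_cosetMk g) h2 h1 h3 u

theorem isBMapAt_cosetMk (g : G) :
    IsBMapAt 𝓘(ℝ, E) (H : Set G) 𝓘(ℝ) {CosetSpace.mk E H 1} (CosetSpace.mk E H) g :=
  .of_surjective (Eventually.of_forall contMDiff_cosetMk)
    (Eventually.of_forall fun _ => cosetMk_eq_one_iff) (exists_mfderiv_cosetMk g)

/-- `A.f` is constant on cosets and so descends to `k = A.f ∘ σ`; regularity descends because `A.f`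
is a submersion. Thus `df / f` is the pull-back of `dk / k`. -/
theorem AnnFrame.exists_isDefFun (A : AnnFrame E H) {g : G} (hg : g ∈ A.U) :
    ∃ k, IsDefFun 𝓘(ℝ) {CosetSpace.mk E H 1} k (CosetSpace.mk E H g) ∧
      ∀ᶠ y in 𝓝 g, k (CosetSpace.mk E H y) = A.f y := by
  obtain ⟨σ, h1, h2, h3⟩ := exists_section_cosetMk (E := E) (H := H) g
  have hm := contMDiff_cosetMk (E := E) (H := H) g
  have hk : ∀ᶠ y in 𝓝 g, A.f (σ (CosetSpace.mk E H y)) = A.f y := by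
    have hU : ∀ᶠ q in 𝓝 (CosetSpace.mk E H g), σ q ∈ A.U :=
      h2.continuousAt.eventually (A.isOpen.mem_nhds (by rwa [h1]))
    filter_upwards [hm.continuousAt.eventually hU, hm.continuousAt.eventually h3,
      A.isOpen.mem_nhds hg] with y h4 h5 h6
    exact A.inv _ h4 _ h6 (CosetSpace.mk_eq.1 h5)
  have hf := A.isDefFun g hg
  refine ⟨A.f ∘ σ, ⟨?_, ?_, fun _ h0 => ?_⟩, hk⟩
  · exact smoothNear_of_comp_cosetMk (hf.smoothNear.congr hk)
  · rw [← CosetSpace.map_nhds, eventually_map]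
    filter_upwards [hk, hf.zero_iff] with y h4 h5
    rw [mem_singleton_iff, cosetMk_eq_one_iff]
    change A.f (σ (CosetSpace.mk E H y)) = 0 ↔ y ∈ H
    rw [h4]
    exact h5
  · obtain ⟨v, hv⟩ := A.regular g hg
    apply hv
    have hs : SmoothNear 𝓘(ℝ) (A.f ∘ σ) (CosetSpace.mk E H g) :=
      smoothNear_of_comp_cosetMk (hf.smoothNear.congr hk)
    have e : (A.f ∘ σ) ∘ CosetSpace.mk E H =ᶠ[𝓝 g] A.f := hk
    rw [← dir_congr_nhds e, dir_comp hs.contMDiffAt hm]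
    unfold dir
    rw [h0]
    rfl

variable {α : AnnBundle E H}

/-- An element of `𝓗°` is a multiple of `df / f = π^*(dk / k)`; the same multiple of `dk / k` is the
covector sought by `piBar`. -/
theorem AnnFrame.coord_smul_dlog (A : AnnFrame E H) (hA : α.1 ∈ A.U) {k : CosetSpace E H → ℝ}
    (hk : IsDefFun 𝓘(ℝ) {CosetSpace.mk E H 1} k (CosetSpace.mk E H α.1))
    (hkA : ∀ᶠ y in 𝓝 α.1, k (CosetSpace.mk E H y) = A.f y)
    (v : BTangent 𝓘(ℝ, E) (H : Set G) α.1) :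
    (A.coord α.1 α.2 • dlog 𝓘(ℝ) {CosetSpace.mk E H 1} k)
      (bMap 𝓘(ℝ, E) (H : Set G) 𝓘(ℝ) {CosetSpace.mk E H 1} (CosetSpace.mk E H) α.1 v) =
        α.2.1 v := by
  have hm := isBMapAt_cosetMk (E := E) (H := H) α.1
  rw [A.apply_eq hA α.2 v, _root_.smul_apply, dlog_bMap hm hk,
    dlog_congr_nhds (A.isDefFun _ hA) (hm.comp k hk) hkA]
  rfl

/-- The covector required in the definition of `piBar` exists, so the default value `0` is never
taken by default. -/
theorem piBar_apply (α : AnnBundle E H) (v : BTangent 𝓘(ℝ, E) (H : Set G) α.1) :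
    (piBar α).2 (bMap 𝓘(ℝ, E) (H : Set G) 𝓘(ℝ) {CosetSpace.mk E H 1} (CosetSpace.mk E H) α.1 v) =
      α.2.1 v := by
  obtain ⟨A, hA⟩ := exists_annFrame E H α.1
  obtain ⟨k, hk, hkA⟩ := A.exists_isDefFun hA
  have h : ∃ β : BTangent 𝓘(ℝ) ({CosetSpace.mk E H 1} : Set (CosetSpace E H))
        (CosetSpace.mk E H α.1) →L[ℝ] ℝ,
      ∀ v, β (bMap 𝓘(ℝ, E) (H : Set G) 𝓘(ℝ) {CosetSpace.mk E H 1} (CosetSpace.mk E H) α.1 v) =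
        α.2.1 v := ⟨_, A.coord_smul_dlog hA hk hkA⟩
  have e : (piBar α).2 = h.choose := dif_pos h
  rw [e]
  exact h.choose_spec v

/-- `π_*` is surjective on `b`-tangent spaces, so the defining property of `π̄(α)` determines it. -/
theorem AnnFrame.piBar_snd (A : AnnFrame E H) (hA : α.1 ∈ A.U) {k : CosetSpace E H → ℝ}
    (hk : IsDefFun 𝓘(ℝ) {CosetSpace.mk E H 1} k (CosetSpace.mk E H α.1))
    (hkA : ∀ᶠ y in 𝓝 α.1, k (CosetSpace.mk E H y) = A.f y) :
    (piBar α).2 = A.coord α.1 α.2 • dlog 𝓘(ℝ) {CosetSpace.mk E H 1} k := by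
  have hm := isBMapAt_cosetMk (E := E) (H := H) α.1
  refine ContinuousLinearMap.ext fun b => ?_
  obtain ⟨v, rfl⟩ := bMap_surjective hm (exists_mfderiv_cosetMk α.1) b
  exact (piBar_apply α v).trans (A.coord_smul_dlog hA hk hkA v).symm

/-- The coordinates of `π̄(α)` are the coordinate of `α` in `A` times the smooth components of `dk /
k`. -/
theorem contMDiff_piBar : ContMDiff (𝓘(ℝ, E).prod 𝓘(ℝ)) (𝓘(ℝ).prod 𝓘(ℝ, ℝ →L[ℝ] ℝ)) ∞
    (piBar : AnnBundle E H → BCotangentBundle ℝ ({CosetSpace.mk E H 1} : Set (CosetSpace E H))) := by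
  intro α
  obtain ⟨A, hA⟩ := exists_annFrame E H α.1
  obtain ⟨k, hk, hkA⟩ := A.exists_isDefFun hA
  obtain ⟨C, hC⟩ := exists_bFrame (E := ℝ) ({CosetSpace.mk E H 1} : Set (CosetSpace E H))
    (CosetSpace.mk E H α.1)
  have hp := contMDiffAt_ann_proj α
  have h1 : ContMDiffAt (𝓘(ℝ, E).prod 𝓘(ℝ)) 𝓘(ℝ) ∞
      (fun β : AnnBundle E H => CosetSpace.mk E H β.1) α :=
    ContMDiffAt.comp α (contMDiff_cosetMk α.1) hp
  have h2 := ((contMDiffAt_annBundle_iff_coord (f := id) A hA).1 contMDiffAt_id).2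
  refine (contMDiffAt_cotangent_iff C hC).2 ⟨h1, ?_⟩
  refine (h2.smul (ContMDiffAt.comp α (C.contMDiffAt_dlog hC hk) h1)).congr_of_eventuallyEq ?_
  filter_upwards [hp.continuousAt.eventually (A.isOpen.mem_nhds hA),
    h1.continuousAt.eventually hk.eventually_isDefFun,
    hp.continuousAt.eventually hkA.eventually_nhds] with β h3 h4 h5
  ext
  rw [C.covec_apply, A.piBar_snd h3 h4 h5]
  rfl

/-- `π̄` covers `π`, so pulling `k` back through `ᵇT*(G/H)` or through `G` gives the same function
on `𝓗°`. -/
theorem isBMapAt_piBar (α : AnnBundle E H) :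
    IsBMapAt (𝓘(ℝ, E).prod 𝓘(ℝ)) (annCritical E H) (𝓘(ℝ).prod 𝓘(ℝ, ℝ →L[ℝ] ℝ))
      (cotangentCritical ℝ ({CosetSpace.mk E H 1} : Set (CosetSpace E H))) piBar α := by
  obtain ⟨A, hA⟩ := exists_annFrame E H α.1
  obtain ⟨k, hk, -⟩ := A.exists_isDefFun hA
  exact .of_isDefFun (Eventually.of_forall contMDiff_piBar)
    ((isBMapAt_cotangent_proj (piBar α)).comp k hk)
    (((isBMapAt_cosetMk α.1).comp_isBMapAt (isBMapAt_ann_proj α)).comp k hk)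

/-- Both sides are the `b`-tangent map of one composite, since `τ ∘ π̄` and `π ∘ τ` agree by
definition. -/
theorem bMap_proj_piBar (α : AnnBundle E H)
    (b : BTangent (𝓘(ℝ, E).prod 𝓘(ℝ)) (annCritical E H) α) :
    bMap (𝓘(ℝ).prod 𝓘(ℝ, ℝ →L[ℝ] ℝ))
      (cotangentCritical ℝ ({CosetSpace.mk E H 1} : Set (CosetSpace E H))) 𝓘(ℝ)
      {CosetSpace.mk E H 1} TotalSpace.proj (piBar α)
      (bMap (𝓘(ℝ, E).prod 𝓘(ℝ)) (annCritical E H) (𝓘(ℝ).prod 𝓘(ℝ, ℝ →L[ℝ] ℝ))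
        (cotangentCritical ℝ {CosetSpace.mk E H 1}) piBar α b) =
      bMap 𝓘(ℝ, E) (H : Set G) 𝓘(ℝ) {CosetSpace.mk E H 1} (CosetSpace.mk E H) α.1
        (bMap (𝓘(ℝ, E).prod 𝓘(ℝ)) (annCritical E H) 𝓘(ℝ, E) (H : Set G) TotalSpace.proj α b) :=
  (bMap_comp (isBMapAt_cotangent_proj (piBar α)) (isBMapAt_piBar α) b).symm.trans
    (bMap_comp (isBMapAt_cosetMk α.1) (isBMapAt_ann_proj α) b)

theorem bMap_proj_psiInv (θ : BConnection E H) (n : AnnBundle E H × (lieAlg E H →L[ℝ] ℝ))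
    (b : BTangent (annDualModel E H) (annDualCritical E H) n) :
    bMap (𝓘(ℝ, E).prod 𝓘(ℝ, E →L[ℝ] ℝ)) (cotangentCritical E (H : Set G)) 𝓘(ℝ, E) (H : Set G)
        TotalSpace.proj (psiInv θ n) (bMap (annDualModel E H) (annDualCritical E H)
        (𝓘(ℝ, E).prod 𝓘(ℝ, E →L[ℝ] ℝ)) (cotangentCritical E (H : Set G)) (psiInv θ) n b) =
      bMap (annDualModel E H) (annDualCritical E H) 𝓘(ℝ, E) (H : Set G) annDualProj n b :=
  (bMap_comp (isBMapAt_cotangent_proj (psiInv θ n)) (isBMapAt_psiInv θ n) b).symm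

variable (E H) in
/-- The pull-back of the Liouville form of `ᵇT*(G/H)` to `𝓗° × 𝔥*`. -/
def reducedLiouville : BForm (annDualModel E H) (annDualCritical E H) 1 :=
  BForm.pullback (Prod.fst : AnnBundle E H × (lieAlg E H →L[ℝ] ℝ) → AnnBundle E H)
    (BForm.pullback (I := 𝓘(ℝ, E).prod 𝓘(ℝ)) (Z := annCritical E H) piBar
      (liouvilleForm ℝ ({CosetSpace.mk E H 1} : Set (CosetSpace E H))))

/-- The central computation: on `w`, the covector `α + μ ∘ θ` gives `α(τ_* w) + μ(θ(τ_* w))`, and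
the defining property of `π̄` rewrites `α(τ_* w)` as `π̄(α)` applied to `π_* τ_* w`. -/
theorem pullback_psiInv_liouvilleForm (θ : BConnection E H) :
    BForm.pullback (psiInv θ) (liouvilleForm E (H : Set G)) =
      reducedLiouville E H + lambdaForm θ := by
  funext n
  refine oneForm_ext fun b => ?_
  rw [pullback_apply_one, liouvilleForm_apply, bMap_proj_psiInv, Pi.add_apply,
    AlternatingMap.add_apply, lambdaForm_apply, reducedLiouville, pullback_apply_one,
    pullback_apply_one, liouvilleForm_apply, bMap_proj_piBar, piBar_apply, bMap_annDualProj]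
  rfl

theorem hasD_pullback_piBar : (BForm.pullback (I := 𝓘(ℝ, E).prod 𝓘(ℝ)) (Z := annCritical E H) piBar
      (liouvilleForm ℝ ({CosetSpace.mk E H 1} : Set (CosetSpace E H)))).HasD :=
  (hasD_liouvilleForm ℝ _).pullback isBMapAt_piBar

theorem hasD_reducedLiouville : (reducedLiouville E H).HasD :=
  hasD_pullback_piBar.pullback isBMapAt_ann_fst

theorem reducedForm_eq : reducedForm E H = -(reducedLiouville E H).d := by
  rw [reducedLiouville, hasD_pullback_piBar.d_pullback isBMapAt_ann_fst,
    (hasD_liouvilleForm ℝ _).d_pullback isBMapAt_piBar]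
  rfl

theorem pullback_psiInv_canonicalForm_eq_neg_d (θ : BConnection E H) :
    BForm.pullback (psiInv θ) (canonicalForm E (H : Set G)) =
      -(BForm.pullback (I := annDualModel E H) (Z := annDualCritical E H) (psiInv θ)
        (liouvilleForm E (H : Set G))).d := by
  rw [(hasD_liouvilleForm E (H : Set G)).d_pullback (isBMapAt_psiInv θ)]
  rfl

theorem pullback_psiInv_canonicalForm (θ : BConnection E H) :
    BForm.pullback (psiInv θ) (canonicalForm E (H : Set G)) =
      reducedForm E H - (lambdaForm θ).d := by
  rw [pullback_psiInv_canonicalForm_eq_neg_d, pullback_psiInv_liouvilleForm,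
    hasD_reducedLiouville.d_add (hasD_lambdaForm θ), reducedForm_eq, neg_add, sub_eq_add_neg]

/-- As `-d` of a pulled-back form of the class `HasD`, the form is smooth and closed; nondegeneracy
is transported through the `b`-tangent map of `psiInv`, which is bijective. -/
theorem isSymplectic_pullback_psiInv (θ : BConnection E H) :
    (BForm.pullback (I := annDualModel E H) (Z := annDualCritical E H) (psiInv θ)
      (canonicalForm E (H : Set G))).IsSymplectic := by
  rw [pullback_psiInv_canonicalForm_eq_neg_d]
  refine isSymplectic_neg_d ((hasD_liouvilleForm E (H : Set G)).pullback (isBMapAt_psiInv θ)) ?_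
  rw [← pullback_psiInv_canonicalForm_eq_neg_d]
  intro n b hb
  obtain ⟨f, hf⟩ := (inferInstance : IsHypersurface (𝓘(ℝ, E).prod 𝓘(ℝ, E →L[ℝ] ℝ))
    (cotangentCritical E (H : Set G))).exists_defFun (psiInv θ n)
  have hF := isBMapAt_psiInv θ n
  -- The derivative of the inverse diffeomorphism. Its surjectivity makes the `b`-tangent map onto;
  -- its injectivity shows that a vector with zero image has zero anchor.
  let D := (psiDiffeomorph θ).symm.mfderivToContinuousLinearEquiv (by simp) n
  have hs := bMap_surjective hF fun v => ⟨D.symm v, D.apply_symm_apply v⟩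
  have h0 := canonicalForm_nondegenerate _ _ fun c => by
    obtain ⟨c, rfl⟩ := hs c
    rw [← pullback_apply_two]
    exact hb c
  have h1 := (bMap_eq_zero_iff hf hF).1 h0
  refine BTangent.eq_zero_of_isDefFun (hF.comp f hf) ?_ h1.2
  exact D.injective (h1.1.trans (map_zero D).symm)

end Quotient

end BGeom

end

/-! ### The theorem. -/

theorem mainTheorem3 {E : Type*} [NormedAddCommGroup E] [NormedSpace ℝ E] [FiniteDimensional ℝ E]
    {G : Type*} [TopologicalSpace G] [ChartedSpace E G] [Group G] [LieGroup 𝓘(ℝ, E) ∞ G]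
    (H : Subgroup G) [IsHypersurface 𝓘(ℝ, E) (H : Set G)] (θ : BConnection E H) :
    ∃ Ψ : Diffeomorph (𝓘(ℝ, E).prod 𝓘(ℝ, E →L[ℝ] ℝ)) (annDualModel E H)
        (BCotangentBundle E (H : Set G)) (AnnBundle E H × (lieAlg E H →L[ℝ] ℝ)) ∞,
      (Ψ : BCotangentBundle E (H : Set G) → AnnBundle E H × (lieAlg E H →L[ℝ] ℝ)) = psi θ ∧
      (canonicalForm E (H : Set G)).IsSymplectic ∧
      (canonicalForm ℝ ({CosetSpace.mk E H 1} : Set (CosetSpace E H))).IsSymplectic ∧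
      (lambdaForm θ).IsSmooth ∧
      (reducedForm E H - (lambdaForm θ).d).IsSymplectic ∧
      BForm.pullback (Ψ.symm : AnnBundle E H × (lieAlg E H →L[ℝ] ℝ) →
        BCotangentBundle E (H : Set G)) (canonicalForm E (H : Set G)) =
          reducedForm E H - (lambdaForm θ).d := by
  have h := pullback_psiInv_canonicalForm θ
  -- The inverse of `psiDiffeomorph θ` is `psiInv θ` by definition, so `h` is the asserted identity
  -- and also carries the `b`-symplectic property to its right-hand side.
  exact ⟨psiDiffeomorph θ, rfl, isSymplectic_canonicalForm E _, isSymplectic_canonicalForm ℝ _,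
    (hasD_lambdaForm θ).isSmooth, h ▸ isSymplectic_pullback_psiInv θ, h⟩
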